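/- Notation. For $x,y\ge 0$ and a fixed constant $A\ge 1$ write $x\sim y$ if $A^{-1}y\le x\le Ay$. For $j\in\mathbb N=\{0,1,2,\dots\}$ and $k\in\mathbb R^2$ let $\tau^j_k\subset\mathbb R^2$ be the closed axis-parallel square of side length $2^{-j}$ with lower-left vertex $k$; for $w\in\mathbb S^1$ and $m\in\mathbb R^2$ let $$\mathfrak t^{j}_{w,m}=\{\xi\in[0,2]^2:\ |\xi-m-((\xi-m)\cdot w)\,w|\le 2^{-j}\}.$$ Let $d(\cdot,\cdot)$ be the distance between two sets. A tube $T\subset\mathbb R^3$ is the closed $1$-neighbourhood of a line with unit direction $d(T)$. For a point $p=(\xi,\tfrac12|\xi|^2)$ of the paraboloid let $n(p)=(\xi,-1)/\sqrt{1+|\xi|^2}$ be the unit normal. Let $r,j,t\in\mathbb N$ with $r\le j$, $w\in\mathbb S^1$, $m\in\mathbb R^2$. Finite families $\mathcal T_1,\mathcal T_2,\mathcal T_3$ of tubes (repetitions are allowed) are of $(r,j,t,w,m)$-type (with constant $A$) if there are $S_1,S_2,S_3\subset\{(\xi,\tfrac12|\xi|^2):|\xi|\le 2\}$ and $\theta$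 such that * $|n(p_1)\wedge n(p_2)\wedge n(p_3)|\sim\theta$ for all $p_1\in S_1$, $p_2\in S_2$, $p_3\in S_3$; * for each $n$ and every $T\in\mathcal T_n$ we have $d(T)=n(p)$ for some $p\in S_n$; * possibly after reordering the sets $S_n$, for some $k,k',k''\in\mathbb R^2$ and $w'\in\mathbb S^1$, $$S_1\subset\{(\xi,\tfrac12|\xi|^2):\xi\in\tau^j_k\cap\mathfrak t^{j+t}_{w,m}\},\quad S_2\subset\{(\xi,\tfrac12|\xi|^2):\xi\in\tau^j_{k'}\cap\mathfrak t^{j+t}_{w,m}\},\quad S_3\subset\{(\xi,\tfrac12|\xi|^2):\xi\in\tau^r_{k''}\cap\mathfrak t^{r+t}_{w',m}\},$$ with $m\in\tau^j_k$, $d(\tau^j_k,\tau^j_{k'})\sim2^{-j}$, $d(\tau^j_{k'},\tau^r_{k''})\sim2^{-r}$, $d(\tau^j_k,\tau^r_{k''})\sim2^{-r}$, $|w-w'|\sim2^{-t}$ and $\theta\sim2^{-j}2^{-r}2^{-t}$. Theorem. For every $A\ge1$ and every $\epsilon>0$ there is a constant $C_\epsilon<\infty$, depending only on $\epsilon$ and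 $A$, such that for all $r,j,t,w,m$, all families $\mathcal T_1,\mathcal T_2,\mathcal T_3$ of $(r,j,t,w,m)$-type with constant $A$, and every ball $Q_R\subset\mathbb R^3$ of radius $R>0$ (of radius $R\ge 1$ in case $\epsilon>3$), $$\int_{Q_R}\prod_{n=1}^3\Big(\sum_{T\in\mathcal T_n}\chi_T\Big)^{1/2}\le C_\epsilon\,R^{\epsilon}\,2^{\frac12(j+t+r)}\prod_{n=1}^3|\mathcal T_n|^{1/2}.$$ -/

import Mathlib

open MeasureTheory

noncomputable section

namespace TrilinearKakeya

/-- The plane of frequencies, with the Euclidean norm. -/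
abbrev E2 := EuclideanSpace ℝ (Fin 2)

/-- Three-dimensional Euclidean space. -/
abbrev E3 := EuclideanSpace ℝ (Fin 3)

/-- `x ∼ y` with comparability constant `A`. -/
def Comparable (A x y : ℝ) : Prop := A⁻¹ * y ≤ x ∧ x ≤ A * y

/-- The distance between two sets of the plane, `inf {|x - y| : x ∈ s, y ∈ s'}`. -/
def setDist (s s' : Set E2) : ℝ := sInf (Set.image2 dist s s')

/-- The (closed) square of side length `2 ^ (-j)` whose lower-left vertex is `k`. -/
def square (j : ℕ) (k : E2) : Set E2 :=
  {ξ | ∀ i, k i ≤ ξ i ∧ ξ i ≤ k i + (2 : ℝ) ^ (-(j : ℝ))}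

/-- The strip in `[0, 2]²` of width `2 ^ (-j)` in the direction `w` through the point `m`. -/
def strip (j : ℕ) (w m : E2) : Set E2 :=
  {ξ | (∀ i, 0 ≤ ξ i ∧ ξ i ≤ 2) ∧ ‖ξ - m - inner ℝ (ξ - m) w • w‖ ≤ (2 : ℝ) ^ (-(j : ℝ))}

/-- The point `(ξ, |ξ|² / 2)` of the paraboloid. -/
def lift (ξ : E2) : E3 := !₂[ξ 0, ξ 1, ‖ξ‖ ^ 2 / 2]

/-- The unit normal `(ξ, -1) / √(1 + |ξ|²)` of the paraboloid at its point `p = (ξ, |ξ|² / 2)`. -/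
def unitNormal (p : E3) : E3 := (√(1 + p 0 ^ 2 + p 1 ^ 2))⁻¹ • !₂[p 0, p 1, -1]

/-- `|u ∧ v ∧ z|`, the volume of the parallelepiped spanned by `u, v, z`. -/
def wedge (u v z : E3) : ℝ := |(Matrix.of ![u.ofLp, v.ofLp, z.ofLp]).det|

/-- A tube with unit width (radius `1`), given by a point and a unit direction of its axis.
Different points of the axis describe the same set, so a finite family of tubes in this sense may
contain a geometric tube several times. -/
structure Tube where
  base : E3
  dir : E3
  norm_dir : ‖dir‖ = 1

/-- The set of points at distance at most `1` from the axis. -/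
def Tube.carrier (T : Tube) : Set E3 := {x | ∃ s : ℝ, dist x (T.base + s • T.dir) ≤ 1}

/-- The families `𝒯 0, 𝒯 1, 𝒯 2` are of `(r, j, t, w, m)`-type, where every relation `∼` holds with
the comparability constant `A`. The permutation `σ` is the reordering of the sets `S n`. -/
def IsOfType (A : ℝ) (r j t : ℕ) (w m : E2) (𝒯 : Fin 3 → Finset Tube) : Prop :=
  ‖w‖ = 1 ∧ r ≤ j ∧
  ∃ (S : Fin 3 → Set E3) (θ : ℝ),
    (∀ n, S n ⊆ lift '' {ξ | ‖ξ‖ ≤ 2}) ∧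
    (∀ p₁ ∈ S 0, ∀ p₂ ∈ S 1, ∀ p₃ ∈ S 2,
      Comparable A (wedge (unitNormal p₁) (unitNormal p₂) (unitNormal p₃)) θ) ∧
    (∀ n, ∀ T ∈ 𝒯 n, ∃ p ∈ S n, T.dir = unitNormal p) ∧
    ∃ (σ : Equiv.Perm (Fin 3)) (k k' k'' w' : E2),
      S (σ 0) ⊆ lift '' (square j k ∩ strip (j + t) w m) ∧
      S (σ 1) ⊆ lift '' (square j k' ∩ strip (j + t) w m) ∧
      S (σ 2) ⊆ lift '' (square r k'' ∩ strip (r + t) w' m) ∧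
      m ∈ square j k ∧
      Comparable A (setDist (square j k) (square j k')) ((2 : ℝ) ^ (-(j : ℝ))) ∧
      Comparable A (setDist (square j k') (square r k'')) ((2 : ℝ) ^ (-(r : ℝ))) ∧
      Comparable A (setDist (square j k) (square r k'')) ((2 : ℝ) ^ (-(r : ℝ))) ∧
      ‖w'‖ = 1 ∧
      Comparable A ‖w - w'‖ ((2 : ℝ) ^ (-(t : ℝ))) ∧
      Comparable A θ
        ((2 : ℝ) ^ (-(j : ℝ)) * (2 : ℝ) ^ (-(r : ℝ)) * (2 : ℝ) ^ (-(t : ℝ)))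

end TrilinearKakeya

end

namespace TrilinearKakeya

open scoped ENNReal

/-! Put `X = 2^j`, `τ = 2^t`, `ρ = 2^r`. The factor `√(X * τ * ρ)` is `θ^(-1/2)` up to a constant,
and an anisotropic linear change of variables produces it. After reflecting the third coordinate, a
tube with frequency `ξ` is a graph over the height with slope `ξ`. A shear by a frequency `o` of the
first family, a rotation to the axes along and across `w`, and dilations by `X` and `X * τ` make the
slopes of the first two families bounded and those of the third `X / ρ` times a bounded vector. In
this normalisation the transversality `θ` becomes a determinant bounded below. The tubes turn into
slabs of horizontal widths about `X` and `X * τ`, and the Jacobian is `X * (X * τ)`, so the slab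
integral has to be at most `R^ε * X * (X * τ) * √(X * τ * ρ)` times the cardinality factor
(`exists_slab_estimate`). There are two regimes.

If `R ≥ X * τ`, slabs are covered by unit tubes. A slab of the first two families takes about `X *
(X * τ)` of them; one of the third takes only about `X * τ * ρ`, because its axis has slope of order
`X / ρ`. The square root of the product of these counts is the required factor. Unit tubes with
uniformly transversal directions obey a trilinear Kakeya inequality that loses a small power of the
radius, which is at most of order `X * τ * R ≤ R^2` (`exists_kakeya_slab`).

If `R < X * τ`, this loss cannot be absorbed by a power of `R`. However, at heights in an interval
of length `2 * R` the first two families drift by no more than about `X * τ`. They stay near planes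
parallel to both of their reference directions, and Cauchy–Schwarz on the slices by such planes,
then across the slices, gives the bound without loss (`setLIntegral_slab_le_of_planar`).

The transversal Kakeya inequality follows Guth's induction on scales: at a scale where tubes are
parallel to the axes up to their width it is the Loomis–Whitney inequality, and averaging passes to
fatter tubes at a fixed cost (`exists_slope_kakeya_near_axes`). Splitting the slopes into boundedly
many small cells makes every family nearly parallel (`exists_estimate_of_slopes`). Balls with `R <
1` are settled by their volume. -/

/-! ### Multiplicities and products of square roots -/

/-- The number of sets `U i`, `i ∈ s`, that contain the point `x`. -/
noncomputable def multiplicity {ι α : Type*} (s : Finset ι) (U : ι → Set α) (x : α) : ℝ≥0∞ :=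
  ∑ i ∈ s, (U i).indicator 1 x

/-- The product of the square roots of three extended nonnegative numbers. -/
noncomputable def sqrtProd (a b c : ℝ≥0∞) : ℝ≥0∞ :=
  a ^ (1 / 2 : ℝ) * b ^ (1 / 2 : ℝ) * c ^ (1 / 2 : ℝ)

lemma sqrtProd_mono {a b c a' b' c' : ℝ≥0∞} (ha : a ≤ a') (hb : b ≤ b') (hc : c ≤ c') :
    sqrtProd a b c ≤ sqrtProd a' b' c' := by
  unfold sqrtProd
  gcongr

lemma sqrtProd_mul (a b c a' b' c' : ℝ≥0∞) :
    sqrtProd (a * a') (b * b') (c * c') = sqrtProd a b c * sqrtProd a' b' c' := by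
  unfold sqrtProd
  rw [ENNReal.mul_rpow_of_nonneg _ _ (by norm_num), ENNReal.mul_rpow_of_nonneg _ _ (by norm_num),
    ENNReal.mul_rpow_of_nonneg _ _ (by norm_num)]
  ring

lemma measurable_sqrtProd {α : Type*} [MeasurableSpace α] {f g h : α → ℝ≥0∞}
    (hf : Measurable f) (hg : Measurable g) (hh : Measurable h) :
    Measurable fun x => sqrtProd (f x) (g x) (h x) := by
  unfold sqrtProd
  exact ((hf.pow_const _).mul (hg.pow_const _)).mul (hh.pow_const _)

lemma measurable_multiplicity {ι α : Type*} [MeasurableSpace α] (s : Finset ι) {U : ι → Set α}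
    (hU : ∀ i, MeasurableSet (U i)) : Measurable (multiplicity s U) := by
  unfold multiplicity
  exact Finset.measurable_fun_sum _ fun i _ => measurable_one.indicator (hU i)

lemma multiplicity_le_of_imp {ι α β : Type*} {s : Finset ι} {U : ι → Set α} {V : ι → Set β}
    {x : α} {y : β} (h : ∀ i ∈ s, x ∈ U i → y ∈ V i) :
    multiplicity s U x ≤ multiplicity s V y := by
  classical
  refine Finset.sum_le_sum fun i hi => ?_
  by_cases hx : x ∈ U i
  · simp [hx, h i hi hx]
  · simp [hx]

lemma multiplicity_le_card {ι α : Type*} (s : Finset ι) (U : ι → Set α) (x : α) :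
    multiplicity s U x ≤ s.card := by
  classical
  calc multiplicity s U x ≤ ∑ i ∈ s, 1 :=
        Finset.sum_le_sum fun i _ => Set.indicator_le_self _ _ _
    _ = s.card := by simp

lemma multiplicity_eq_card_filter {ι α : Type*} (s : Finset ι) (U : ι → Set α) (x : α)
    [DecidablePred fun i => x ∈ U i] :
    multiplicity s U x = (s.filter fun i => x ∈ U i).card := by
  classical
  unfold multiplicity
  simp [Set.indicator_apply]

lemma multiplicity_le_filter {ι α : Type*} (s : Finset ι) (U V : ι → Set α) (x : α)
    (P : ι → Prop) [DecidablePred P] (h : ∀ i ∈ s, x ∈ U i → P i ∧ x ∈ V i) :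
    multiplicity s U x ≤ multiplicity (s.filter P) V x := by
  classical
  unfold multiplicity
  rw [Finset.sum_filter]
  refine Finset.sum_le_sum fun i hi => ?_
  by_cases hx : x ∈ U i
  · simp [hx, (h i hi hx).1, (h i hi hx).2]
  · simp [hx]

/-- A family of sets, each of them covered by sets indexed by `G`. -/
lemma multiplicity_le_product {ι κ α β : Type*} (s : Finset ι) (G : Finset κ) {U : ι → Set α}
    {V : ι × κ → Set β} {x : α} {y : β} (h : ∀ i ∈ s, x ∈ U i → ∃ g ∈ G, y ∈ V (i, g)) :
    multiplicity s U x ≤ multiplicity (s ×ˢ G) V y := by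
  classical
  unfold multiplicity
  rw [Finset.sum_product]
  refine Finset.sum_le_sum fun i hi => ?_
  by_cases hx : x ∈ U i
  · obtain ⟨g, hg, hy⟩ := h i hi hx
    calc (U i).indicator (1 : α → ℝ≥0∞) x = (V (i, g)).indicator (1 : β → ℝ≥0∞) y := by
          simp [hx, hy]
      _ ≤ _ := Finset.single_le_sum (f := fun g => (V (i, g)).indicator (1 : β → ℝ≥0∞) y)
          (fun _ _ => zero_le) hg
  · simp [hx]

lemma lintegral_multiplicity {ι α : Type*} [MeasurableSpace α] (μ : Measure α) (s : Finset ι)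
    {U : ι → Set α} (hU : ∀ i, MeasurableSet (U i)) :
    ∫⁻ x, multiplicity s U x ∂μ = ∑ i ∈ s, μ (U i) := by
  unfold multiplicity
  rw [lintegral_finsetSum _ fun i _ => measurable_one.indicator (hU i)]
  exact Finset.sum_congr rfl fun i _ => lintegral_indicator_one (hU i)

lemma multiplicity_mul {ι κ α : Type*} (s : Finset ι) (t : Finset κ) (U : ι → Set α)
    (V : κ → Set α) (x : α) :
    multiplicity s U x * multiplicity t V x =
      multiplicity (s ×ˢ t) (fun i => U i.1 ∩ V i.2) x := by
  unfold multiplicity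
  rw [Finset.sum_mul_sum, Finset.sum_product]
  refine Finset.sum_congr rfl fun i _ => Finset.sum_congr rfl fun k _ => ?_
  rw [Set.inter_indicator_one, Pi.mul_apply]

lemma multiplicity_preimage {ι α β : Type*} (s : Finset ι) (U : ι → Set β) (f : α → β) (x : α) :
    multiplicity s U (f x) = multiplicity s (fun i => f ⁻¹' U i) x := by
  classical
  simp [multiplicity, Set.indicator_apply]

lemma lintegral_sqrt_mul_sqrt_le {α : Type*} [MeasurableSpace α] (μ : Measure α)
    {f g : α → ℝ≥0∞} (hf : Measurable f) (hg : Measurable g) :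
    ∫⁻ x, f x ^ (1 / 2 : ℝ) * g x ^ (1 / 2 : ℝ) ∂μ ≤
      (∫⁻ x, f x ∂μ) ^ (1 / 2 : ℝ) * (∫⁻ x, g x ∂μ) ^ (1 / 2 : ℝ) := by
  have h := ENNReal.lintegral_mul_le_Lp_mul_Lq μ (p := 2) (q := 2) Real.HolderConjugate.two_two
    (hf.pow_const (1 / 2 : ℝ)).aemeasurable (hg.pow_const (1 / 2 : ℝ)).aemeasurable
  have sq : ∀ a : ℝ≥0∞, (a ^ (1 / 2 : ℝ)) ^ (2 : ℝ) = a := fun a => by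
    rw [← ENNReal.rpow_mul]
    norm_num
  simpa only [sq, Pi.mul_apply] using h

/-! ### Linear changes of variables and volumes -/

/-- The linear map of three-dimensional space with a given matrix. -/
def applyMatrix (M : Matrix (Fin 3) (Fin 3) ℝ) (x : ℝ × ℝ × ℝ) : ℝ × ℝ × ℝ :=
  (M 0 0 * x.1 + M 0 1 * x.2.1 + M 0 2 * x.2.2,
    M 1 0 * x.1 + M 1 1 * x.2.1 + M 1 2 * x.2.2,
    M 2 0 * x.1 + M 2 1 * x.2.1 + M 2 2 * x.2.2)

lemma measurePreserving_finThreeArrow :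
    MeasurePreserving (fun x : Fin 3 → ℝ => (x 0, x 1, x 2)) volume
      (volume : Measure (ℝ × ℝ × ℝ)) := by
  have h₁ := volume_preserving_piFinSuccAbove (fun _ : Fin 3 => ℝ) 0
  have h₂ := (MeasurePreserving.id (volume : Measure ℝ)).prod (volume_preserving_finTwoArrow ℝ)
  exact h₂.comp h₁

lemma measurePreserving_coordinates :
    MeasurePreserving (fun x : E3 => (x 0, x 1, x 2)) volume
      (volume : Measure (ℝ × ℝ × ℝ)) :=
  measurePreserving_finThreeArrow.comp (PiLp.volume_preserving_ofLp (Fin 3))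

lemma lintegral_comp_applyMatrix {M : Matrix (Fin 3) (Fin 3) ℝ} (hM : M.det ≠ 0)
    {g : ℝ × ℝ × ℝ → ℝ≥0∞} (hg : Measurable g) :
    ∫⁻ x, g (applyMatrix M x) = ENNReal.ofReal |M.det|⁻¹ * ∫⁻ x, g x := by
  have hp := measurePreserving_finThreeArrow
  have hgp : Measurable fun x : Fin 3 → ℝ => g (x 0, x 1, x 2) := hg.comp hp.measurable
  have hmeas : Measurable (applyMatrix M) := by
    unfold applyMatrix
    fun_prop
  have h : ∫⁻ x : Fin 3 → ℝ, g (x 0, x 1, x 2) ∂(volume.map (Matrix.toLin' M)) =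
      ∫⁻ x : Fin 3 → ℝ, g (x 0, x 1, x 2) ∂(ENNReal.ofReal |M.det⁻¹| • volume) := by
    rw [Real.map_matrix_volume_pi_eq_smul_volume_pi hM]
  rw [lintegral_map hgp (LinearMap.continuous_on_pi _).measurable,
    lintegral_smul_measure, hp.lintegral_comp hg] at h
  rw [← abs_inv, ← smul_eq_mul, ← h]
  refine (hp.lintegral_comp (hg.comp hmeas)).symm.trans (lintegral_congr fun x => ?_)
  simp [applyMatrix, Matrix.toLin'_apply, Matrix.mulVec, dotProduct, Fin.sum_univ_three]

/-- Domination of an integral after a linear change of variables. -/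
lemma setLIntegral_le_of_applyMatrix {M : Matrix (Fin 3) (Fin 3) ℝ} (hM : M.det ≠ 0)
    {D D' : Set (ℝ × ℝ × ℝ)} (hD : MeasurableSet D) (hD' : MeasurableSet D')
    {f g : ℝ × ℝ × ℝ → ℝ≥0∞} (hg : Measurable g)
    (hDD' : ∀ x ∈ D, applyMatrix M x ∈ D') (h : ∀ x ∈ D, f x ≤ g (applyMatrix M x)) :
    ∫⁻ x in D, f x ≤ ENNReal.ofReal |M.det|⁻¹ * ∫⁻ x in D', g x := by
  rw [← lintegral_indicator hD, ← lintegral_indicator hD',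
    ← lintegral_comp_applyMatrix hM (hg.indicator hD')]
  refine lintegral_mono fun x => ?_
  by_cases hx : x ∈ D
  · simp only [hx, Set.indicator_of_mem, hDD' x hx]
    exact h x hx
  · simp [hx]

/-- The set is the preimage of a product of two intervals under a linear map of determinant `a * b'
- b * a'`. -/
lemma volume_strip_inter_strip_le {a b a' b' H H' : ℝ} (hH : 0 ≤ H) (c c' : ℝ)
    (hdet : a * b' - b * a' ≠ 0) :
    volume {x : ℝ × ℝ | |a * x.1 + b * x.2 - c| ≤ H ∧ |a' * x.1 + b' * x.2 - c'| ≤ H'} ≤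
      ENNReal.ofReal (4 * H * H' / |a * b' - b * a'|) := by
  set f := Matrix.toLin (Module.Basis.finTwoProd ℝ) (Module.Basis.finTwoProd ℝ) !![a, b; a', b']
  have hf : LinearMap.det f = a * b' - b * a' := by
    rw [LinearMap.det_toLin, Matrix.det_fin_two_of]
  have hset : {x : ℝ × ℝ | |a * x.1 + b * x.2 - c| ≤ H ∧ |a' * x.1 + b' * x.2 - c'| ≤ H'} =
      f ⁻¹' (Metric.closedBall c H ×ˢ Metric.closedBall c' H') := by
    ext x
    simp [f, Matrix.toLin_finTwoProd_apply, Real.dist_eq]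
  rw [hset, Measure.addHaar_preimage_linearMap _ (by rwa [hf]), hf, Measure.volume_eq_prod,
    Measure.prod_prod, Real.volume_closedBall, Real.volume_closedBall,
    ← ENNReal.ofReal_mul (by positivity), ← ENNReal.ofReal_mul (by positivity), abs_inv]
  refine le_of_eq (congrArg _ ?_)
  ring

lemma volume_closedBall_prod (x : ℝ × ℝ × ℝ) {s : ℝ} (hs : 0 ≤ s) :
    volume (Metric.closedBall x s) = ENNReal.ofReal ((2 * s) ^ 3) := by
  obtain ⟨a, b, c⟩ := x
  rw [← closedBall_prod_same, ← closedBall_prod_same, Measure.volume_eq_prod, Measure.prod_prod,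
    Measure.volume_eq_prod, Measure.prod_prod]
  simp only [Real.volume_closedBall]
  rw [← ENNReal.ofReal_mul (by positivity), ← ENNReal.ofReal_mul (by positivity)]
  congr 1
  ring

/-! ### The Loomis–Whitney inequality by slicing -/

/-- Loomis–Whitney type inequality by slicing: two of the families are contained in thin slabs. -/
lemma lintegral_sqrtProd_le_of_slices {ι₁ ι₂ ι₃ : Type*} (s₁ : Finset ι₁) (s₂ : Finset ι₂)
    (s₃ : Finset ι₃) {U₁ : ι₁ → Set (ℝ × ℝ × ℝ)} {U₂ : ι₂ → Set (ℝ × ℝ × ℝ)}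
    {U₃ : ι₃ → Set (ℝ × ℝ × ℝ)} (hm₁ : ∀ i, MeasurableSet (U₁ i))
    (hm₂ : ∀ i, MeasurableSet (U₂ i)) (hm₃ : ∀ i, MeasurableSet (U₃ i))
    (ζ₁ : ι₁ → ℝ) (ζ₂ : ι₂ → ℝ) {h : ℝ} {K K' : ℝ≥0∞}
    (h₁ : ∀ i ∈ s₁, ∀ x ∈ U₁ i, |x.1 - ζ₁ i| ≤ h) (h₂ : ∀ i ∈ s₂, ∀ x ∈ U₂ i, |x.1 - ζ₂ i| ≤ h)
    (hK : ∀ i ∈ s₁, ∀ k ∈ s₂, ∀ q, volume {y | (q, y) ∈ U₁ i ∧ (q, y) ∈ U₂ k} ≤ K)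
    (hK' : ∀ i ∈ s₃, ∀ q, volume {y | (q, y) ∈ U₃ i} ≤ K') :
    ∫⁻ x, sqrtProd (multiplicity s₁ U₁ x) (multiplicity s₂ U₂ x) (multiplicity s₃ U₃ x) ≤
      ENNReal.ofReal (2 * h) * (K * K') ^ (1 / 2 : ℝ) * sqrtProd s₁.card s₂.card s₃.card := by
  classical
  have M₁ := measurable_multiplicity s₁ hm₁
  have M₂ := measurable_multiplicity s₂ hm₂
  have M₃ := measurable_multiplicity s₃ hm₃
  set B₁ : ι₁ → Set ℝ := fun i => Metric.closedBall (ζ₁ i) h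
  set B₂ : ι₂ → Set ℝ := fun i => Metric.closedBall (ζ₂ i) h
  have N₁ : Measurable (multiplicity s₁ B₁) :=
    measurable_multiplicity s₁ fun i => measurableSet_closedBall
  have N₂ : Measurable (multiplicity s₂ B₂) :=
    measurable_multiplicity s₂ fun i => measurableSet_closedBall
  have i₁ : ∫⁻ q, multiplicity s₁ B₁ q = s₁.card * ENNReal.ofReal (2 * h) := by
    rw [lintegral_multiplicity _ _ fun i => measurableSet_closedBall]
    simp
  have i₂ : ∫⁻ q, multiplicity s₂ B₂ q = s₂.card * ENNReal.ofReal (2 * h) := by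
    rw [lintegral_multiplicity _ _ fun i => measurableSet_closedBall]
    simp
  -- Only pairs of sets that both reach the slice `q` contribute, so the bound keeps the
  -- multiplicities of the intervals `B₁` and `B₂` instead of the cardinalities.
  have slice₁₂ : ∀ q, ∫⁻ y, multiplicity s₁ U₁ (q, y) * multiplicity s₂ U₂ (q, y) ≤
      multiplicity s₁ B₁ q * multiplicity s₂ B₂ q * K := by
    intro q
    simp_rw [multiplicity_mul]
    have := lintegral_multiplicity volume (s₁ ×ˢ s₂) fun i : ι₁ × ι₂ =>
      measurable_prodMk_left (x := q) ((hm₁ i.1).inter (hm₂ i.2))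
    simp_rw [multiplicity_preimage _ _ (Prod.mk q)]
    rw [this, multiplicity, Finset.sum_mul]
    refine Finset.sum_le_sum fun ik hik => ?_
    obtain ⟨i, k⟩ := ik
    obtain ⟨hi, hk⟩ := Finset.mem_product.1 hik
    change volume {y : ℝ × ℝ | (q, y) ∈ U₁ i ∧ (q, y) ∈ U₂ k} ≤ _
    by_cases hq : q ∈ B₁ i ∧ q ∈ B₂ k
    · simpa [hq.1, hq.2] using hK i hi k hk q
    · have : {y : ℝ × ℝ | (q, y) ∈ U₁ i ∧ (q, y) ∈ U₂ k} = ∅ := by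
        ext y
        simp only [Set.mem_ofPred_eq, Set.mem_empty_iff_false, iff_false]
        rintro ⟨a, b⟩
        exact hq ⟨by simpa [B₁, Real.dist_eq] using h₁ i hi _ a,
          by simpa [B₂, Real.dist_eq] using h₂ k hk _ b⟩
      simp [this]
  have slice₃ : ∀ q, ∫⁻ y, multiplicity s₃ U₃ (q, y) ≤ s₃.card * K' := by
    intro q
    have := lintegral_multiplicity volume s₃ fun i => measurable_prodMk_left (x := q) (hm₃ i)
    simp_rw [multiplicity_preimage _ _ (Prod.mk q)]
    rw [this]
    calc _ ≤ ∑ i ∈ s₃, K' := Finset.sum_le_sum fun i hi => hK' i hi q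
      _ = s₃.card * K' := by simp
  -- Cauchy–Schwarz on each slice separates the third family from the product of the first two; a
  -- second Cauchy–Schwarz, in `q`, separates these, each set having total mass `2 * h` there.
  rw [Measure.volume_eq_prod, lintegral_prod _ (measurable_sqrtProd M₁ M₂ M₃).aemeasurable]
  calc ∫⁻ q, ∫⁻ y, sqrtProd (multiplicity s₁ U₁ (q, y)) (multiplicity s₂ U₂ (q, y))
        (multiplicity s₃ U₃ (q, y))
      ≤ ∫⁻ q, (K * K') ^ (1 / 2 : ℝ) * (s₃.card : ℝ≥0∞) ^ (1 / 2 : ℝ) *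
          (multiplicity s₁ B₁ q ^ (1 / 2 : ℝ) * multiplicity s₂ B₂ q ^ (1 / 2 : ℝ)) := by
        refine lintegral_mono fun q => ?_
        calc ∫⁻ y, sqrtProd (multiplicity s₁ U₁ (q, y)) (multiplicity s₂ U₂ (q, y))
              (multiplicity s₃ U₃ (q, y))
            = ∫⁻ y, (multiplicity s₁ U₁ (q, y) * multiplicity s₂ U₂ (q, y)) ^ (1 / 2 : ℝ) *
                multiplicity s₃ U₃ (q, y) ^ (1 / 2 : ℝ) := by
              simp only [sqrtProd, ENNReal.mul_rpow_of_nonneg _ _ (by norm_num : (0 : ℝ) ≤ 1 / 2)]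
          _ ≤ (∫⁻ y, multiplicity s₁ U₁ (q, y) * multiplicity s₂ U₂ (q, y)) ^ (1 / 2 : ℝ) *
                (∫⁻ y, multiplicity s₃ U₃ (q, y)) ^ (1 / 2 : ℝ) :=
              lintegral_sqrt_mul_sqrt_le _
                ((M₁.comp measurable_prodMk_left).mul (M₂.comp measurable_prodMk_left))
                (M₃.comp measurable_prodMk_left)
          _ ≤ (multiplicity s₁ B₁ q * multiplicity s₂ B₂ q * K) ^ (1 / 2 : ℝ) *
                (s₃.card * K') ^ (1 / 2 : ℝ) := by
              gcongr
              · exact slice₁₂ q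
              · exact slice₃ q
          _ = _ := by
              simp only [ENNReal.mul_rpow_of_nonneg _ _ (by norm_num : (0 : ℝ) ≤ 1 / 2)]
              ring
    _ = (K * K') ^ (1 / 2 : ℝ) * (s₃.card : ℝ≥0∞) ^ (1 / 2 : ℝ) *
          ∫⁻ q, multiplicity s₁ B₁ q ^ (1 / 2 : ℝ) * multiplicity s₂ B₂ q ^ (1 / 2 : ℝ) :=
        lintegral_const_mul _ ((N₁.pow_const _).mul (N₂.pow_const _))
    _ ≤ (K * K') ^ (1 / 2 : ℝ) * (s₃.card : ℝ≥0∞) ^ (1 / 2 : ℝ) *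
          ((s₁.card * ENNReal.ofReal (2 * h)) ^ (1 / 2 : ℝ) *
            (s₂.card * ENNReal.ofReal (2 * h)) ^ (1 / 2 : ℝ)) := by
        gcongr
        rw [← i₁, ← i₂]
        exact lintegral_sqrt_mul_sqrt_le _ N₁ N₂
    _ = _ := by
        have hh : ENNReal.ofReal (2 * h) ^ (1 / 2 : ℝ) * ENNReal.ofReal (2 * h) ^ (1 / 2 : ℝ) =
            ENNReal.ofReal (2 * h) := by
          rw [← ENNReal.rpow_add_of_nonneg _ _ (by norm_num) (by norm_num)]
          norm_num
        nth_rewrite 3 [← hh]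
        simp only [ENNReal.mul_rpow_of_nonneg _ _ (by norm_num : (0 : ℝ) ≤ 1 / 2), sqrtProd]
        ring

/-! ### Trilinear Kakeya near the axes: induction on scales -/

/-- A tube along the first axis with intercepts `P` and slopes `V`. -/
def tubeAlong₁ (W : ℝ) (P V : ℝ × ℝ) : Set (ℝ × ℝ × ℝ) :=
  {x | |x.2.1 - P.1 - x.1 * V.1| ≤ W ∧ |x.2.2 - P.2 - x.1 * V.2| ≤ W}

/-- A tube along the second axis with intercepts `P` and slopes `V`. -/
def tubeAlong₂ (W : ℝ) (P V : ℝ × ℝ) : Set (ℝ × ℝ × ℝ) :=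
  {x | |x.1 - P.1 - x.2.1 * V.1| ≤ W ∧ |x.2.2 - P.2 - x.2.1 * V.2| ≤ W}

/-- A tube along the third axis with intercepts `P` and slopes `V`. -/
def tubeAlong₃ (W : ℝ) (P V : ℝ × ℝ) : Set (ℝ × ℝ × ℝ) :=
  {x | |x.1 - P.1 - x.2.2 * V.1| ≤ W ∧ |x.2.1 - P.2 - x.2.2 * V.2| ≤ W}

lemma measurableSet_abs_le_and {f g : ℝ × ℝ × ℝ → ℝ} (hf : Measurable f) (hg : Measurable g)
    (a b : ℝ) : MeasurableSet {x | |f x| ≤ a ∧ |g x| ≤ b} :=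
  (measurableSet_le hf.abs measurable_const).inter (measurableSet_le hg.abs measurable_const)

lemma measurableSet_tubeAlong₁ (W : ℝ) (P V : ℝ × ℝ) : MeasurableSet (tubeAlong₁ W P V) := by
  refine measurableSet_abs_le_and ?_ ?_ _ _ <;> fun_prop

lemma measurableSet_tubeAlong₂ (W : ℝ) (P V : ℝ × ℝ) : MeasurableSet (tubeAlong₂ W P V) := by
  refine measurableSet_abs_le_and ?_ ?_ _ _ <;> fun_prop

lemma measurableSet_tubeAlong₃ (W : ℝ) (P V : ℝ × ℝ) : MeasurableSet (tubeAlong₃ W P V) := by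
  refine measurableSet_abs_le_and ?_ ?_ _ _ <;> fun_prop

/-- Freezing the running coordinate at the centre of a ball of radius `s` costs `s * δ`: there a
tube of slope at most `δ` is parallel to its axis up to that error. -/
lemma abs_sub_mul_le_of_near {x y p v c W s δ : ℝ} (h : |y - p - x * v| ≤ W)
    (hx : |x - c| ≤ s) (hv : |v| ≤ δ) : |y - p - c * v| ≤ W + s * δ := by
  have h₁ : |(x - c) * v| ≤ s * δ := by
    rw [abs_mul]
    exact mul_le_mul hx hv (abs_nonneg _) ((abs_nonneg _).trans hx)
  calc |y - p - c * v| = |(y - p - x * v) + (x - c) * v| := by ring_nf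
    _ ≤ W + s * δ := (abs_add_le _ _).trans (add_le_add h h₁)

/-- A tube that meets a ball contains the centre of the ball once it is fattened. -/
lemma abs_sub_mul_le_of_near_of_near {x y p v c d W s δ : ℝ} (h : |y - p - x * v| ≤ W)
    (hx : |x - c| ≤ s) (hy : |y - d| ≤ s) (hv : |v| ≤ δ) :
    |d - p - c * v| ≤ W + s + s * δ := by
  have h₁ := abs_sub_mul_le_of_near h hx hv
  calc |d - p - c * v| = |(y - p - c * v) - (y - d)| := by ring_nf
    _ ≤ (W + s * δ) + s := (abs_sub _ _).trans (add_le_add h₁ hy)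
    _ = _ := by ring

lemma mem_closedBall_prod {x y : ℝ × ℝ × ℝ} {s : ℝ} :
    x ∈ Metric.closedBall y s ↔
      |x.1 - y.1| ≤ s ∧ |x.2.1 - y.2.1| ≤ s ∧ |x.2.2 - y.2.2| ≤ s := by
  simp [Prod.dist_eq, Real.dist_eq]

section NearAxes

variable {ι₁ ι₂ ι₃ : Type*} (s₁ : Finset ι₁) (s₂ : Finset ι₂) (s₃ : Finset ι₃)
  (P₁ V₁ : ι₁ → ℝ × ℝ) (P₂ V₂ : ι₂ → ℝ × ℝ) (P₃ V₃ : ι₃ → ℝ × ℝ)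

/-- The trilinear Kakeya integrand of families of tubes of width `W` along the three axes. -/
noncomputable def kakeyaIntegrand (W : ℝ) (x : ℝ × ℝ × ℝ) : ℝ≥0∞ :=
  sqrtProd (multiplicity s₁ (fun i => tubeAlong₁ W (P₁ i) (V₁ i)) x)
    (multiplicity s₂ (fun i => tubeAlong₂ W (P₂ i) (V₂ i)) x)
    (multiplicity s₃ (fun i => tubeAlong₃ W (P₃ i) (V₃ i)) x)

lemma measurable_kakeyaIntegrand (W : ℝ) :
    Measurable (kakeyaIntegrand s₁ s₂ s₃ P₁ V₁ P₂ V₂ P₃ V₃ W) :=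
  measurable_sqrtProd (measurable_multiplicity _ fun _ => measurableSet_tubeAlong₁ _ _ _)
    (measurable_multiplicity _ fun _ => measurableSet_tubeAlong₂ _ _ _)
    (measurable_multiplicity _ fun _ => measurableSet_tubeAlong₃ _ _ _)

lemma sqrtProd_rotate (a b c : ℝ≥0∞) : sqrtProd a b c = sqrtProd b c a := by
  unfold sqrtProd
  ring

/-- In a ball of radius `s` the tubes are essentially parallel to the axes. -/
lemma setLIntegral_closedBall_kakeyaIntegrand_le {W W' s δ : ℝ} (hW : 0 < W)
    (hsδ : s * δ ≤ W) (hs : 2 * W + s ≤ W')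
    (h₁ : ∀ i ∈ s₁, |(V₁ i).1| ≤ δ ∧ |(V₁ i).2| ≤ δ)
    (h₂ : ∀ i ∈ s₂, |(V₂ i).1| ≤ δ ∧ |(V₂ i).2| ≤ δ)
    (h₃ : ∀ i ∈ s₃, |(V₃ i).1| ≤ δ ∧ |(V₃ i).2| ≤ δ) (y : ℝ × ℝ × ℝ) :
    ∫⁻ x in Metric.closedBall y s, kakeyaIntegrand s₁ s₂ s₃ P₁ V₁ P₂ V₂ P₃ V₃ W x ≤
      ENNReal.ofReal ((4 * W) ^ 3) * kakeyaIntegrand s₁ s₂ s₃ P₁ V₁ P₂ V₂ P₃ V₃ W' y := by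
  classical
  set B := Metric.closedBall y s
  have hB : MeasurableSet B := measurableSet_closedBall
  -- Tubes whose fattening misses `y` do not meet the ball, so cardinalities of the remaining tubes
  -- are values of the fat integrand at `y`.
  set r₁ := s₁.filter fun i => y ∈ tubeAlong₁ W' (P₁ i) (V₁ i)
  set r₂ := s₂.filter fun i => y ∈ tubeAlong₂ W' (P₂ i) (V₂ i)
  set r₃ := s₃.filter fun i => y ∈ tubeAlong₃ W' (P₃ i) (V₃ i)
  set U₁ := fun i => tubeAlong₁ W (P₁ i) (V₁ i) ∩ B
  set U₂ := fun i => tubeAlong₂ W (P₂ i) (V₂ i) ∩ B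
  set U₃ := fun i => tubeAlong₃ W (P₃ i) (V₃ i) ∩ B
  -- The slices are taken in the first coordinate, in which the tubes along the other two axes are
  -- thin. As `s * δ ≤ W`, the half-widths become `2 * W`, and the resulting constant is `4 * W * (4
  -- * W) ^ 2`.
  have key := lintegral_sqrtProd_le_of_slices r₂ r₃ r₁ (U₁ := U₂) (U₂ := U₃) (U₃ := U₁)
    (fun _ => (measurableSet_tubeAlong₂ _ _ _).inter hB)
    (fun _ => (measurableSet_tubeAlong₃ _ _ _).inter hB)
    (fun _ => (measurableSet_tubeAlong₁ _ _ _).inter hB)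
    (fun i => (P₂ i).1 + y.2.1 * (V₂ i).1) (fun i => (P₃ i).1 + y.2.2 * (V₃ i).1)
    (h := 2 * W) (K := ENNReal.ofReal ((4 * W) ^ 2)) (K' := ENNReal.ofReal ((4 * W) ^ 2))
    ?_ ?_ ?_ ?_
  · calc ∫⁻ x in B, kakeyaIntegrand s₁ s₂ s₃ P₁ V₁ P₂ V₂ P₃ V₃ W x
        ≤ ∫⁻ x in B, sqrtProd (multiplicity r₂ U₂ x) (multiplicity r₃ U₃ x)
            (multiplicity r₁ U₁ x) := by
          refine setLIntegral_mono' hB fun x hx => ?_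
          have hx' := mem_closedBall_prod.1 hx
          rw [← sqrtProd_rotate]
          refine sqrtProd_mono ?_ ?_ ?_
          · refine multiplicity_le_filter _ _ _ _ _ fun i hi hxi => ⟨⟨?_, ?_⟩, hxi, hx⟩
            · linarith [abs_sub_mul_le_of_near_of_near hxi.1 hx'.1 hx'.2.1 (h₁ i hi).1]
            · linarith [abs_sub_mul_le_of_near_of_near hxi.2 hx'.1 hx'.2.2 (h₁ i hi).2]
          · refine multiplicity_le_filter _ _ _ _ _ fun i hi hxi => ⟨⟨?_, ?_⟩, hxi, hx⟩
            · linarith [abs_sub_mul_le_of_near_of_near hxi.1 hx'.2.1 hx'.1 (h₂ i hi).1]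
            · linarith [abs_sub_mul_le_of_near_of_near hxi.2 hx'.2.1 hx'.2.2 (h₂ i hi).2]
          · refine multiplicity_le_filter _ _ _ _ _ fun i hi hxi => ⟨⟨?_, ?_⟩, hxi, hx⟩
            · linarith [abs_sub_mul_le_of_near_of_near hxi.1 hx'.2.2 hx'.1 (h₃ i hi).1]
            · linarith [abs_sub_mul_le_of_near_of_near hxi.2 hx'.2.2 hx'.2.1 (h₃ i hi).2]
      _ ≤ _ := (setLIntegral_le_lintegral _ _).trans key
      _ = ENNReal.ofReal ((4 * W) ^ 3) * sqrtProd r₁.card r₂.card r₃.card := by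
          rw [← sqrtProd_rotate, ← ENNReal.ofReal_mul (by positivity),
            ENNReal.ofReal_rpow_of_nonneg (by positivity) (by norm_num),
            ← ENNReal.ofReal_mul (by positivity), ← pow_two, ← Real.sqrt_eq_rpow,
            Real.sqrt_sq (by positivity)]
          congr 2
          ring
      _ = _ := by
          simp only [kakeyaIntegrand, multiplicity_eq_card_filter, r₁, r₂, r₃]
  · intro i hi x hx
    have hx' := mem_closedBall_prod.1 hx.2
    have := abs_sub_mul_le_of_near hx.1.1 hx'.2.1 (h₂ i (Finset.mem_filter.1 hi).1).1
    rw [← sub_sub]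
    linarith
  · intro i hi x hx
    have hx' := mem_closedBall_prod.1 hx.2
    have := abs_sub_mul_le_of_near hx.1.1 hx'.2.2 (h₃ i (Finset.mem_filter.1 hi).1).1
    rw [← sub_sub]
    linarith
  · intro i hi k hk q
    refine le_trans (measure_mono ?_) ((volume_strip_inter_strip_le (a := 1) (b := 0) (a' := 0)
      (b' := 1) (H := 2 * W) (H' := 2 * W) (by positivity)
      ((P₃ k).2 + y.2.2 * (V₃ k).2) ((P₂ i).2 + y.2.1 * (V₂ i).2) (by norm_num)).trans ?_)
    · rintro z ⟨hz, hz'⟩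
      have hb := mem_closedBall_prod.1 hz.2
      have e₁ := abs_sub_mul_le_of_near hz.1.2 hb.2.1 (h₂ i (Finset.mem_filter.1 hi).1).2
      have e₂ := abs_sub_mul_le_of_near hz'.1.2 hb.2.2 (h₃ k (Finset.mem_filter.1 hk).1).2
      constructor
      · rw [← sub_sub]
        simp only at e₂ ⊢
        ring_nf at e₂ ⊢
        linarith
      · rw [← sub_sub]
        simp only at e₁ ⊢
        ring_nf at e₁ ⊢
        linarith
    · refine le_of_eq (congrArg _ ?_)
      norm_num
      ring
  · intro i hi q
    refine le_trans (measure_mono ?_) ((volume_strip_inter_strip_le (a := 1) (b := 0) (a' := 0)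
      (b' := 1) (H := W) (H' := W) (by positivity)
      ((P₁ i).1 + q * (V₁ i).1) ((P₁ i).2 + q * (V₁ i).2) (by norm_num)).trans ?_)
    · rintro z ⟨hz, -⟩
      constructor
      · rw [← sub_sub]
        simpa using hz.1
      · rw [← sub_sub]
        simpa using hz.2
    · refine ENNReal.ofReal_le_ofReal ?_
      norm_num
      nlinarith

/-- One change of scale: the integral is controlled by the integral of the fattened tubes. -/
lemma setLIntegral_kakeyaIntegrand_le_fat {W M : ℝ} (hW : 0 < W) (hM : 1 ≤ M)
    (h₁ : ∀ i ∈ s₁, |(V₁ i).1| ≤ M⁻¹ ∧ |(V₁ i).2| ≤ M⁻¹)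
    (h₂ : ∀ i ∈ s₂, |(V₂ i).1| ≤ M⁻¹ ∧ |(V₂ i).2| ≤ M⁻¹)
    (h₃ : ∀ i ∈ s₃, |(V₃ i).1| ≤ M⁻¹ ∧ |(V₃ i).2| ≤ M⁻¹) (c : ℝ × ℝ × ℝ) (S : ℝ) :
    ∫⁻ x in Metric.closedBall c S, kakeyaIntegrand s₁ s₂ s₃ P₁ V₁ P₂ V₂ P₃ V₃ W x ≤
      ENNReal.ofReal ((2 / M) ^ 3) * ∫⁻ x in Metric.closedBall c (S + W * M),
        kakeyaIntegrand s₁ s₂ s₃ P₁ V₁ P₂ V₂ P₃ V₃ (3 * W * M) x := by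
  classical
  have hM0 : 0 < M := by linarith
  set s := W * M with hs
  have hs0 : 0 < s := by positivity
  set F := kakeyaIntegrand s₁ s₂ s₃ P₁ V₁ P₂ V₂ P₃ V₃ with hF
  have hFm : ∀ W, Measurable (F W) := measurable_kakeyaIntegrand s₁ s₂ s₃ P₁ V₁ P₂ V₂ P₃ V₃
  have hnear : MeasurableSet {z : (ℝ × ℝ × ℝ) × (ℝ × ℝ × ℝ) | dist z.1 z.2 ≤ s} :=
    measurableSet_le measurable_dist measurable_const
  have hdist : ∀ x y : ℝ × ℝ × ℝ, dist x y ≤ s → x ∈ Metric.closedBall c S →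
      y ∈ Metric.closedBall c (S + s) := fun x y h hx => by
    have := dist_triangle y x c
    rw [Metric.mem_closedBall] at hx ⊢
    rw [dist_comm] at h
    linarith
  -- The double integral of `k` is evaluated in both orders. For fixed `x` the admissible `y` fill a
  -- cube of volume `(2 * s) ^ 3`; for fixed `y` the estimate on a single small ball applies.
  have key : ENNReal.ofReal ((2 * s) ^ 3) * ∫⁻ x in Metric.closedBall c S, F W x ≤
      ENNReal.ofReal ((4 * W) ^ 3) * ∫⁻ y in Metric.closedBall c (S + s), F (3 * W * M) y := by
    set k : (ℝ × ℝ × ℝ) → (ℝ × ℝ × ℝ) → ℝ≥0∞ := fun x y =>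
      (Metric.closedBall y s).indicator (F W) x with hk
    have hkm : Measurable (Function.uncurry k) := by
      have : Function.uncurry k = {z : (ℝ × ℝ × ℝ) × (ℝ × ℝ × ℝ) | dist z.1 z.2 ≤ s}.indicator
          fun z => F W z.1 := by
        ext z
        simp [Function.uncurry, k, Set.indicator_apply]
      rw [this]
      exact ((hFm W).comp measurable_fst).indicator hnear
    calc ENNReal.ofReal ((2 * s) ^ 3) * ∫⁻ x in Metric.closedBall c S, F W x
        = ∫⁻ x in Metric.closedBall c S, ENNReal.ofReal ((2 * s) ^ 3) * F W x :=
          (lintegral_const_mul _ (hFm W)).symm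
      _ ≤ ∫⁻ x in Metric.closedBall c S, ∫⁻ y in Metric.closedBall c (S + s), k x y := by
          refine setLIntegral_mono' measurableSet_closedBall fun x hx => ?_
          have : ∀ y, k x y = (Metric.closedBall x s).indicator (fun _ => F W x) y := by
            intro y
            simp [k, Set.indicator_apply, dist_comm]
          simp_rw [this]
          rw [lintegral_indicator measurableSet_closedBall, lintegral_const,
            Measure.restrict_restrict measurableSet_closedBall, Measure.restrict_apply_univ,
            Set.inter_eq_left.2 fun y hy => hdist x y (by rwa [dist_comm]) hx,
            volume_closedBall_prod _ hs0.le, mul_comm]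
      _ = ∫⁻ y in Metric.closedBall c (S + s), ∫⁻ x in Metric.closedBall c S, k x y :=
          lintegral_lintegral_swap hkm.aemeasurable
      _ ≤ ∫⁻ y in Metric.closedBall c (S + s),
            ENNReal.ofReal ((4 * W) ^ 3) * F (3 * W * M) y := by
          refine lintegral_mono fun y => ?_
          calc ∫⁻ x in Metric.closedBall c S, k x y ≤ ∫⁻ x, k x y :=
                setLIntegral_le_lintegral _ _
            _ = ∫⁻ x in Metric.closedBall y s, F W x :=
                lintegral_indicator measurableSet_closedBall _
            _ ≤ _ := setLIntegral_closedBall_kakeyaIntegrand_le s₁ s₂ s₃ P₁ V₁ P₂ V₂ P₃ V₃ hW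
                (by rw [hs]; field_simp; rfl) (by rw [hs]; nlinarith) h₁ h₂ h₃ y
      _ = _ := lintegral_const_mul _ (hFm _)
  have h2s : ENNReal.ofReal ((2 * s) ^ 3) * ENNReal.ofReal (((2 * s) ^ 3)⁻¹) = 1 := by
    rw [← ENNReal.ofReal_mul (by positivity), mul_inv_cancel₀ (by positivity), ENNReal.ofReal_one]
  calc ∫⁻ x in Metric.closedBall c S, F W x
      = ENNReal.ofReal (((2 * s) ^ 3)⁻¹) *
          (ENNReal.ofReal ((2 * s) ^ 3) * ∫⁻ x in Metric.closedBall c S, F W x) := by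
        rw [← mul_assoc, mul_comm (ENNReal.ofReal _) (ENNReal.ofReal _), h2s, one_mul]
    _ ≤ ENNReal.ofReal (((2 * s) ^ 3)⁻¹) * (ENNReal.ofReal ((4 * W) ^ 3) *
          ∫⁻ y in Metric.closedBall c (S + s), F (3 * W * M) y) := by gcongr
    _ = _ := by
        rw [← mul_assoc, ← ENNReal.ofReal_mul (by positivity)]
        congr 2
        rw [hs]
        field_simp
        norm_num

/-- Each change of scale multiplies the width by `3 * M`, hence its cube by `27 * M ^ 3`, and brings
a factor `(2 / M) ^ 3`. The net cost is `216`, whatever `M` is. -/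
lemma setLIntegral_kakeyaIntegrand_le_pow {M : ℝ} (hM : 1 ≤ M)
    (h₁ : ∀ i ∈ s₁, |(V₁ i).1| ≤ M⁻¹ ∧ |(V₁ i).2| ≤ M⁻¹)
    (h₂ : ∀ i ∈ s₂, |(V₂ i).1| ≤ M⁻¹ ∧ |(V₂ i).2| ≤ M⁻¹)
    (h₃ : ∀ i ∈ s₃, |(V₃ i).1| ≤ M⁻¹ ∧ |(V₃ i).2| ≤ M⁻¹) (c : ℝ × ℝ × ℝ) (n : ℕ) :
    ∀ {W S : ℝ}, 0 < W → S ≤ W * M ^ n →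
    ∫⁻ x in Metric.closedBall c S, kakeyaIntegrand s₁ s₂ s₃ P₁ V₁ P₂ V₂ P₃ V₃ W x ≤
      ENNReal.ofReal (216 ^ n * (4 * W) ^ 3) * sqrtProd s₁.card s₂.card s₃.card := by
  have hM0 : 0 < M := by linarith
  induction n with
  | zero =>
    intro W S hW hS
    have := setLIntegral_closedBall_kakeyaIntegrand_le s₁ s₂ s₃ P₁ V₁ P₂ V₂ P₃ V₃ (s := W * M)
      (δ := M⁻¹) (W' := 2 * W + W * M) hW (by field_simp; rfl) le_rfl h₁ h₂ h₃ c
    refine (lintegral_mono_set (Metric.closedBall_subset_closedBall ?_)).trans (this.trans ?_)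
    · nlinarith [pow_zero M]
    · rw [pow_zero, one_mul]
      gcongr
      exact sqrtProd_mono (multiplicity_le_card _ _ _) (multiplicity_le_card _ _ _)
        (multiplicity_le_card _ _ _)
  | succ n ih =>
    intro W S hW hS
    have h := setLIntegral_kakeyaIntegrand_le_fat s₁ s₂ s₃ P₁ V₁ P₂ V₂ P₃ V₃ hW hM h₁ h₂ h₃ c S
    refine h.trans ((mul_le_mul_right (ih (by positivity) ?_) _).trans ?_)
    · have h1 : 1 ≤ M ^ n := one_le_pow₀ hM
      have h2 : 0 < W * M := by positivity
      rw [pow_succ] at hS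
      nlinarith
    · rw [← mul_assoc, ← ENNReal.ofReal_mul (by positivity)]
      refine le_of_eq (congrArg (ENNReal.ofReal · * _) ?_)
      field_simp
      ring

end NearAxes

/-- The trilinear Kakeya inequality for tubes whose directions are close to the axes. -/
theorem exists_slope_kakeya_near_axes {ε : ℝ} (hε : 0 < ε) :
    ∃ δ : ℝ, 0 < δ ∧ ∀ {ι₁ ι₂ ι₃ : Type} (s₁ : Finset ι₁) (s₂ : Finset ι₂) (s₃ : Finset ι₃)
      (P₁ V₁ : ι₁ → ℝ × ℝ) (P₂ V₂ : ι₂ → ℝ × ℝ) (P₃ V₃ : ι₃ → ℝ × ℝ),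
      (∀ i ∈ s₁, |(V₁ i).1| ≤ δ ∧ |(V₁ i).2| ≤ δ) →
      (∀ i ∈ s₂, |(V₂ i).1| ≤ δ ∧ |(V₂ i).2| ≤ δ) →
      (∀ i ∈ s₃, |(V₃ i).1| ≤ δ ∧ |(V₃ i).2| ≤ δ) →
      ∀ (c : ℝ × ℝ × ℝ) (W S : ℝ), 0 < W → W ≤ S →
      ∫⁻ x in Metric.closedBall c S, kakeyaIntegrand s₁ s₂ s₃ P₁ V₁ P₂ V₂ P₃ V₃ W x ≤
        ENNReal.ofReal (216 * (4 * W) ^ 3 * (S / W) ^ ε) *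
          sqrtProd s₁.card s₂.card s₃.card := by
  -- With `M ^ ε = 216`, the cost of `n` changes of scale is `(M ^ n) ^ ε`, a power `ε` of the ratio
  -- of scales.
  set M : ℝ := 216 ^ (1 / ε) with hM
  have hM1 : 1 < M := Real.one_lt_rpow (by norm_num) (by positivity)
  have hM0 : 0 < M := by linarith
  have hMε : M ^ ε = 216 := by
    rw [hM, ← Real.rpow_mul (by norm_num), one_div_mul_cancel hε.ne', Real.rpow_one]
  refine ⟨M⁻¹, inv_pos.2 hM0, ?_⟩
  intro ι₁ ι₂ ι₃ s₁ s₂ s₃ P₁ V₁ P₂ V₂ P₃ V₃ h₁ h₂ h₃ c W S hW hS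
  -- Reaching `S` takes `n + 1` steps, while only `M ^ n` is known to be at most `S / W`; the
  -- surplus step is the factor `216` of the statement.
  obtain ⟨n, hn, hn'⟩ := exists_nat_pow_near ((one_le_div hW).2 hS) hM1
  have h := setLIntegral_kakeyaIntegrand_le_pow s₁ s₂ s₃ P₁ V₁ P₂ V₂ P₃ V₃ hM1.le h₁ h₂ h₃ c
    (n + 1) hW (S := S) ((div_le_iff₀' hW).1 hn'.le)
  refine h.trans ?_
  gcongr ENNReal.ofReal ?_ * _
  have hpow : (216 : ℝ) ^ n ≤ (S / W) ^ ε := by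
    rw [← hMε, ← Real.rpow_natCast, ← Real.rpow_mul hM0.le, mul_comm, Real.rpow_mul hM0.le,
      Real.rpow_natCast]
    exact Real.rpow_le_rpow (by positivity) hn hε.le
  rw [pow_succ]
  have : 0 < (4 * W) ^ 3 := by positivity
  nlinarith

/-! ### Slabs at small heights: the planar estimate -/

/-- A tube that is a graph over the third axis, with widths `W₁` and `W₂` in the directions of the
first and the second axis, intercepts `P` and slopes `V`. -/
def slab (W₁ W₂ : ℝ) (P V : ℝ × ℝ) : Set (ℝ × ℝ × ℝ) :=
  {x | |x.1 - P.1 - x.2.2 * V.1| ≤ W₁ ∧ |x.2.1 - P.2 - x.2.2 * V.2| ≤ W₂}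

lemma measurableSet_slab (W₁ W₂ : ℝ) (P V : ℝ × ℝ) : MeasurableSet (slab W₁ W₂ P V) := by
  refine measurableSet_abs_le_and ?_ ?_ _ _ <;> fun_prop

lemma abs_mul_sub_mul_le {a b x y A B X Y : ℝ} (ha : |a| ≤ A) (hb : |b| ≤ B) (hx : |x| ≤ X)
    (hy : |y| ≤ Y) : |a * x - b * y| ≤ A * X + B * Y := by
  refine (abs_sub _ _).trans ?_
  rw [abs_mul, abs_mul]
  have := abs_nonneg a
  have := abs_nonneg b
  have := abs_nonneg x
  have := abs_nonneg y
  gcongr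
  · linarith
  · linarith

/-- The estimate without loss at heights for which the first two families are essentially parallel
to a plane. -/
lemma setLIntegral_slab_le_of_planar {ι₁ ι₂ ι₃ : Type*} (s₁ : Finset ι₁) (s₂ : Finset ι₂)
    (s₃ : Finset ι₃) (P₁ V₁ : ι₁ → ℝ × ℝ) (P₂ V₂ : ι₂ → ℝ × ℝ) (P₃ V₃ : ι₃ → ℝ × ℝ)
    {X₁ X₂ H σ c C η z₀ R α₂ β₂ α₃ β₃ : ℝ} (hX₁ : 0 < X₁) (hX₂ : 0 < X₂) (hX₁H : X₁ ≤ H)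
    (hX₂H : X₂ ≤ H) (hRH : R ≤ H) (hσ : 0 < σ) (hc : 0 < c) (hC : 1 ≤ C) (hη : η ≤ c / 4)
    (hη' : η * C ≤ c / 4) (hη1 : η ≤ 1)
    (hα₂ : |α₂| ≤ C) (hβ₂ : |β₂| ≤ C)
    (hcα₂ : c ≤ |α₂|) (hdet : c ≤ |α₂ * β₃ - β₂ * α₃|)
    (h₁ : ∀ i ∈ s₁, |(V₁ i).1| ≤ η ∧ |(V₁ i).2| ≤ η)
    (h₂ : ∀ i ∈ s₂, |(V₂ i).1 - α₂| ≤ η ∧ |(V₂ i).2 - β₂| ≤ η)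
    (h₃ : ∀ i ∈ s₃, |(V₃ i).1 - α₃| ≤ η ∧ |(V₃ i).2 - β₃| ≤ η) :
    ∫⁻ x in {x : ℝ × ℝ × ℝ | |x.2.2 - z₀| ≤ R},
        sqrtProd (multiplicity s₁ (fun i => slab X₁ X₂ (P₁ i) (V₁ i)) x)
          (multiplicity s₂ (fun i => slab X₁ X₂ (P₂ i) (V₂ i)) x)
          (multiplicity s₃ (fun i => slab X₁ X₂ (P₃ i) (σ • V₃ i)) x) ≤
      ENNReal.ofReal (c⁻¹ * (12 * C ^ 2 * H *
        √(8 * X₁ ^ 2 / c * (8 * C * X₁ * X₂ / (σ * c))))) *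
        sqrtProd s₁.card s₂.card s₃.card := by
  have hC0 : 0 < C := by linarith
  have hH : 0 < H := by linarith
  -- The slicing coordinate `α₂ * x.2.1 - β₂ * x.1` is constant along `(0, 0, 1)` and `(α₂, β₂, 1)`;
  -- `Q` is its value on the axis of a slab at height `z₀`. The widths contribute at most `2 * C *
  -- H` and the drift over the heights at most `2 * C * (C + 1) * H`, which gives `6 * C ^ 2 * H`.
  set Q : ℝ × ℝ → ℝ × ℝ → ℝ := fun P V =>
    α₂ * (P.2 + z₀ * V.2) - β₂ * (P.1 + z₀ * V.1) with hQ
  set U : ℝ × ℝ → ℝ × ℝ → Set (ℝ × ℝ × ℝ) := fun P V =>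
    {y | |y.2.1 - P.1 - y.2.2 * V.1| ≤ X₁ ∧ |y.1 - Q P V| ≤ 6 * C ^ 2 * H} with hU
  -- For the third family the old second coordinate is eliminated: in the new coordinates `y` it
  -- equals `(y.1 + β₂ * y.2.1) / α₂`.
  set U' : ℝ × ℝ → ℝ × ℝ → Set (ℝ × ℝ × ℝ) := fun P V =>
    {y | |y.2.1 - P.1 - y.2.2 * (σ * V.1)| ≤ X₁ ∧
      |y.1 + β₂ * y.2.1 - α₂ * P.2 - α₂ * (y.2.2 * (σ * V.2))| ≤ C * X₂} with hU'
  have hUm : ∀ P V, MeasurableSet (U P V) := fun P V => by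
    refine measurableSet_abs_le_and ?_ ?_ _ _ <;> fun_prop
  have hUm' : ∀ P V, MeasurableSet (U' P V) := fun P V => by
    refine measurableSet_abs_le_and ?_ ?_ _ _ <;> fun_prop
  set M : Matrix (Fin 3) (Fin 3) ℝ := !![-β₂, α₂, 0; 1, 0, 0; 0, 0, 1] with hM
  have hMdet : M.det = -α₂ := by simp [hM, Matrix.det_fin_three]
  have hMx : ∀ x, applyMatrix M x = (α₂ * x.2.1 - β₂ * x.1, x.1, x.2.2) := fun x => by
    simp [applyMatrix, hM]
    ring
  have hα0 : 0 < |α₂| := hc.trans_le hcα₂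
  have hmem : ∀ {P V : ℝ × ℝ} {x : ℝ × ℝ × ℝ}, |V.1| ≤ C + 1 → |V.2| ≤ C + 1 →
      |x.2.2 - z₀| ≤ R → x ∈ slab X₁ X₂ P V → applyMatrix M x ∈ U P V := by
    intro P V x hV₁ hV₂ hz hx
    rw [hMx]
    refine ⟨hx.1, ?_⟩
    have e₁ := abs_mul_sub_mul_le hα₂ hβ₂ hx.2 hx.1
    have e₂ := abs_mul_sub_mul_le hα₂ hβ₂ hV₂ hV₁
    have e₃ : |(x.2.2 - z₀) * (α₂ * V.2 - β₂ * V.1)| ≤ H * (C * (C + 1) + C * (C + 1)) := by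
      rw [abs_mul]
      exact mul_le_mul (hz.trans hRH) e₂ (abs_nonneg _) hH.le
    calc |α₂ * x.2.1 - β₂ * x.1 - Q P V|
        = |(α₂ * (x.2.1 - P.2 - x.2.2 * V.2) - β₂ * (x.1 - P.1 - x.2.2 * V.1)) +
            (x.2.2 - z₀) * (α₂ * V.2 - β₂ * V.1)| := by
          rw [hQ]
          ring_nf
      _ ≤ (C * X₂ + C * X₁) + H * (C * (C + 1) + C * (C + 1)) :=
          (abs_add_le _ _).trans (add_le_add e₁ e₃)
      _ ≤ (C * H + C * H) + H * (C * (C + 1) + C * (C + 1)) := by gcongr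
      _ ≤ 6 * C ^ 2 * H := by nlinarith [mul_nonneg (mul_pos hH hC0).le (sub_nonneg.2 hC)]
  have key := lintegral_sqrtProd_le_of_slices s₁ s₂ s₃ (U₁ := fun i => U (P₁ i) (V₁ i))
    (U₂ := fun i => U (P₂ i) (V₂ i)) (U₃ := fun i => U' (P₃ i) (V₃ i))
    (fun _ => hUm _ _) (fun _ => hUm _ _) (fun _ => hUm' _ _) (fun i => Q (P₁ i) (V₁ i))
    (fun i => Q (P₂ i) (V₂ i)) (h := 6 * C ^ 2 * H) (K := ENNReal.ofReal (8 * X₁ ^ 2 / c))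
    (K' := ENNReal.ofReal (8 * C * X₁ * X₂ / (σ * c)))
    (fun i _ x hx => hx.2) (fun i _ x hx => hx.2) ?_ ?_
  · have hD : MeasurableSet {x : ℝ × ℝ × ℝ | |x.2.2 - z₀| ≤ R} :=
      measurableSet_le (by fun_prop) measurable_const
    refine (setLIntegral_le_of_applyMatrix (M := M)
      (D' := Set.univ) (g := fun x => sqrtProd (multiplicity s₁ (fun i => U (P₁ i) (V₁ i)) x)
        (multiplicity s₂ (fun i => U (P₂ i) (V₂ i)) x)
        (multiplicity s₃ (fun i => U' (P₃ i) (V₃ i)) x)) ?_ hD MeasurableSet.univ ?_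
        (fun _ _ => Set.mem_univ _) ?_).trans ?_
    · rw [hMdet]
      exact neg_ne_zero.2 (abs_pos.1 hα0)
    · exact measurable_sqrtProd (measurable_multiplicity _ fun _ => hUm _ _)
        (measurable_multiplicity _ fun _ => hUm _ _) (measurable_multiplicity _ fun _ => hUm' _ _)
    · intro x hx
      refine sqrtProd_mono ?_ ?_ ?_
      · exact multiplicity_le_of_imp fun i hi hxi =>
          hmem (by linarith [(h₁ i hi).1]) (by linarith [(h₁ i hi).2]) hx hxi
      · refine multiplicity_le_of_imp fun i hi hxi => hmem ?_ ?_ hx hxi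
        · linarith [(h₂ i hi).1, abs_sub_abs_le_abs_sub (V₂ i).1 α₂]
        · linarith [(h₂ i hi).2, abs_sub_abs_le_abs_sub (V₂ i).2 β₂]
      · refine multiplicity_le_of_imp fun i hi hxi => ?_
        rw [hMx]
        refine ⟨hxi.1, ?_⟩
        calc |α₂ * x.2.1 - β₂ * x.1 + β₂ * x.1 - α₂ * (P₃ i).2 - α₂ * (x.2.2 * (σ * (V₃ i).2))|
            = |α₂| * |x.2.1 - (P₃ i).2 - x.2.2 * (σ • V₃ i).2| := by
              rw [← abs_mul, Prod.smul_snd, smul_eq_mul]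
              ring_nf
          _ ≤ C * X₂ := mul_le_mul hα₂ hxi.2 (abs_nonneg _) hC0.le
    · rw [setLIntegral_univ, hMdet, abs_neg]
      refine (mul_le_mul_right key _).trans ?_
      rw [← ENNReal.ofReal_mul (by positivity),
        ENNReal.ofReal_rpow_of_nonneg (by positivity) (by norm_num), ← Real.sqrt_eq_rpow,
        ← ENNReal.ofReal_mul (by positivity), ← mul_assoc, ← ENNReal.ofReal_mul (by positivity)]
      rw [show 2 * (6 * C ^ 2 * H) = 12 * C ^ 2 * H by ring]
      gcongr
  · intro i hi k hk q
    -- On a slice the first two families are strips with slopes near `0` and `α₂`, so they cross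
    -- transversally.
    have hsep : c / 2 ≤ |(V₂ k).1 - (V₁ i).1| := by
      have e₁ := (h₁ i hi).1
      have e₂ := (h₂ k hk).1
      have : |α₂| ≤ |(V₂ k).1 - (V₁ i).1| + |(V₂ k).1 - α₂| + |(V₁ i).1| := by
        calc |α₂| = |((V₂ k).1 - (V₁ i).1) - ((V₂ k).1 - α₂) + (V₁ i).1| := by ring_nf
          _ ≤ _ := (abs_add_le _ _).trans (add_le_add_left (abs_sub _ _) _)
      linarith
    have hd : 1 * -(V₂ k).1 - -(V₁ i).1 * 1 = -((V₂ k).1 - (V₁ i).1) := by ring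
    have hpos : 0 < |(V₂ k).1 - (V₁ i).1| := by linarith [half_pos hc]
    refine le_trans (measure_mono ?_) ((volume_strip_inter_strip_le (a := 1) (b := -(V₁ i).1)
      (a' := 1) (b' := -(V₂ k).1) (H := X₁) (H' := X₁) hX₁.le (P₁ i).1 (P₂ k).1
      (by rw [hd]; exact neg_ne_zero.2 (abs_pos.1 hpos))).trans ?_)
    · rintro z ⟨hz, hz'⟩
      refine ⟨le_of_eq_of_le ?_ hz.1, le_of_eq_of_le ?_ hz'.1⟩ <;> ring_nf
    · rw [hd, abs_neg]
      refine ENNReal.ofReal_le_ofReal ?_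
      calc 4 * X₁ * X₁ / |(V₂ k).1 - (V₁ i).1| ≤ 4 * X₁ * X₁ / (c / 2) := by gcongr
        _ = _ := by field_simp; ring
  · intro i hi q
    -- This quantity times `σ` is the determinant of the two strips that cut out a slice of a third
    -- slab. The factor `σ` is where the large slopes of this family help.
    have hsep : c / 2 ≤ |α₂ * (V₃ i).2 - β₂ * (V₃ i).1| := by
      have e := abs_mul_sub_mul_le hα₂ hβ₂ (h₃ i hi).2 (h₃ i hi).1
      have : |α₂ * β₃ - β₂ * α₃| ≤ |α₂ * (V₃ i).2 - β₂ * (V₃ i).1| +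
          |α₂ * ((V₃ i).2 - β₃) - β₂ * ((V₃ i).1 - α₃)| := by
        calc |α₂ * β₃ - β₂ * α₃| = |(α₂ * (V₃ i).2 - β₂ * (V₃ i).1) -
              (α₂ * ((V₃ i).2 - β₃) - β₂ * ((V₃ i).1 - α₃))| := by ring_nf
          _ ≤ _ := abs_sub _ _
      linarith
    have hd : 1 * -(α₂ * (σ * (V₃ i).2)) - -(σ * (V₃ i).1) * β₂ =
      -(σ * (α₂ * (V₃ i).2 - β₂ * (V₃ i).1)) := by ring
    have hpos : 0 < |α₂ * (V₃ i).2 - β₂ * (V₃ i).1| := by linarith [half_pos hc]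
    refine le_trans (measure_mono ?_) ((volume_strip_inter_strip_le (a := 1)
      (b := -(σ * (V₃ i).1)) (a' := β₂) (b' := -(α₂ * (σ * (V₃ i).2))) (H := X₁) (H' := C * X₂)
      hX₁.le (P₃ i).1 (α₂ * (P₃ i).2 - q)
      (by rw [hd]; exact neg_ne_zero.2 (mul_ne_zero hσ.ne' (abs_pos.1 hpos)))).trans ?_)
    · rintro z hz
      refine ⟨le_of_eq_of_le ?_ hz.1, le_of_eq_of_le ?_ hz.2⟩ <;> ring_nf
    · rw [hd, abs_neg, abs_mul, abs_of_pos hσ]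
      refine ENNReal.ofReal_le_ofReal ?_
      calc 4 * X₁ * (C * X₂) / (σ * |α₂ * (V₃ i).2 - β₂ * (V₃ i).1|) ≤
            4 * X₁ * (C * X₂) / (σ * (c / 2)) := by gcongr
        _ = _ := by field_simp; ring

/-! ### Uniformly transversal unit tubes -/

/-- The neighbourhood of width `1`, in the maximum norm, of a line. -/
def lineTube (P d : ℝ × ℝ × ℝ) : Set (ℝ × ℝ × ℝ) := {x | ∃ s : ℝ, ‖x - P - s • d‖ ≤ 1}

lemma norm_prod_le_iff {x : ℝ × ℝ × ℝ} {r : ℝ} :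
    ‖x‖ ≤ r ↔ |x.1| ≤ r ∧ |x.2.1| ≤ r ∧ |x.2.2| ≤ r := by
  simp [Prod.norm_def]

lemma applyMatrix_sub (M : Matrix (Fin 3) (Fin 3) ℝ) (x y : ℝ × ℝ × ℝ) :
    applyMatrix M (x - y) = applyMatrix M x - applyMatrix M y := by
  simp only [applyMatrix, Prod.fst_sub, Prod.snd_sub, Prod.mk_sub_mk, Prod.mk.injEq]
  refine ⟨?_, ?_, ?_⟩ <;> ring

lemma applyMatrix_smul (M : Matrix (Fin 3) (Fin 3) ℝ) (s : ℝ) (x : ℝ × ℝ × ℝ) :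
    applyMatrix M (s • x) = s • applyMatrix M x := by
  simp only [applyMatrix, Prod.smul_fst, Prod.smul_snd, Prod.smul_mk, smul_eq_mul, Prod.mk.injEq]
  refine ⟨?_, ?_, ?_⟩ <;> ring

/-- Eliminating the parameter of a line. -/
lemma abs_sub_slope_le {t t' a b s d d' Γ : ℝ} (h : |t - a - s * d| ≤ Γ)
    (h' : |t' - b - s * d'| ≤ Γ) (hd : 1 / 2 ≤ d) (hd' : |d'| ≤ 1 / 2) :
    |t' - (b - a * (d' / d)) - t * (d' / d)| ≤ 2 * Γ := by
  have hd0 : 0 < d := by linarith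
  have hv : |d' / d| ≤ 1 := by
    rw [abs_div, abs_of_pos hd0, div_le_one hd0]
    linarith
  have hv' : d' / d * d = d' := div_mul_cancel₀ _ hd0.ne'
  calc |t' - (b - a * (d' / d)) - t * (d' / d)|
      = |(t' - b - s * d') - d' / d * (t - a - s * d)| := by
        rw [mul_sub (d' / d) (t - a) (s * d), mul_left_comm, hv']
        ring_nf
    _ ≤ Γ + 1 * Γ := by
        refine (abs_sub _ _).trans (add_le_add h' ?_)
        rw [abs_mul]
        exact mul_le_mul hv h (abs_nonneg _) zero_le_one
    _ = 2 * Γ := by ring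

lemma abs_slope_le {d d' γ : ℝ} (hd : 1 / 2 ≤ d) (hd' : |d'| ≤ γ) : |d' / d| ≤ 2 * γ := by
  have hd0 : 0 < d := by linarith
  rw [abs_div, abs_of_pos hd0, div_le_iff₀ hd0]
  nlinarith [abs_nonneg d']

/-- The trilinear Kakeya inequality for unit tubes with uniformly transversal directions. -/
theorem exists_kakeya_lineTube {ε c C : ℝ} (hε : 0 < ε) (hc : 0 < c) (hC : 1 ≤ C) :
    ∃ η B : ℝ, 0 < η ∧ 0 < B ∧ ∀ {ι₁ ι₂ ι₃ : Type} (s₁ : Finset ι₁) (s₂ : Finset ι₂)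
      (s₃ : Finset ι₃) (P₁ d₁ : ι₁ → ℝ × ℝ × ℝ) (P₂ d₂ : ι₂ → ℝ × ℝ × ℝ)
      (P₃ d₃ : ι₃ → ℝ × ℝ × ℝ) {α₂ β₂ α₃ β₃ κ : ℝ},
      |α₂| ≤ C → |β₂| ≤ C → |α₃| ≤ C → |β₃| ≤ C → |κ| ≤ 1 → c ≤ |α₂ * β₃ - β₂ * α₃| →
      (∀ i ∈ s₁, ‖d₁ i - (0, 0, 1)‖ ≤ η) → (∀ i ∈ s₂, ‖d₂ i - (α₂, β₂, 1)‖ ≤ η) →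
      (∀ i ∈ s₃, ‖d₃ i - (α₃, β₃, κ)‖ ≤ η) →
      ∀ (x₀ : ℝ × ℝ × ℝ) {S : ℝ}, 1 ≤ S →
      ∫⁻ x in Metric.closedBall x₀ S,
          sqrtProd (multiplicity s₁ (fun i => lineTube (P₁ i) (d₁ i)) x)
            (multiplicity s₂ (fun i => lineTube (P₂ i) (d₂ i)) x)
            (multiplicity s₃ (fun i => lineTube (P₃ i) (d₃ i)) x) ≤
        ENNReal.ofReal (B * S ^ ε) * sqrtProd s₁.card s₂.card s₃.card := by
  obtain ⟨δ, hδ, hkak⟩ := exists_slope_kakeya_near_axes hε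
  set Γ : ℝ := 1 + 4 * C / c with hΓ
  have hC0 : 0 < C := by linarith
  have hΓ1 : 1 ≤ Γ := by
    rw [hΓ]
    linarith [div_pos (mul_pos four_pos hC0) hc]
  have hΓ0 : 0 < Γ := by linarith
  -- `Γ` bounds the straightening map below in the maximum norm. The condition `Γ * η ≤ 1 / 2` keeps
  -- the main component of each direction at least `1 / 2`, and `2 * (Γ * η) ≤ δ` then bounds the
  -- slopes. The factor `2 * C ^ 2` bounds the inverse determinant `|Δ|`.
  refine ⟨min (1 / 2) (δ / 2) / Γ, 2 * C ^ 2 * (216 * (4 * (2 * Γ)) ^ 3), by positivity,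
    by positivity, ?_⟩
  set η := min (1 / 2) (δ / 2) / Γ with hη
  have hηΓ : Γ * η ≤ 1 / 2 := by
    rw [hη, mul_div_cancel₀ _ hΓ0.ne']
    exact min_le_left _ _
  have hηδ : 2 * (Γ * η) ≤ δ := by
    rw [hη, mul_div_cancel₀ _ hΓ0.ne']
    linarith [min_le_right (1 / 2) (δ / 2)]
  intro ι₁ ι₂ ι₃ s₁ s₂ s₃ P₁ d₁ P₂ d₂ P₃ d₃ α₂ β₂ α₃ β₃ κ hα₂ hβ₂ hα₃ hβ₃ hκ hdet h₁ h₂ h₃ x₀ S hS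
  set Δ := α₂ * β₃ - β₂ * α₃ with hΔ
  have hΔabs : 0 < |Δ| := hc.trans_le hdet
  have hΔ0 : Δ ≠ 0 := abs_pos.1 hΔabs
  -- This is the inverse of the matrix whose columns are the three reference directions. Since the
  -- first of them is vertical, the determinant does not involve `κ`, so the bounds remain uniform
  -- when the third direction is almost horizontal.
  set M : Matrix (Fin 3) (Fin 3) ℝ := !![(κ * β₂ - β₃) * Δ⁻¹, (α₃ - κ * α₂) * Δ⁻¹, 1;
    β₃ * Δ⁻¹, -α₃ * Δ⁻¹, 0; -β₂ * Δ⁻¹, α₂ * Δ⁻¹, 0] with hM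
  have hMx : ∀ x, applyMatrix M x = (x.2.2 - (β₃ * x.1 - α₃ * x.2.1) / Δ -
      κ * ((α₂ * x.2.1 - β₂ * x.1) / Δ), (β₃ * x.1 - α₃ * x.2.1) / Δ,
      (α₂ * x.2.1 - β₂ * x.1) / Δ) := fun x => by
    simp only [applyMatrix, hM, Matrix.of_apply, Matrix.cons_val, Prod.mk.injEq, div_eq_mul_inv]
    refine ⟨?_, ?_, ?_⟩ <;> ring
  have hMdet : M.det = Δ⁻¹ := by
    have : M.det = (α₂ * β₃ - β₂ * α₃) * (Δ⁻¹ * Δ⁻¹) := by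
      simp [hM, Matrix.det_fin_three]
      ring
    rw [this, ← hΔ, ← mul_assoc, mul_inv_cancel₀ hΔ0, one_mul]
  have hMnorm : ∀ {x r}, ‖x‖ ≤ r → ‖applyMatrix M x‖ ≤ Γ * r := by
    intro x r hx
    have hr : 0 ≤ r := (norm_nonneg x).trans hx
    obtain ⟨hx₁, hx₂, hx₃⟩ := norm_prod_le_iff.1 hx
    have hdiv : ∀ {y}, |y| ≤ C * r + C * r → |y / Δ| ≤ 2 * C / c * r := by
      intro y hy
      rw [abs_div, div_le_iff₀ hΔabs]
      calc |y| ≤ 2 * C / c * r * c := by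
            rw [mul_right_comm, div_mul_cancel₀ _ hc.ne']
            linarith
        _ ≤ _ := by gcongr
    have e₁ := hdiv (abs_mul_sub_mul_le hβ₃ hα₃ hx₁ hx₂)
    have e₂ := hdiv (abs_mul_sub_mul_le hα₂ hβ₂ hx₂ hx₁)
    have hle : 2 * C / c * r + 2 * C / c * r + r = Γ * r := by
      rw [hΓ]
      ring
    have hpos : 0 ≤ 2 * C / c * r := by positivity
    rw [hMx, norm_prod_le_iff]
    refine ⟨?_, by simp only; linarith, by simp only; linarith⟩
    have e₃ : |κ * ((α₂ * x.2.1 - β₂ * x.1) / Δ)| ≤ 1 * (2 * C / c * r) := by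
      rw [abs_mul]
      exact mul_le_mul hκ e₂ (abs_nonneg _) zero_le_one
    refine (abs_sub _ _).trans ?_
    have := abs_sub x.2.2 ((β₃ * x.1 - α₃ * x.2.1) / Δ)
    linarith
  have hM₁ : applyMatrix M (0, 0, 1) = (1, 0, 0) := by simp [hMx]
  have hM₂ : applyMatrix M (α₂, β₂, 1) = (0, 1, 0) := by
    rw [hMx]
    have e₁ : β₃ * α₂ - α₃ * β₂ = Δ := by rw [hΔ]; ring
    have e₂ : α₂ * β₂ - β₂ * α₂ = 0 := by ring
    simp only [e₁, e₂, div_self hΔ0]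
    norm_num
  have hM₃ : applyMatrix M (α₃, β₃, κ) = (0, 0, 1) := by
    rw [hMx]
    have e₁ : β₃ * α₃ - α₃ * β₃ = 0 := by ring
    simp only [e₁, ← hΔ, div_self hΔ0]
    norm_num
  have hline : ∀ {P d x}, x ∈ lineTube P d → ∃ s : ℝ,
      ‖applyMatrix M x - applyMatrix M P - s • applyMatrix M d‖ ≤ Γ := by
    rintro P d x ⟨s, hs⟩
    refine ⟨s, ?_⟩
    rw [← applyMatrix_smul, ← applyMatrix_sub, ← applyMatrix_sub]
    simpa using hMnorm hs
  set a₁ := fun i => applyMatrix M (P₁ i)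
  set a₂ := fun i => applyMatrix M (P₂ i)
  set a₃ := fun i => applyMatrix M (P₃ i)
  set e₁ := fun i => applyMatrix M (d₁ i)
  set e₂ := fun i => applyMatrix M (d₂ i)
  set e₃ := fun i => applyMatrix M (d₃ i)
  have he₁ : ∀ i ∈ s₁, 1 / 2 ≤ (e₁ i).1 ∧ |(e₁ i).2.1| ≤ Γ * η ∧ |(e₁ i).2.2| ≤ Γ * η := by
    intro i hi
    have := hMnorm (h₁ i hi)
    rw [applyMatrix_sub, hM₁, norm_prod_le_iff] at this
    simp only [Prod.fst_sub, Prod.snd_sub, sub_zero] at this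
    exact ⟨by linarith [abs_le.1 this.1], this.2⟩
  have he₂ : ∀ i ∈ s₂, 1 / 2 ≤ (e₂ i).2.1 ∧ |(e₂ i).1| ≤ Γ * η ∧ |(e₂ i).2.2| ≤ Γ * η := by
    intro i hi
    have := hMnorm (h₂ i hi)
    rw [applyMatrix_sub, hM₂, norm_prod_le_iff] at this
    simp only [Prod.fst_sub, Prod.snd_sub, sub_zero] at this
    exact ⟨by linarith [abs_le.1 this.2.1], this.1, this.2.2⟩
  have he₃ : ∀ i ∈ s₃, 1 / 2 ≤ (e₃ i).2.2 ∧ |(e₃ i).1| ≤ Γ * η ∧ |(e₃ i).2.1| ≤ Γ * η := by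
    intro i hi
    have := hMnorm (h₃ i hi)
    rw [applyMatrix_sub, hM₃, norm_prod_le_iff] at this
    simp only [Prod.fst_sub, Prod.snd_sub, sub_zero] at this
    exact ⟨by linarith [abs_le.1 this.2.2], this.1, this.2.1⟩
  set V₁ : ι₁ → ℝ × ℝ := fun i => ((e₁ i).2.1 / (e₁ i).1, (e₁ i).2.2 / (e₁ i).1)
  set V₂ : ι₂ → ℝ × ℝ := fun i => ((e₂ i).1 / (e₂ i).2.1, (e₂ i).2.2 / (e₂ i).2.1)
  set V₃ : ι₃ → ℝ × ℝ := fun i => ((e₃ i).1 / (e₃ i).2.2, (e₃ i).2.1 / (e₃ i).2.2)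
  set Q₁ : ι₁ → ℝ × ℝ := fun i =>
    ((a₁ i).2.1 - (a₁ i).1 * (V₁ i).1, (a₁ i).2.2 - (a₁ i).1 * (V₁ i).2)
  set Q₂ : ι₂ → ℝ × ℝ := fun i =>
    ((a₂ i).1 - (a₂ i).2.1 * (V₂ i).1, (a₂ i).2.2 - (a₂ i).2.1 * (V₂ i).2)
  set Q₃ : ι₃ → ℝ × ℝ := fun i =>
    ((a₃ i).1 - (a₃ i).2.2 * (V₃ i).1, (a₃ i).2.1 - (a₃ i).2.2 * (V₃ i).2)
  -- Eliminating the parameter of the axis doubles the width `Γ`. The radius is taken as `2 * Γ *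
  -- S`, although `Γ * S` would contain the image of the ball, so that its ratio to the width is
  -- exactly `S`.
  have hk := hkak s₁ s₂ s₃ Q₁ V₁ Q₂ V₂ Q₃ V₃
    (fun i hi => ⟨(abs_slope_le (he₁ i hi).1 (he₁ i hi).2.1).trans hηδ,
      (abs_slope_le (he₁ i hi).1 (he₁ i hi).2.2).trans hηδ⟩)
    (fun i hi => ⟨(abs_slope_le (he₂ i hi).1 (he₂ i hi).2.1).trans hηδ,
      (abs_slope_le (he₂ i hi).1 (he₂ i hi).2.2).trans hηδ⟩)
    (fun i hi => ⟨(abs_slope_le (he₃ i hi).1 (he₃ i hi).2.1).trans hηδ,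
      (abs_slope_le (he₃ i hi).1 (he₃ i hi).2.2).trans hηδ⟩)
    (applyMatrix M x₀) (2 * Γ) (2 * Γ * S) (by positivity) (by nlinarith)
  rw [mul_div_cancel_left₀ _ (by positivity)] at hk
  set F := kakeyaIntegrand s₁ s₂ s₃ Q₁ V₁ Q₂ V₂ Q₃ V₃ (2 * Γ) with hF
  refine (setLIntegral_le_of_applyMatrix (M := M)
      (D' := Metric.closedBall (applyMatrix M x₀) (2 * Γ * S)) (g := F)
      (by rw [hMdet]; exact inv_ne_zero hΔ0) measurableSet_closedBall measurableSet_closedBall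
      (measurable_kakeyaIntegrand _ _ _ _ _ _ _ _ _ _) ?_ fun x _ => ?_).trans ?_
  · intro x hx
    rw [Metric.mem_closedBall, dist_eq_norm] at hx ⊢
    rw [← applyMatrix_sub]
    refine (hMnorm hx).trans ?_
    nlinarith
  · refine sqrtProd_mono ?_ ?_ ?_
    · refine multiplicity_le_of_imp fun i hi hx => ?_
      obtain ⟨s, hs⟩ := hline hx
      obtain ⟨g₁, g₂, g₃⟩ := norm_prod_le_iff.1 hs
      exact ⟨abs_sub_slope_le g₁ g₂ (he₁ i hi).1 ((he₁ i hi).2.1.trans hηΓ),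
        abs_sub_slope_le g₁ g₃ (he₁ i hi).1 ((he₁ i hi).2.2.trans hηΓ)⟩
    · refine multiplicity_le_of_imp fun i hi hx => ?_
      obtain ⟨s, hs⟩ := hline hx
      obtain ⟨g₁, g₂, g₃⟩ := norm_prod_le_iff.1 hs
      exact ⟨abs_sub_slope_le g₂ g₁ (he₂ i hi).1 ((he₂ i hi).2.1.trans hηΓ),
        abs_sub_slope_le g₂ g₃ (he₂ i hi).1 ((he₂ i hi).2.2.trans hηΓ)⟩
    · refine multiplicity_le_of_imp fun i hi hx => ?_
      obtain ⟨s, hs⟩ := hline hx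
      obtain ⟨g₁, g₂, g₃⟩ := norm_prod_le_iff.1 hs
      exact ⟨abs_sub_slope_le g₃ g₁ (he₃ i hi).1 ((he₃ i hi).2.1.trans hηΓ),
        abs_sub_slope_le g₃ g₂ (he₃ i hi).1 ((he₃ i hi).2.2.trans hηΓ)⟩
  · have hΔC : |Δ| ≤ 2 * C ^ 2 := by
      have := abs_mul_sub_mul_le hα₂ hβ₂ hβ₃ hα₃
      rw [← hΔ] at this
      linarith
    refine (mul_le_mul_right hk _).trans ?_
    rw [hMdet, abs_inv, inv_inv, ← mul_assoc, ← ENNReal.ofReal_mul (by positivity)]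
    gcongr ENNReal.ofReal ?_ * _
    rw [← mul_assoc]
    gcongr

/-! ### Covering slabs by unit tubes -/

/-- The integers of absolute value at most `⌈B⌉`. -/
noncomputable def grid (B : ℝ) : Finset ℤ := Finset.Icc (-⌈B⌉) ⌈B⌉

lemma floor_mem_grid {x B : ℝ} (hx : |x| ≤ B) : ⌊x⌋ ∈ grid B := by
  obtain ⟨h₁, h₂⟩ := abs_le.1 hx
  have hB := Int.le_ceil B
  refine Finset.mem_Icc.2 ⟨Int.le_floor.2 ?_, ?_⟩
  · push_cast
    linarith
  · have := Int.floor_le x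
    exact_mod_cast this.trans (h₂.trans hB)

lemma exists_mem_grid {x B : ℝ} (hx : |x| ≤ B) : ∃ n ∈ grid B, |x - n| ≤ 1 := by
  refine ⟨⌊x⌋, floor_mem_grid hx, ?_⟩
  rw [abs_le]
  constructor <;> linarith [Int.floor_le x, Int.lt_floor_add_one x]

lemma card_grid_le {B : ℝ} (hB : 1 ≤ B) : ((grid B).card : ℝ) ≤ 5 * B := by
  have h₀ : 0 ≤ ⌈B⌉ := Int.ceil_nonneg (by linarith)
  have h : ((grid B).card : ℤ) = 2 * ⌈B⌉ + 1 := by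
    rw [grid, Int.card_Icc, Int.toNat_of_nonneg (by linarith)]
    ring
  have h' : ((grid B).card : ℝ) = 2 * ⌈B⌉ + 1 := by exact_mod_cast h
  rw [h']
  linarith [Int.ceil_lt_add_one B]

lemma card_product_grid_le {ι : Type*} (s : Finset ι) {B B' : ℝ} (hB : 1 ≤ B) (hB' : 1 ≤ B') :
    ((s ×ˢ (grid B ×ˢ grid B')).card : ℝ≥0∞) ≤ ENNReal.ofReal (25 * (B * B')) * s.card := by
  have h : (((grid B).card * (grid B').card : ℕ) : ℝ) ≤ 25 * (B * B') := by
    push_cast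
    nlinarith [card_grid_le hB, card_grid_le hB',
      mul_le_mul (card_grid_le hB) (card_grid_le hB') (Nat.cast_nonneg _) (by positivity)]
  rw [Finset.card_product, Finset.card_product, Nat.cast_mul, mul_comm]
  gcongr
  rw [← ENNReal.ofReal_natCast]
  exact ENNReal.ofReal_le_ofReal h

lemma sqrtProd_ofReal {a b c : ℝ} (ha : 0 ≤ a) (hb : 0 ≤ b) (hc : 0 ≤ c) :
    sqrtProd (ENNReal.ofReal a) (ENNReal.ofReal b) (ENNReal.ofReal c) =
      ENNReal.ofReal √(a * b * c) := by
  have h : (0 : ℝ) ≤ 1 / 2 := by norm_num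
  rw [sqrtProd, ← ENNReal.mul_rpow_of_nonneg _ _ h, ← ENNReal.mul_rpow_of_nonneg _ _ h,
    ← ENNReal.ofReal_mul ha, ← ENNReal.ofReal_mul (by positivity),
    ENNReal.ofReal_rpow_of_nonneg (by positivity) h, Real.sqrt_eq_rpow]

/-- The trilinear Kakeya inequality for slabs, obtained by covering them with unit tubes. -/
theorem exists_kakeya_slab {ε c C : ℝ} (hε : 0 < ε) (hc : 0 < c) (hC : 1 ≤ C) :
    ∃ η B : ℝ, 0 < η ∧ 0 < B ∧ ∀ {ι₁ ι₂ ι₃ : Type} (s₁ : Finset ι₁) (s₂ : Finset ι₂)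
      (s₃ : Finset ι₃) (P₁ V₁ : ι₁ → ℝ × ℝ) (P₂ V₂ : ι₂ → ℝ × ℝ)
      (P₃ V₃ : ι₃ → ℝ × ℝ) {α₂ β₂ α₃ β₃ σ X₁ X₂ : ℝ},
      |α₂| ≤ C → |β₂| ≤ C → |α₃| ≤ C → |β₃| ≤ C → 1 ≤ σ → c ≤ |α₂ * β₃ - β₂ * α₃| →
      c ≤ |α₃| → 1 ≤ X₁ → 1 ≤ X₂ →
      (∀ i ∈ s₁, |(V₁ i).1| ≤ η ∧ |(V₁ i).2| ≤ η) →
      (∀ i ∈ s₂, |(V₂ i).1 - α₂| ≤ η ∧ |(V₂ i).2 - β₂| ≤ η) →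
      (∀ i ∈ s₃, |(V₃ i).1 - α₃| ≤ η ∧ |(V₃ i).2 - β₃| ≤ η) →
      ∀ (x₀ : ℝ × ℝ × ℝ) {S : ℝ}, 1 ≤ S →
      ∫⁻ x in Metric.closedBall x₀ S,
          sqrtProd (multiplicity s₁ (fun i => slab X₁ X₂ (P₁ i) (V₁ i)) x)
            (multiplicity s₂ (fun i => slab X₁ X₂ (P₂ i) (V₂ i)) x)
            (multiplicity s₃ (fun i => slab X₁ X₂ (P₃ i) (σ • V₃ i)) x) ≤
        ENNReal.ofReal (B * S ^ ε * √((25 * (X₁ * X₂)) * (25 * (X₁ * X₂)) *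
          (25 * ((X₂ + 4 * C / c * X₁) * (1 + 2 * X₁ / (c * σ)))))) *
          sqrtProd s₁.card s₂.card s₃.card := by
  obtain ⟨η₀, B, hη₀, hB, hkak⟩ := exists_kakeya_lineTube hε hc hC
  refine ⟨min η₀ (min (c / 2) 1), B, by positivity, hB, ?_⟩
  set η := min η₀ (min (c / 2) 1) with hη
  have hη₀' : η ≤ η₀ := min_le_left _ _
  have hηc : η ≤ c / 2 := (min_le_right _ _).trans (min_le_left _ _)
  have hη1 : η ≤ 1 := (min_le_right _ _).trans (min_le_right _ _)
  intro ι₁ ι₂ ι₃ s₁ s₂ s₃ P₁ V₁ P₂ V₂ P₃ V₃ α₂ β₂ α₃ β₃ σ X₁ X₂ hα₂ hβ₂ hα₃ hβ₃ hσ hdet hcα₃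
    hX₁ hX₂ h₁ h₂ h₃ x₀ S hS
  have hσ0 : 0 < σ := by linarith
  have hC0 : 0 < C := by linarith
  -- A third slab is covered starting from its section by the plane where the first coordinate
  -- equals the intercept, not from a horizontal section. Sliding along the axis to this plane
  -- shifts the second coordinate by at most `4 * C / c * X₁` and the height by at most `2 * X₁ / (c
  -- * σ)`, whence the section sizes `B₁` and `B₂`.
  set B₁ := X₂ + 4 * C / c * X₁ with hB₁
  set B₂ := 1 + 2 * X₁ / (c * σ) with hB₂
  have hB₁1 : 1 ≤ B₁ := by
    have : 0 ≤ 4 * C / c * X₁ := by positivity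
    linarith
  have hB₂1 : 1 ≤ B₂ := by
    have : 0 ≤ 2 * X₁ / (c * σ) := by positivity
    linarith
  set G := grid X₁ ×ˢ grid X₂
  set G' := grid B₁ ×ˢ grid B₂
  have hk := hkak (s₁ ×ˢ G) (s₂ ×ˢ G) (s₃ ×ˢ G')
    (fun i => ((P₁ i.1).1 + i.2.1, (P₁ i.1).2 + i.2.2, 0))
    (fun i => ((V₁ i.1).1, (V₁ i.1).2, 1))
    (fun i => ((P₂ i.1).1 + i.2.1, (P₂ i.1).2 + i.2.2, 0))
    (fun i => ((V₂ i.1).1, (V₂ i.1).2, 1))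
    (fun i => ((P₃ i.1).1, (P₃ i.1).2 + i.2.1, i.2.2))
    (fun i => ((V₃ i.1).1, (V₃ i.1).2, σ⁻¹)) (κ := σ⁻¹) hα₂ hβ₂ hα₃ hβ₃
    (by rw [abs_of_pos (by positivity)]; exact inv_le_one_of_one_le₀ hσ) hdet ?_ ?_ ?_ x₀ hS
  rotate_left
  · intro i hi
    have := h₁ i.1 (Finset.mem_product.1 hi).1
    rw [norm_prod_le_iff]
    simpa using ⟨this.1.trans hη₀', this.2.trans hη₀', hη₀.le⟩
  · intro i hi
    have := h₂ i.1 (Finset.mem_product.1 hi).1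
    rw [norm_prod_le_iff]
    simpa using ⟨this.1.trans hη₀', this.2.trans hη₀', hη₀.le⟩
  · intro i hi
    have := h₃ i.1 (Finset.mem_product.1 hi).1
    rw [norm_prod_le_iff]
    simpa using ⟨this.1.trans hη₀', this.2.trans hη₀', hη₀.le⟩
  have hcov : ∀ (P V : ℝ × ℝ) (x : ℝ × ℝ × ℝ), x ∈ slab X₁ X₂ P V →
      ∃ g ∈ G, x ∈ lineTube (P.1 + g.1, P.2 + g.2, 0) (V.1, V.2, 1) := by
    intro P V x hx
    obtain ⟨n, hn, hn'⟩ := exists_mem_grid hx.1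
    obtain ⟨k, hk, hk'⟩ := exists_mem_grid hx.2
    refine ⟨(n, k), Finset.mem_product.2 ⟨hn, hk⟩, x.2.2, norm_prod_le_iff.2 ⟨?_, ?_, ?_⟩⟩
    · refine le_of_eq_of_le (congrArg _ ?_) hn'
      simp only [Prod.fst_sub, Prod.smul_fst, smul_eq_mul]
      ring
    · refine le_of_eq_of_le (congrArg _ ?_) hk'
      simp only [Prod.fst_sub, Prod.snd_sub, Prod.smul_fst, Prod.smul_snd, smul_eq_mul]
      ring
    · simp
  have hcov' : ∀ i ∈ s₃, ∀ x ∈ slab X₁ X₂ (P₃ i) (σ • V₃ i),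
      ∃ g ∈ G', x ∈ lineTube ((P₃ i).1, (P₃ i).2 + g.1, g.2) ((V₃ i).1, (V₃ i).2, σ⁻¹) := by
    intro i hi x hx
    set a := (V₃ i).1 with ha
    set b := (V₃ i).2 with hb
    have hac : c / 2 ≤ |a| := by
      have := (h₃ i hi).1
      rw [abs_sub_comm] at this
      linarith [abs_sub_abs_le_abs_sub α₃ a]
    have hbC : |b| ≤ 2 * C := by
      linarith [(h₃ i hi).2, abs_sub_abs_le_abs_sub b β₃]
    have ha0 : a ≠ 0 := abs_pos.1 (by linarith [half_pos hc])
    set e₁ := x.1 - (P₃ i).1 - x.2.2 * (σ • V₃ i).1 with he₁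
    set e₂ := x.2.1 - (P₃ i).2 - x.2.2 * (σ • V₃ i).2 with he₂
    have hs : |e₁ / a| ≤ 2 * X₁ / c := by
      rw [abs_div]
      calc |e₁| / |a| ≤ X₁ / (c / 2) := by
            gcongr
            exact hx.1
        _ = _ := by field_simp
    have hy : |e₂ - e₁ / a * b| ≤ B₁ := by
      calc |e₂ - e₁ / a * b| ≤ X₂ + 2 * X₁ / c * (2 * C) := by
            refine (abs_sub _ _).trans (add_le_add hx.2 ?_)
            rw [abs_mul]
            exact mul_le_mul hs hbC (abs_nonneg _) (by positivity)
        _ = B₁ := by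
            rw [hB₁]
            ring
    have hz : |-(e₁ / a) * σ⁻¹| ≤ B₂ := by
      rw [abs_mul, abs_neg, abs_of_pos (inv_pos.2 hσ0)]
      calc |e₁ / a| * σ⁻¹ ≤ 2 * X₁ / c * σ⁻¹ := by gcongr
        _ = 2 * X₁ / (c * σ) := by field_simp
        _ ≤ B₂ := by linarith
    obtain ⟨n, hn, hn'⟩ := exists_mem_grid hy
    obtain ⟨k, hk, hk'⟩ := exists_mem_grid hz
    -- With the direction normalised to `((V₃ i).1, (V₃ i).2, σ⁻¹)`, the term `e₁ / a` of the
    -- parameter removes the offset in the first coordinate completely.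
    refine ⟨(n, k), Finset.mem_product.2 ⟨hn, hk⟩, σ * x.2.2 + e₁ / a,
      norm_prod_le_iff.2 ⟨?_, ?_, ?_⟩⟩
    · refine le_of_eq_of_le ?_ zero_le_one
      simp only [Prod.fst_sub, Prod.smul_fst, smul_eq_mul]
      rw [add_mul, div_mul_cancel₀ _ ha0, he₁, Prod.smul_fst, smul_eq_mul, ← ha, abs_eq_zero]
      ring
    · refine le_of_eq_of_le (congrArg _ ?_) hn'
      simp only [Prod.fst_sub, Prod.snd_sub, Prod.smul_fst, Prod.smul_snd, smul_eq_mul, he₂, ← hb]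
      ring
    · refine le_of_eq_of_le (congrArg _ ?_) hk'
      simp only [Prod.snd_sub, Prod.smul_snd, smul_eq_mul]
      field_simp
      ring
  refine (lintegral_mono fun x => ?_).trans (hk.trans ?_)
  · exact sqrtProd_mono (multiplicity_le_product _ _ fun i _ hx => hcov _ _ x hx)
      (multiplicity_le_product _ _ fun i _ hx => hcov _ _ x hx)
      (multiplicity_le_product _ _ fun i hi hx => hcov' i hi x hx)
  · rw [ENNReal.ofReal_mul (p := B * S ^ ε) (by positivity), mul_assoc,
      ← sqrtProd_ofReal (by positivity) (by positivity) (by positivity), ← sqrtProd_mul]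
    gcongr
    exact sqrtProd_mono (card_product_grid_le _ hX₁ hX₂) (card_product_grid_le _ hX₁ hX₂)
      (card_product_grid_le _ hB₁1 hB₂1)

/-! ### Slabs with slopes in small cells: the two regimes -/

/-- Interchanging the first two axes. -/
lemma setLIntegral_slab_le_swap {ι₁ ι₂ ι₃ : Type*} (s₁ : Finset ι₁) (s₂ : Finset ι₂)
    (s₃ : Finset ι₃) (P₁ V₁ : ι₁ → ℝ × ℝ) (P₂ V₂ : ι₂ → ℝ × ℝ) (P₃ V₃ : ι₃ → ℝ × ℝ)
    (X₁ X₂ : ℝ) {D D' : Set (ℝ × ℝ × ℝ)} (hD : MeasurableSet D) (hD' : MeasurableSet D')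
    (h : ∀ x ∈ D, (x.2.1, x.1, x.2.2) ∈ D') :
    ∫⁻ x in D, sqrtProd (multiplicity s₁ (fun i => slab X₁ X₂ (P₁ i) (V₁ i)) x)
          (multiplicity s₂ (fun i => slab X₁ X₂ (P₂ i) (V₂ i)) x)
          (multiplicity s₃ (fun i => slab X₁ X₂ (P₃ i) (V₃ i)) x) ≤
      ∫⁻ x in D', sqrtProd
          (multiplicity s₁ (fun i => slab X₂ X₁ (P₁ i).swap (V₁ i).swap) x)
          (multiplicity s₂ (fun i => slab X₂ X₁ (P₂ i).swap (V₂ i).swap) x)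
          (multiplicity s₃ (fun i => slab X₂ X₁ (P₃ i).swap (V₃ i).swap) x) := by
  set M : Matrix (Fin 3) (Fin 3) ℝ := !![0, 1, 0; 1, 0, 0; 0, 0, 1] with hM
  have hMdet : M.det = -1 := by simp [hM, Matrix.det_fin_three]
  have hMx : ∀ x, applyMatrix M x = (x.2.1, x.1, x.2.2) := fun x => by
    simp [applyMatrix, hM]
  have key := setLIntegral_le_of_applyMatrix (M := M) (by rw [hMdet]; norm_num) hD hD'
    (measurable_sqrtProd (measurable_multiplicity s₁ fun i =>
        measurableSet_slab X₂ X₁ (P₁ i).swap (V₁ i).swap)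
      (measurable_multiplicity s₂ fun i => measurableSet_slab X₂ X₁ (P₂ i).swap (V₂ i).swap)
      (measurable_multiplicity s₃ fun i => measurableSet_slab X₂ X₁ (P₃ i).swap (V₃ i).swap))
    (fun x hx => by rw [hMx]; exact h x hx)
    (f := fun x => sqrtProd (multiplicity s₁ (fun i => slab X₁ X₂ (P₁ i) (V₁ i)) x)
          (multiplicity s₂ (fun i => slab X₁ X₂ (P₂ i) (V₂ i)) x)
          (multiplicity s₃ (fun i => slab X₁ X₂ (P₃ i) (V₃ i)) x)) fun x _ => by
      rw [hMx]
      exact sqrtProd_mono (multiplicity_le_of_imp fun i _ hx => ⟨hx.2, hx.1⟩)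
        (multiplicity_le_of_imp fun i _ hx => ⟨hx.2, hx.1⟩)
        (multiplicity_le_of_imp fun i _ hx => ⟨hx.2, hx.1⟩)
  simpa [hMdet] using key

/-- The trilinear integrand of three families of slabs of the same widths. -/
noncomputable def slabIntegrand {ι₁ ι₂ ι₃ : Type*} (s₁ : Finset ι₁) (s₂ : Finset ι₂)
    (s₃ : Finset ι₃) (P₁ V₁ : ι₁ → ℝ × ℝ) (P₂ V₂ : ι₂ → ℝ × ℝ) (P₃ V₃ : ι₃ → ℝ × ℝ)
    (X₁ X₂ : ℝ) (x : ℝ × ℝ × ℝ) : ℝ≥0∞ :=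
  sqrtProd (multiplicity s₁ (fun i => slab X₁ X₂ (P₁ i) (V₁ i)) x)
    (multiplicity s₂ (fun i => slab X₁ X₂ (P₂ i) (V₂ i)) x)
    (multiplicity s₃ (fun i => slab X₁ X₂ (P₃ i) (V₃ i)) x)

/-- Multiplied by the slab thickness of order `X * τ`, this is the bound required in the planar
regime. Assuming only `X₁ ≤ 6 * C * X` admits interchanged axes, where `X₁ = 6 * (X * τ)` with `τ ≤
C`. -/
lemma sqrt_planar_le {X τ ρ c C X₁ X₂ : ℝ} (hX : 1 ≤ X) (hτ : 1 ≤ τ) (hρ : 1 ≤ ρ)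
    (hc : 0 < c) (hC : 1 ≤ C) (hX₁ : 0 < X₁) (hX₁C : X₁ ≤ 6 * C * X)
    (hX₁₂ : X₁ * X₂ = 36 * (X * (X * τ))) :
    √(8 * X₁ ^ 2 / c * (8 * C * X₁ * X₂ / (X / ρ * c))) ≤
      288 * C ^ 2 / c * (X * √(X * τ * ρ)) := by
  have hX0 : 0 < X := by linarith
  have hτ0 : 0 < τ := by linarith
  have hρ0 : 0 < ρ := by linarith
  have hC0 : 0 < C := by linarith
  have e : 8 * X₁ ^ 2 / c * (8 * C * X₁ * X₂ / (X / ρ * c)) =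
      2304 * C * X₁ ^ 2 * (X * τ * ρ) / c ^ 2 := by
    rw [mul_assoc (8 * C) X₁ X₂, hX₁₂]
    field_simp
    ring
  have e' : (288 * C ^ 2 / c * (X * √(X * τ * ρ))) ^ 2 =
      2304 * C * (36 * C ^ 3 * X ^ 2) * (X * τ * ρ) / c ^ 2 := by
    rw [mul_pow, mul_pow X, Real.sq_sqrt (by positivity)]
    field_simp
    ring
  refine Real.sqrt_le_iff.2 ⟨by positivity, ?_⟩
  rw [e, e']
  gcongr
  calc X₁ ^ 2 ≤ (6 * C * X) ^ 2 := by gcongr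
    _ = 36 * C ^ 2 * X ^ 2 := by ring
    _ ≤ 36 * C ^ 3 * X ^ 2 := by
        gcongr
        norm_num

/-- The covering numbers `X * (X * τ)`, twice, and `X * τ * ρ` combine to the same bound as in the
planar regime. -/
lemma sqrt_covering_le {X τ ρ c C X₁ X₂ : ℝ} (hX : 1 ≤ X) (hτ : 1 ≤ τ) (hρ : 1 ≤ ρ)
    (hc : 0 < c) (hC : 1 ≤ C) (hX₁ : 0 < X₁) (hX₁τ : X₁ ≤ 6 * (X * τ)) (hX₂τ : X₂ ≤ 6 * (X * τ))
    (hX₁C : X₁ ≤ 6 * C * X) (hX₁₂ : X₁ * X₂ = 36 * (X * (X * τ))) :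
    √((25 * (X₁ * X₂)) * (25 * (X₁ * X₂)) *
        (25 * ((X₂ + 4 * C / c * X₁) * (1 + 2 * X₁ / (c * (X / ρ)))))) ≤
      900 * √(150 * (1 + 4 * C / c) * (1 + 12 * C / c)) * (X * (X * τ) * √(X * τ * ρ)) := by
  have hX0 : 0 < X := by linarith
  have hτ0 : 0 < τ := by linarith
  have hρ0 : 0 < ρ := by linarith
  have hC0 : 0 < C := by linarith
  have h₁ : X₂ + 4 * C / c * X₁ ≤ 6 * (X * τ) * (1 + 4 * C / c) := by
    calc X₂ + 4 * C / c * X₁ ≤ 6 * (X * τ) + 4 * C / c * (6 * (X * τ)) := by gcongr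
      _ = _ := by ring
  have h₂ : 1 + 2 * X₁ / (c * (X / ρ)) ≤ ρ * (1 + 12 * C / c) := by
    calc 1 + 2 * X₁ / (c * (X / ρ)) ≤ ρ + 2 * (6 * C * X) / (c * (X / ρ)) := by gcongr
      _ = _ := by
        field_simp
        ring
  refine Real.sqrt_le_iff.2 ⟨by positivity, ?_⟩
  rw [mul_pow, mul_pow 900, mul_pow (X * (X * τ)), Real.sq_sqrt (by positivity),
    Real.sq_sqrt (by positivity), hX₁₂]
  calc _ ≤ (25 * (36 * (X * (X * τ)))) * (25 * (36 * (X * (X * τ)))) *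
        (25 * ((6 * (X * τ) * (1 + 4 * C / c)) * (ρ * (1 + 12 * C / c)))) := by gcongr
    _ = _ := by ring

/-- The trilinear estimate for slabs whose slopes lie in small cells. -/
theorem exists_slab_estimate {ε c C : ℝ} (hε : 0 < ε) (hc : 0 < c) (hC : 1 ≤ C) :
    ∃ η B : ℝ, 0 < η ∧ 0 < B ∧ ∀ {ι₁ ι₂ ι₃ : Type} (s₁ : Finset ι₁) (s₂ : Finset ι₂)
      (s₃ : Finset ι₃) (P₁ V₁ : ι₁ → ℝ × ℝ) (P₂ V₂ : ι₂ → ℝ × ℝ)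
      (P₃ V₃ : ι₃ → ℝ × ℝ) {α₂ β₂ α₃ β₃ X τ ρ R : ℝ},
      |α₂| ≤ C → |β₂| ≤ C → |α₃| ≤ C → |β₃| ≤ C → c ≤ |α₂ * β₃ - β₂ * α₃| →
      (c ≤ |α₂| ∨ τ ≤ C ∧ c ≤ |β₂|) → (c ≤ |α₃| ∨ τ ≤ C ∧ c ≤ |β₃|) →
      1 ≤ τ → 1 ≤ ρ → ρ ≤ X → 1 ≤ R →
      (∀ i ∈ s₁, |(V₁ i).1| ≤ η ∧ |(V₁ i).2| ≤ η) →
      (∀ i ∈ s₂, |(V₂ i).1 - α₂| ≤ η ∧ |(V₂ i).2 - β₂| ≤ η) →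
      (∀ i ∈ s₃, |(V₃ i).1 - α₃| ≤ η ∧ |(V₃ i).2 - β₃| ≤ η) →
      ∀ (x₀ : ℝ × ℝ × ℝ),
      ∫⁻ x in Metric.closedBall x₀ (12 * (X * τ) * R) ∩ {x | |x.2.2 - x₀.2.2| ≤ R},
          slabIntegrand s₁ s₂ s₃ P₁ V₁ P₂ V₂ P₃ (fun i => (X / ρ) • V₃ i)
            (6 * X) (6 * (X * τ)) x ≤
        ENNReal.ofReal (B * R ^ ε * (X * (X * τ) * √(X * τ * ρ))) *
          sqrtProd s₁.card s₂.card s₃.card := by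
  obtain ⟨η₀, B₀, hη₀, hB₀, hkak⟩ := exists_kakeya_slab (half_pos hε) hc hC
  have hC0 : 0 < C := by linarith
  set B₁ : ℝ := c⁻¹ * (12 * C ^ 2 * 6 * (288 * C ^ 2 / c)) with hB₁
  set B₂ : ℝ := B₀ * 12 ^ (ε / 2) * (900 * √(150 * (1 + 4 * C / c) * (1 + 12 * C / c))) with hB₂
  have hB₁0 : 0 < B₁ := by positivity
  have hB₂0 : 0 < B₂ := by positivity
  refine ⟨min η₀ (min (c / (4 * C)) 1), B₁ + B₂, by positivity, by positivity, ?_⟩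
  set η := min η₀ (min (c / (4 * C)) 1) with hη
  have hηη₀ : η ≤ η₀ := min_le_left _ _
  have hη1 : η ≤ 1 := (min_le_right _ _).trans (min_le_right _ _)
  have hη0 : 0 < η := by positivity
  have hηC : η * C ≤ c / 4 := by
    have : η ≤ c / (4 * C) := (min_le_right _ _).trans (min_le_left _ _)
    calc η * C ≤ c / (4 * C) * C := by gcongr
      _ = c / 4 := by field_simp
  have hηc : η ≤ c / 4 := by nlinarith
  intro ι₁ ι₂ ι₃ s₁ s₂ s₃ P₁ V₁ P₂ V₂ P₃ V₃ α₂ β₂ α₃ β₃ X τ ρ R hα₂ hβ₂ hα₃ hβ₃ hdet hD₂ hD₃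
    hτ hρ hρX hR h₁ h₂ h₃ x₀
  have hX : 1 ≤ X := hρ.trans hρX
  have hX0 : 0 < X := by linarith
  have hτ0 : 0 < τ := by linarith
  have hρ0 : 0 < ρ := by linarith
  have hR0 : 0 < R := by linarith
  have hXτ : X ≤ X * τ := by nlinarith
  have hσ : 1 ≤ X / ρ := (one_le_div hρ0).2 hρX
  have hRε : 1 ≤ R ^ ε := Real.one_le_rpow hR hε.le
  have hdet' : c ≤ |β₂ * α₃ - α₂ * β₃| := by rwa [abs_sub_comm]
  have hmeasH : ∀ z R : ℝ, MeasurableSet {x : ℝ × ℝ × ℝ | |x.2.2 - z| ≤ R} := fun z R =>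
    measurableSet_le (by fun_prop) measurable_const
  have hD := (measurableSet_closedBall (x := x₀) (ε := 12 * (X * τ) * R)).inter
    (hmeasH x₀.2.2 R)
  have h₁s : ∀ i ∈ s₁, |(V₁ i).swap.1| ≤ η ∧ |(V₁ i).swap.2| ≤ η := fun i hi => (h₁ i hi).symm
  have h₂s : ∀ i ∈ s₂, |(V₂ i).swap.1 - β₂| ≤ η ∧ |(V₂ i).swap.2 - α₂| ≤ η :=
    fun i hi => (h₂ i hi).symm
  have h₃s : ∀ i ∈ s₃, |(V₃ i).swap.1 - β₃| ≤ η ∧ |(V₃ i).swap.2 - α₃| ≤ η :=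
    fun i hi => (h₃ i hi).symm
  have hprod : 6 * X * (6 * (X * τ)) = 36 * (X * (X * τ)) := by ring
  have hprod' : 6 * (X * τ) * (6 * X) = 36 * (X * (X * τ)) := by ring
  have hX₁C : 6 * X ≤ 6 * C * X := by nlinarith
  have hX₂C : τ ≤ C → 6 * (X * τ) ≤ 6 * C * X := fun h => by nlinarith
  -- In the first case only the restriction of the heights is used. In the second only the ball is,
  -- whose radius is at most `12 * R ^ 2`; this is why the Kakeya inequality was invoked with
  -- exponent `ε / 2`.
  rcases le_or_gt R (X * τ) with hRX | hRX
  · have hbound : ∀ {X₁ X₂ : ℝ}, 0 < X₁ → X₁ ≤ 6 * C * X → X₁ * X₂ = 36 * (X * (X * τ)) →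
        c⁻¹ * (12 * C ^ 2 * (6 * (X * τ)) * √(8 * X₁ ^ 2 / c * (8 * C * X₁ * X₂ / (X / ρ * c)))) ≤
          (B₁ + B₂) * R ^ ε * (X * (X * τ) * √(X * τ * ρ)) := by
      intro X₁ X₂ hX₁ hX₁C hX₁₂
      calc _ ≤ c⁻¹ * (12 * C ^ 2 * (6 * (X * τ)) * (288 * C ^ 2 / c * (X * √(X * τ * ρ)))) := by
            gcongr
            exact sqrt_planar_le hX hτ hρ hc hC hX₁ hX₁C hX₁₂
        _ = B₁ * 1 * (X * (X * τ) * √(X * τ * ρ)) := by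
            rw [hB₁]
            ring
        _ ≤ _ := by
            gcongr
            linarith
    -- The planar estimate needs a large first slope in the second family. Otherwise `τ ≤ C`, the
    -- two widths are comparable, and the horizontal axes may be interchanged.
    rcases hD₂ with hcα | ⟨hτC, hcβ⟩
    · refine (lintegral_mono_set Set.inter_subset_right).trans
        ((setLIntegral_slab_le_of_planar s₁ s₂ s₃ P₁ V₁ P₂ V₂ P₃ V₃ (H := 6 * (X * τ))
          (by positivity) (by positivity) (by linarith) le_rfl (by linarith) (by positivity) hc hC
          hηc hηC hη1 hα₂ hβ₂ hcα hdet h₁ h₂ h₃).trans ?_)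
      gcongr ENNReal.ofReal ?_ * _
      exact hbound (by positivity) hX₁C hprod
    · refine (setLIntegral_slab_le_swap s₁ s₂ s₃ P₁ V₁ P₂ V₂ P₃ (fun i => (X / ρ) • V₃ i) _ _ hD
        (hmeasH x₀.2.2 R) fun x hx => hx.2).trans
        ((setLIntegral_slab_le_of_planar s₁ s₂ s₃ (fun i => (P₁ i).swap) (fun i => (V₁ i).swap)
          (fun i => (P₂ i).swap) (fun i => (V₂ i).swap) (fun i => (P₃ i).swap)
          (fun i => (V₃ i).swap) (H := 6 * (X * τ))
          (by positivity) (by positivity) le_rfl (by linarith) (by linarith) (by positivity) hc hC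
          hηc hηC hη1 hβ₂ hα₂ hcβ hdet' h₁s h₂s h₃s).trans ?_)
      gcongr ENNReal.ofReal ?_ * _
      exact hbound (by positivity) (hX₂C hτC) hprod'
  · have hS : 1 ≤ 12 * (X * τ) * R := by
      have : 1 ≤ X * τ * R := one_le_mul_of_one_le_of_one_le (hX.trans hXτ) hR
      linarith
    have hSε : (12 * (X * τ) * R) ^ (ε / 2) ≤ 12 ^ (ε / 2) * R ^ ε := by
      calc (12 * (X * τ) * R) ^ (ε / 2) ≤ (12 * (R * R)) ^ (ε / 2) := by
            refine Real.rpow_le_rpow (by positivity) ?_ (by positivity)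
            rw [mul_assoc]
            gcongr
        _ = 12 ^ (ε / 2) * R ^ ε := by
            rw [Real.mul_rpow (by norm_num) (by positivity), Real.mul_rpow hR0.le hR0.le,
              ← Real.rpow_add hR0, add_halves]
    have hbound : ∀ {X₁ X₂ : ℝ}, 0 < X₁ → X₁ ≤ 6 * (X * τ) → X₂ ≤ 6 * (X * τ) →
        X₁ ≤ 6 * C * X → X₁ * X₂ = 36 * (X * (X * τ)) →
        B₀ * (12 * (X * τ) * R) ^ (ε / 2) * √((25 * (X₁ * X₂)) * (25 * (X₁ * X₂)) *
            (25 * ((X₂ + 4 * C / c * X₁) * (1 + 2 * X₁ / (c * (X / ρ)))))) ≤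
          (B₁ + B₂) * R ^ ε * (X * (X * τ) * √(X * τ * ρ)) := by
      intro X₁ X₂ hX₁ hX₁τ hX₂τ hX₁C hX₁₂
      calc _ ≤ B₀ * (12 ^ (ε / 2) * R ^ ε) *
              (900 * √(150 * (1 + 4 * C / c) * (1 + 12 * C / c)) *
                (X * (X * τ) * √(X * τ * ρ))) := by
            gcongr
            exact sqrt_covering_le hX hτ hρ hc hC hX₁ hX₁τ hX₂τ hX₁C hX₁₂
        _ = B₂ * R ^ ε * (X * (X * τ) * √(X * τ * ρ)) := by
            rw [hB₂]
            ring
        _ ≤ _ := by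
            gcongr
            linarith
    have weaken : ∀ {a b : ℝ}, a ≤ η ∧ b ≤ η → a ≤ η₀ ∧ b ≤ η₀ := fun h =>
      ⟨h.1.trans hηη₀, h.2.trans hηη₀⟩
    rcases hD₃ with hcα | ⟨hτC, hcβ⟩
    · refine (lintegral_mono_set Set.inter_subset_left).trans
        ((hkak s₁ s₂ s₃ P₁ V₁ P₂ V₂ P₃ V₃ hα₂ hβ₂ hα₃ hβ₃ hσ hdet hcα (by linarith) (by linarith)
          (fun i hi => weaken (h₁ i hi)) (fun i hi => weaken (h₂ i hi))
          (fun i hi => weaken (h₃ i hi)) x₀ hS).trans ?_)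
      gcongr ENNReal.ofReal ?_ * _
      exact hbound (by positivity) (by linarith) le_rfl hX₁C hprod
    · refine (setLIntegral_slab_le_swap s₁ s₂ s₃ P₁ V₁ P₂ V₂ P₃ (fun i => (X / ρ) • V₃ i) _ _ hD
        (measurableSet_closedBall (x := (x₀.2.1, x₀.1, x₀.2.2)) (ε := 12 * (X * τ) * R))
        fun x hx => ?_).trans
        ((hkak s₁ s₂ s₃ (fun i => (P₁ i).swap) (fun i => (V₁ i).swap)
          (fun i => (P₂ i).swap) (fun i => (V₂ i).swap) (fun i => (P₃ i).swap)
          (fun i => (V₃ i).swap) hβ₂ hα₂ hβ₃ hα₃ hσ hdet' hcβ (by linarith) (by linarith)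
          (fun i hi => weaken (h₁s i hi)) (fun i hi => weaken (h₂s i hi))
          (fun i hi => weaken (h₃s i hi)) _ hS).trans ?_)
      · have := mem_closedBall_prod.1 hx.1
        exact mem_closedBall_prod.2 ⟨this.2.1, this.1, this.2.2⟩
      · gcongr ENNReal.ofReal ?_ * _
        exact hbound (by positivity) le_rfl (by linarith) (hX₂C hτC) hprod'

/-! ### Decomposition into cells -/

lemma sqrt_sum_le {κ : Type*} (J : Finset κ) (f : κ → ℝ≥0∞) :
    (∑ k ∈ J, f k) ^ (1 / 2 : ℝ) ≤ ∑ k ∈ J, f k ^ (1 / 2 : ℝ) := by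
  classical
  induction J using Finset.induction_on with
  | empty => simp
  | insert a s ha ih =>
    rw [Finset.sum_insert ha, Finset.sum_insert ha]
    exact (ENNReal.rpow_add_le_add_rpow _ _ (by norm_num) (by norm_num)).trans (by gcongr)

lemma sqrtProd_sum_le {κ : Type*} (J : Finset κ) (a b c : κ → ℝ≥0∞) :
    sqrtProd (∑ k ∈ J, a k) (∑ k ∈ J, b k) (∑ k ∈ J, c k) ≤
      ∑ k ∈ J, ∑ l ∈ J, ∑ n ∈ J, sqrtProd (a k) (b l) (c n) := by
  calc sqrtProd (∑ k ∈ J, a k) (∑ k ∈ J, b k) (∑ k ∈ J, c k)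
      ≤ (∑ k ∈ J, a k ^ (1 / 2 : ℝ)) * (∑ k ∈ J, b k ^ (1 / 2 : ℝ)) *
          (∑ k ∈ J, c k ^ (1 / 2 : ℝ)) := by
        unfold sqrtProd
        gcongr <;> exact sqrt_sum_le _ _
    _ = _ := by
        rw [Finset.sum_mul_sum, Finset.sum_mul]
        refine Finset.sum_congr rfl fun k _ => ?_
        rw [Finset.sum_mul]
        exact Finset.sum_congr rfl fun l _ => Finset.mul_sum _ _ _

lemma multiplicity_eq_sum_cells {ι κ α : Type*} [DecidableEq κ] {s : Finset ι} {J : Finset κ}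
    {f : ι → κ} (hf : ∀ i ∈ s, f i ∈ J) (U : ι → Set α) (x : α) :
    multiplicity s U x = ∑ k ∈ J, multiplicity (s.filter fun i => f i = k) U x :=
  (Finset.sum_fiberwise_of_maps_to hf _).symm

/-- By subadditivity of the square root, the integrand is at most the sum over triples of cells. -/
lemma setLIntegral_le_of_cells {ι₁ ι₂ ι₃ κ α : Type*} [DecidableEq κ] [MeasurableSpace α]
    (μ : Measure α) {s₁ : Finset ι₁} {s₂ : Finset ι₂} {s₃ : Finset ι₃} {J : Finset κ}
    {f₁ : ι₁ → κ} {f₂ : ι₂ → κ} {f₃ : ι₃ → κ} (hf₁ : ∀ i ∈ s₁, f₁ i ∈ J)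
    (hf₂ : ∀ i ∈ s₂, f₂ i ∈ J) (hf₃ : ∀ i ∈ s₃, f₃ i ∈ J) {U₁ : ι₁ → Set α} {U₂ : ι₂ → Set α}
    {U₃ : ι₃ → Set α} (hU₁ : ∀ i, MeasurableSet (U₁ i)) (hU₂ : ∀ i, MeasurableSet (U₂ i))
    (hU₃ : ∀ i, MeasurableSet (U₃ i)) {T : ℝ≥0∞}
    (h : ∀ k l n, ∫⁻ x, sqrtProd (multiplicity (s₁.filter fun i => f₁ i = k) U₁ x)
      (multiplicity (s₂.filter fun i => f₂ i = l) U₂ x)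
      (multiplicity (s₃.filter fun i => f₃ i = n) U₃ x) ∂μ ≤ T) :
    ∫⁻ x, sqrtProd (multiplicity s₁ U₁ x) (multiplicity s₂ U₂ x) (multiplicity s₃ U₃ x) ∂μ ≤
      (J.card : ℝ≥0∞) ^ 3 * T := by
  have hm : ∀ k l n, Measurable fun x =>
      sqrtProd (multiplicity (s₁.filter fun i => f₁ i = k) U₁ x)
        (multiplicity (s₂.filter fun i => f₂ i = l) U₂ x)
        (multiplicity (s₃.filter fun i => f₃ i = n) U₃ x) := fun k l n =>
    measurable_sqrtProd (measurable_multiplicity _ hU₁) (measurable_multiplicity _ hU₂)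
      (measurable_multiplicity _ hU₃)
  calc _ ≤ ∫⁻ x, ∑ k ∈ J, ∑ l ∈ J, ∑ n ∈ J,
        sqrtProd (multiplicity (s₁.filter fun i => f₁ i = k) U₁ x)
          (multiplicity (s₂.filter fun i => f₂ i = l) U₂ x)
          (multiplicity (s₃.filter fun i => f₃ i = n) U₃ x) ∂μ := by
        refine lintegral_mono fun x => ?_
        simp only [multiplicity_eq_sum_cells hf₁, multiplicity_eq_sum_cells hf₂,
          multiplicity_eq_sum_cells hf₃]
        exact sqrtProd_sum_le _ _ _ _
    _ = ∑ k ∈ J, ∑ l ∈ J, ∑ n ∈ J, ∫⁻ x,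
        sqrtProd (multiplicity (s₁.filter fun i => f₁ i = k) U₁ x)
          (multiplicity (s₂.filter fun i => f₂ i = l) U₂ x)
          (multiplicity (s₃.filter fun i => f₃ i = n) U₃ x) ∂μ := by
        rw [lintegral_finsetSum _ fun k _ => Finset.measurable_fun_sum _ fun l _ =>
          Finset.measurable_fun_sum _ fun n _ => hm k l n]
        refine Finset.sum_congr rfl fun k _ => ?_
        rw [lintegral_finsetSum _ fun l _ => Finset.measurable_fun_sum _ fun n _ => hm k l n]
        refine Finset.sum_congr rfl fun l _ => ?_
        rw [lintegral_finsetSum _ fun n _ => hm k l n]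
    _ ≤ ∑ k ∈ J, ∑ l ∈ J, ∑ n ∈ J, T :=
        Finset.sum_le_sum fun k _ => Finset.sum_le_sum fun l _ => Finset.sum_le_sum fun n _ =>
          h k l n
    _ = _ := by
        simp
        ring

/-! ### Anisotropic rescaling -/

/-- The component of `ξ` in the direction `w`. -/
def along (w ξ : ℝ × ℝ) : ℝ := w.1 * ξ.1 + w.2 * ξ.2

/-- The component of `ξ` perpendicular to the direction `w`. -/
def across (w ξ : ℝ × ℝ) : ℝ := w.1 * ξ.2 - w.2 * ξ.1

lemma abs_along_le {w ξ : ℝ × ℝ} (hw : w.1 ^ 2 + w.2 ^ 2 = 1) {r : ℝ} (h₁ : |ξ.1| ≤ r)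
    (h₂ : |ξ.2| ≤ r) : |along w ξ| ≤ 2 * r := by
  have e₁ : |w.1| ≤ 1 := abs_le_one_iff_mul_self_le_one.2 (by nlinarith)
  have e₂ : |-w.2| ≤ 1 := abs_le_one_iff_mul_self_le_one.2 (by nlinarith)
  have := abs_mul_sub_mul_le e₁ e₂ h₁ h₂
  rw [along]
  rw [neg_mul, sub_neg_eq_add] at this
  linarith

lemma abs_across_le {w ξ : ℝ × ℝ} (hw : w.1 ^ 2 + w.2 ^ 2 = 1) {r : ℝ} (h₁ : |ξ.1| ≤ r)
    (h₂ : |ξ.2| ≤ r) : |across w ξ| ≤ 2 * r := by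
  have e₁ : |w.1| ≤ 1 := abs_le_one_iff_mul_self_le_one.2 (by nlinarith)
  have e₂ : |w.2| ≤ 1 := abs_le_one_iff_mul_self_le_one.2 (by nlinarith)
  have := abs_mul_sub_mul_le e₁ e₂ h₂ h₁
  rw [across]
  linarith

lemma along_sub (w ξ ζ : ℝ × ℝ) : along w (ξ - ζ) = along w ξ - along w ζ := by
  simp only [along, Prod.fst_sub, Prod.snd_sub]
  ring

lemma across_sub (w ξ ζ : ℝ × ℝ) : across w (ξ - ζ) = across w ξ - across w ζ := by
  simp only [across, Prod.fst_sub, Prod.snd_sub]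
  ring

lemma along_sq_add_across_sq {w : ℝ × ℝ} (hw : w.1 ^ 2 + w.2 ^ 2 = 1) (ξ : ℝ × ℝ) :
    along w ξ ^ 2 + across w ξ ^ 2 = ξ.1 ^ 2 + ξ.2 ^ 2 := by
  calc along w ξ ^ 2 + across w ξ ^ 2 = (w.1 ^ 2 + w.2 ^ 2) * (ξ.1 ^ 2 + ξ.2 ^ 2) := by
        simp only [along, across]
        ring
    _ = _ := by rw [hw, one_mul]

lemma along_mul_across_sub {w : ℝ × ℝ} (hw : w.1 ^ 2 + w.2 ^ 2 = 1) (ξ ζ : ℝ × ℝ) :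
    along w ξ * across w ζ - across w ξ * along w ζ = ξ.1 * ζ.2 - ξ.2 * ζ.1 := by
  calc along w ξ * across w ζ - across w ξ * along w ζ =
        (w.1 ^ 2 + w.2 ^ 2) * (ξ.1 * ζ.2 - ξ.2 * ζ.1) := by
        simp only [along, across]
        ring
    _ = _ := by rw [hw, one_mul]

/-- The coordinates of `ξ` relative to `w`, rescaled by `X` and `Y`. -/
def rescaled (w : ℝ × ℝ) (X Y : ℝ) (ξ : ℝ × ℝ) : ℝ × ℝ := (X * along w ξ, Y * across w ξ)

/-- The anisotropic linear change of variables that makes the directions transversal. -/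
lemma setLIntegral_slab_le_rescaled {ι₁ ι₂ ι₃ : Type*} (s₁ : Finset ι₁) (s₂ : Finset ι₂)
    (s₃ : Finset ι₃) (P₁ ξ₁ : ι₁ → ℝ × ℝ) (P₂ ξ₂ : ι₂ → ℝ × ℝ) (P₃ ξ₃ : ι₃ → ℝ × ℝ)
    {w o : ℝ × ℝ} {X τ R : ℝ} (hw : w.1 ^ 2 + w.2 ^ 2 = 1) (ho₁ : |o.1| ≤ 2) (ho₂ : |o.2| ≤ 2)
    (hX1 : 1 ≤ X) (hτ : 1 ≤ τ) (hR : 0 < R) (x₀ : ℝ × ℝ × ℝ) :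
    ∃ y₀ : ℝ × ℝ × ℝ, ∫⁻ x in Metric.closedBall x₀ R,
        slabIntegrand s₁ s₂ s₃ P₁ ξ₁ P₂ ξ₂ P₃ ξ₃ 3 3 x ≤
      ENNReal.ofReal (X * (X * τ))⁻¹ *
        ∫⁻ x in Metric.closedBall y₀ (12 * (X * τ) * R) ∩ {x | |x.2.2 - y₀.2.2| ≤ R},
          slabIntegrand s₁ s₂ s₃ (fun i => rescaled w X (X * τ) (P₁ i))
            (fun i => rescaled w X (X * τ) (ξ₁ i - o)) (fun i => rescaled w X (X * τ) (P₂ i))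
            (fun i => rescaled w X (X * τ) (ξ₂ i - o)) (fun i => rescaled w X (X * τ) (P₃ i))
            (fun i => rescaled w X (X * τ) (ξ₃ i - o)) (6 * X) (6 * (X * τ)) x := by
  have hX : 0 < X := by linarith
  have hτ0 : 0 < τ := by linarith
  -- The shear by `o` makes the direction of slope `o` vertical; it is followed by the rotation to
  -- the axes along and across `w` and the dilations by `X` and `X * τ`. Heights are unchanged.
  set M : Matrix (Fin 3) (Fin 3) ℝ := !![X * w.1, X * w.2, -(X * along w o);
    -(X * τ * w.2), X * τ * w.1, -(X * τ * across w o); 0, 0, 1] with hM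
  have hMdet : M.det = X * (X * τ) := by
    have : M.det = X * (X * τ) * (w.1 ^ 2 + w.2 ^ 2) := by
      simp [hM, Matrix.det_fin_three]
      ring
    rw [this, hw, mul_one]
  have hdet0 : 0 < X * (X * τ) := by positivity
  have hMx : ∀ x, applyMatrix M x = (X * along w ((x.1, x.2.1) - x.2.2 • o),
      X * τ * across w ((x.1, x.2.1) - x.2.2 • o), x.2.2) := fun x => by
    simp only [applyMatrix, hM, Matrix.of_apply, Matrix.cons_val, Prod.mk.injEq, along, across,
      Prod.fst_sub, Prod.snd_sub, Prod.smul_fst, Prod.smul_snd, smul_eq_mul]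
    refine ⟨?_, ?_, ?_⟩ <;> ring
  have hmem : ∀ {P ξ : ℝ × ℝ} {x : ℝ × ℝ × ℝ}, x ∈ slab 3 3 P ξ → applyMatrix M x ∈
      slab (6 * X) (6 * (X * τ)) (rescaled w X (X * τ) P) (rescaled w X (X * τ) (ξ - o)) := by
    intro P ξ x hx
    rw [hMx]
    have e₁ := abs_along_le (ξ := (x.1 - P.1 - x.2.2 * ξ.1, x.2.1 - P.2 - x.2.2 * ξ.2)) hw hx.1 hx.2
    have e₂ := abs_across_le (ξ := (x.1 - P.1 - x.2.2 * ξ.1, x.2.1 - P.2 - x.2.2 * ξ.2))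
      hw hx.1 hx.2
    constructor
    · calc _ = X * |along w (x.1 - P.1 - x.2.2 * ξ.1, x.2.1 - P.2 - x.2.2 * ξ.2)| := by
            rw [← abs_of_pos hX, ← abs_mul, abs_of_pos hX]
            simp only [rescaled, along, Prod.fst_sub, Prod.snd_sub, Prod.smul_fst, Prod.smul_snd,
              smul_eq_mul]
            ring_nf
        _ ≤ X * (2 * 3) := by gcongr
        _ = 6 * X := by ring
    · calc _ = X * τ * |across w (x.1 - P.1 - x.2.2 * ξ.1, x.2.1 - P.2 - x.2.2 * ξ.2)| := by
            have hXτ : 0 < X * τ := by positivity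
            rw [← abs_of_pos hXτ, ← abs_mul, abs_of_pos hXτ]
            simp only [rescaled, across, Prod.fst_sub, Prod.snd_sub, Prod.smul_fst, Prod.smul_snd,
              smul_eq_mul]
            ring_nf
        _ ≤ X * τ * (2 * 3) := by gcongr
        _ = 6 * (X * τ) := by ring
  have hm : MeasurableSet {x : ℝ × ℝ × ℝ | |x.2.2 - (applyMatrix M x₀).2.2| ≤ R} :=
    measurableSet_le (by fun_prop) measurable_const
  refine ⟨applyMatrix M x₀, ?_⟩
  have hslab := fun P V => measurableSet_slab (6 * X) (6 * (X * τ)) P V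
  have key := setLIntegral_le_of_applyMatrix (M := M) (by rw [hMdet]; exact hdet0.ne')
    (measurableSet_closedBall (x := x₀) (ε := R))
    ((measurableSet_closedBall (x := applyMatrix M x₀) (ε := 12 * (X * τ) * R)).inter hm)
    (f := slabIntegrand s₁ s₂ s₃ P₁ ξ₁ P₂ ξ₂ P₃ ξ₃ 3 3)
    (measurable_sqrtProd (measurable_multiplicity s₁ fun i => hslab _ _)
      (measurable_multiplicity s₂ fun i => hslab _ _)
      (measurable_multiplicity s₃ fun i => hslab _ _)) ?_
    (fun x _ => sqrtProd_mono (multiplicity_le_of_imp fun i _ hx => hmem hx)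
      (multiplicity_le_of_imp fun i _ hx => hmem hx)
      (multiplicity_le_of_imp fun i _ hx => hmem hx))
  · rwa [hMdet, abs_of_pos hdet0] at key
  · intro x hx
    have hx' := hx
    rw [mem_closedBall_prod] at hx'
    obtain ⟨hx₁, hx₂, hx₃⟩ := hx'
    have hz : |(applyMatrix M x).2.2 - (applyMatrix M x₀).2.2| ≤ R := by
      rw [hMx, hMx]
      exact hx₃
    have hbig : 3 * R ≤ 3 * (τ * R) := by nlinarith
    set d : ℝ × ℝ := (x.1 - x₀.1 - (x.2.2 - x₀.2.2) * o.1, x.2.1 - x₀.2.1 - (x.2.2 - x₀.2.2) * o.2)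
      with hd
    have hmul : ∀ {a : ℝ}, |a| ≤ 2 → |(x.2.2 - x₀.2.2) * a| ≤ R * 2 := fun ha => by
      rw [abs_mul]
      exact mul_le_mul hx₃ ha (abs_nonneg _) hR.le
    have hd₁ : |d.1| ≤ 3 * R := (abs_sub _ _).trans (by linarith [hmul ho₁])
    have hd₂ : |d.2| ≤ 3 * R := (abs_sub _ _).trans (by linarith [hmul ho₂])
    refine ⟨mem_closedBall_prod.2 ⟨?_, ?_, ?_⟩, hz⟩
    · calc |(applyMatrix M x).1 - (applyMatrix M x₀).1| = X * |along w d| := by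
            rw [hMx, hMx, ← abs_of_pos hX, ← abs_mul, abs_of_pos hX, hd]
            simp only [along, Prod.fst_sub, Prod.snd_sub, Prod.smul_fst, Prod.smul_snd,
              smul_eq_mul]
            ring_nf
        _ ≤ X * (2 * (3 * (τ * R))) := by
            gcongr
            exact (abs_along_le hw hd₁ hd₂).trans (by linarith)
        _ ≤ 12 * (X * τ) * R := by
            have : 0 < X * τ * R := by positivity
            linarith
    · calc |(applyMatrix M x).2.1 - (applyMatrix M x₀).2.1| = X * τ * |across w d| := by
            have hXτ : 0 < X * τ := by positivity
            rw [hMx, hMx, ← abs_of_pos hXτ, ← abs_mul, abs_of_pos hXτ, hd]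
            simp only [across, Prod.fst_sub, Prod.snd_sub, Prod.smul_fst, Prod.smul_snd,
              smul_eq_mul]
            ring_nf
        _ ≤ X * τ * (2 * (3 * R)) := by
            gcongr
            exact abs_across_le hw hd₁ hd₂
        _ ≤ 12 * (X * τ) * R := by
            have : 0 < X * τ * R := by positivity
            linarith
    · refine hz.trans ?_
      have : 1 ≤ X * τ := one_le_mul_of_one_le_of_one_le hX1 hτ
      nlinarith

/-! ### The estimate in terms of the slopes -/

/-- The cell of side length `η` of a point of the plane. -/
noncomputable def cell (η : ℝ) (x : ℝ × ℝ) : ℤ × ℤ := (⌊x.1 / η⌋, ⌊x.2 / η⌋)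

lemma abs_sub_le_of_floor_eq {η x y : ℝ} (hη : 0 < η) (h : ⌊x / η⌋ = ⌊y / η⌋) : |x - y| ≤ η := by
  have := Int.abs_sub_lt_one_of_floor_eq_floor h
  rw [← sub_div, abs_div, abs_of_pos hη, div_lt_one hη] at this
  exact this.le

lemma abs_sub_le_of_cell_eq {η : ℝ} {x y : ℝ × ℝ} (hη : 0 < η) (h : cell η x = cell η y) :
    |x.1 - y.1| ≤ η ∧ |x.2 - y.2| ≤ η :=
  ⟨abs_sub_le_of_floor_eq hη (Prod.ext_iff.1 h).1, abs_sub_le_of_floor_eq hη (Prod.ext_iff.1 h).2⟩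

lemma cell_mem_grid {η C : ℝ} {x : ℝ × ℝ} (hη : 0 < η) (h₁ : |x.1| ≤ C) (h₂ : |x.2| ≤ C) :
    cell η x ∈ grid (C / η) ×ˢ grid (C / η) := by
  refine Finset.mem_product.2 ⟨floor_mem_grid ?_, floor_mem_grid ?_⟩
  · rw [abs_div, abs_of_pos hη]
    gcongr
  · rw [abs_div, abs_of_pos hη]
    gcongr

lemma rescaled_sub (w : ℝ × ℝ) (X Y : ℝ) (ξ ζ : ℝ × ℝ) :
    rescaled w X Y (ξ - ζ) = rescaled w X Y ξ - rescaled w X Y ζ := by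
  simp only [rescaled, along_sub, across_sub, Prod.mk_sub_mk, Prod.mk.injEq]
  constructor <;> ring

/-- A vector of length at least `c / X` has a large rescaled first coordinate, or the eccentricity
of the rescaling is bounded. -/
lemma rescaled_alternative {w ξ : ℝ × ℝ} {X τ c C : ℝ} (hw : w.1 ^ 2 + w.2 ^ 2 = 1) (hc : 0 < c)
    (hτ : 1 ≤ τ) (hξ : c ^ 2 ≤ X ^ 2 * (ξ.1 ^ 2 + ξ.2 ^ 2))
    (hC : |(rescaled w X (X * τ) ξ).2| ≤ C) :
    c / 2 ≤ |(rescaled w X (X * τ) ξ).1| ∨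
      τ ≤ 2 * C / c ∧ c / 2 ≤ |(rescaled w X (X * τ) ξ).2| := by
  rcases le_or_gt (c / 2) |(rescaled w X (X * τ) ξ).1| with h | h
  · exact Or.inl h
  right
  have h₂ : (rescaled w X (X * τ) ξ).2 = τ * (X * across w ξ) := by
    simp only [rescaled]
    ring
  have h₃ : (X * along w ξ) ^ 2 < (c / 2) ^ 2 := by
    rw [← sq_abs (X * along w ξ)]
    exact pow_lt_pow_left₀ h (abs_nonneg _) two_ne_zero
  -- When the component along `w` is small, the one across `w` carries the length. It is still
  -- bounded by `C` after the extra dilation by `τ`, so `τ` itself is bounded.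
  have h₄ : (c / 2) ^ 2 ≤ (X * across w ξ) ^ 2 := by
    rw [← along_sq_add_across_sq hw] at hξ
    nlinarith
  have h₅ : c / 2 ≤ |X * across w ξ| := by
    rw [← sq_abs (X * across w ξ)] at h₄
    exact le_of_sq_le_sq h₄ (abs_nonneg _)
  rw [h₂, abs_mul, abs_of_pos (by linarith)] at hC ⊢
  constructor
  · rw [le_div_iff₀ hc]
    nlinarith
  · nlinarith

/-- The trilinear Kakeya estimate for slabs of bounded width, in terms of the slopes. -/
theorem exists_estimate_of_slopes {ε c C : ℝ} (hε : 0 < ε) (hc : 0 < c) (hC : 1 ≤ C) :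
    ∃ B : ℝ, 0 < B ∧ ∀ {ι₁ ι₂ ι₃ : Type} (s₁ : Finset ι₁) (s₂ : Finset ι₂) (s₃ : Finset ι₃)
      (P₁ ξ₁ : ι₁ → ℝ × ℝ) (P₂ ξ₂ : ι₂ → ℝ × ℝ) (P₃ ξ₃ : ι₃ → ℝ × ℝ) {w m : ℝ × ℝ}
      {X τ ρ R : ℝ}, w.1 ^ 2 + w.2 ^ 2 = 1 → 1 ≤ τ → 1 ≤ ρ → ρ ≤ X → 1 ≤ R →
      (∀ i ∈ s₁, |(ξ₁ i).1| ≤ 2 ∧ |(ξ₁ i).2| ≤ 2) →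
      (∀ i ∈ s₁, |(rescaled w X (X * τ) (ξ₁ i - m)).1| ≤ C ∧
        |(rescaled w X (X * τ) (ξ₁ i - m)).2| ≤ C) →
      (∀ i ∈ s₂, |(rescaled w X (X * τ) (ξ₂ i - m)).1| ≤ C ∧
        |(rescaled w X (X * τ) (ξ₂ i - m)).2| ≤ C) →
      (∀ i ∈ s₃, |(rescaled w ρ (ρ * τ) (ξ₃ i - m)).1| ≤ C ∧
        |(rescaled w ρ (ρ * τ) (ξ₃ i - m)).2| ≤ C) →
      (∀ i ∈ s₁, ∀ k ∈ s₂, c ^ 2 ≤ X ^ 2 * ((ξ₂ k - ξ₁ i).1 ^ 2 + (ξ₂ k - ξ₁ i).2 ^ 2)) →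
      (∀ i ∈ s₁, ∀ k ∈ s₃, c ^ 2 ≤ ρ ^ 2 * ((ξ₃ k - ξ₁ i).1 ^ 2 + (ξ₃ k - ξ₁ i).2 ^ 2)) →
      (∀ i ∈ s₁, ∀ k ∈ s₂, ∀ l ∈ s₃, c ≤ X * ρ * τ *
        |(ξ₂ k - ξ₁ i).1 * (ξ₃ l - ξ₁ i).2 - (ξ₂ k - ξ₁ i).2 * (ξ₃ l - ξ₁ i).1|) →
      ∀ x₀ : ℝ × ℝ × ℝ, ∫⁻ x in Metric.closedBall x₀ R,
          slabIntegrand s₁ s₂ s₃ P₁ ξ₁ P₂ ξ₂ P₃ ξ₃ 3 3 x ≤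
        ENNReal.ofReal (B * R ^ ε * √(X * τ * ρ)) * sqrtProd s₁.card s₂.card s₃.card := by
  classical
  have hC0 : 0 < C := by linarith
  -- The first term bounds differences of two rescaled slopes; the second is the bound for `τ` that
  -- `rescaled_alternative` gives with `2 * C`.
  set C' : ℝ := 2 * C + 2 * (2 * C) / c with hC'
  have hCC' : 2 * C ≤ C' := by
    have : 0 < 2 * (2 * C) / c := by positivity
    linarith
  have hCC'' : 2 * (2 * C) / c ≤ C' := by linarith
  obtain ⟨η, B, hη, hB, hest⟩ := exists_slab_estimate hε (half_pos hc) (C := C') (by linarith)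
  set J := grid (C / η) ×ˢ grid (C / η) with hJ
  refine ⟨(J.card + 1 : ℝ) ^ 3 * B, by positivity, ?_⟩
  intro ι₁ ι₂ ι₃ s₁ s₂ s₃ P₁ ξ₁ P₂ ξ₂ P₃ ξ₃ w m X τ ρ R hw hτ hρ hρX hR hξ₁ h₁ h₂ h₃ hd₂ hd₃ hdet x₀
  have hX : 1 ≤ X := hρ.trans hρX
  have hX0 : 0 < X := by linarith
  have hτ0 : 0 < τ := by linarith
  have hρ0 : 0 < ρ := by linarith
  have hR0 : 0 < R := by linarith
  refine (setLIntegral_le_of_cells (volume.restrict (Metric.closedBall x₀ R)) (J := J)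
    (f₁ := fun i => cell η (rescaled w X (X * τ) (ξ₁ i - m)))
    (f₂ := fun i => cell η (rescaled w X (X * τ) (ξ₂ i - m)))
    (f₃ := fun i => cell η (rescaled w ρ (ρ * τ) (ξ₃ i - m)))
    (fun i hi => cell_mem_grid hη (h₁ i hi).1 (h₁ i hi).2)
    (fun i hi => cell_mem_grid hη (h₂ i hi).1 (h₂ i hi).2)
    (fun i hi => cell_mem_grid hη (h₃ i hi).1 (h₃ i hi).2)
    (fun i => measurableSet_slab _ _ _ _) (fun i => measurableSet_slab _ _ _ _)
    (fun i => measurableSet_slab _ _ _ _)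
    (T := ENNReal.ofReal (B * R ^ ε * √(X * τ * ρ)) * sqrtProd s₁.card s₂.card s₃.card) ?_).trans ?_
  · intro k l n
    set r₁ := s₁.filter fun i => cell η (rescaled w X (X * τ) (ξ₁ i - m)) = k with hr₁
    set r₂ := s₂.filter fun i => cell η (rescaled w X (X * τ) (ξ₂ i - m)) = l with hr₂
    set r₃ := s₃.filter fun i => cell η (rescaled w ρ (ρ * τ) (ξ₃ i - m)) = n with hr₃
    rcases r₁.eq_empty_or_nonempty with e₁ | ⟨i₁, hi₁⟩
    · simp [e₁, multiplicity, sqrtProd]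
    rcases r₂.eq_empty_or_nonempty with e₂ | ⟨i₂, hi₂⟩
    · simp [e₂, multiplicity, sqrtProd]
    rcases r₃.eq_empty_or_nonempty with e₃ | ⟨i₃, hi₃⟩
    · simp [e₃, multiplicity, sqrtProd]
    obtain ⟨hs₁, hc₁⟩ := Finset.mem_filter.1 hi₁
    obtain ⟨hs₂, hc₂⟩ := Finset.mem_filter.1 hi₂
    obtain ⟨hs₃, hc₃⟩ := Finset.mem_filter.1 hi₃
    -- Shearing by one frequency of the first cell makes that whole cell nearly vertical. The third
    -- family is measured at its own scale `ρ`; at scale `X` its slopes acquire the factor `X / ρ`.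
    set o := ξ₁ i₁ with ho
    set D₂ := rescaled w X (X * τ) (ξ₂ i₂ - o) with hD₂
    set D₃ := rescaled w ρ (ρ * τ) (ξ₃ i₃ - o) with hD₃
    have hD₂' : D₂ = rescaled w X (X * τ) (ξ₂ i₂ - m) - rescaled w X (X * τ) (o - m) := by
      rw [hD₂, ← rescaled_sub, sub_sub_sub_cancel_right]
    have hD₃' : D₃ = rescaled w ρ (ρ * τ) (ξ₃ i₃ - m) - rescaled w ρ (ρ * τ) (o - m) := by
      rw [hD₃, ← rescaled_sub, sub_sub_sub_cancel_right]
    have ho₁ : |(rescaled w ρ (ρ * τ) (o - m)).1| ≤ C := by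
      refine le_trans ?_ (h₁ i₁ hs₁).1
      simp only [rescaled, abs_mul, abs_of_pos hX0, abs_of_pos hρ0]
      gcongr
    have ho₂ : |(rescaled w ρ (ρ * τ) (o - m)).2| ≤ C := by
      refine le_trans ?_ (h₁ i₁ hs₁).2
      simp only [rescaled, abs_mul, abs_of_pos hX0, abs_of_pos hρ0, abs_of_pos hτ0]
      gcongr
    have hα₂ : |D₂.1| ≤ 2 * C := by
      rw [hD₂']
      exact (abs_sub _ _).trans (by linarith [(h₁ i₁ hs₁).1, (h₂ i₂ hs₂).1])
    have hβ₂ : |D₂.2| ≤ 2 * C := by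
      rw [hD₂']
      exact (abs_sub _ _).trans (by linarith [(h₁ i₁ hs₁).2, (h₂ i₂ hs₂).2])
    have hα₃ : |D₃.1| ≤ 2 * C := by
      rw [hD₃']
      exact (abs_sub _ _).trans (by linarith [(h₃ i₃ hs₃).1])
    have hβ₃ : |D₃.2| ≤ 2 * C := by
      rw [hD₃']
      exact (abs_sub _ _).trans (by linarith [(h₃ i₃ hs₃).2])
    -- The rotation preserves the cross product, and the two dilations contribute `X * ρ * τ`, which
    -- exactly compensates the size of `θ`.
    have hdet' : c / 2 ≤ |D₂.1 * D₃.2 - D₂.2 * D₃.1| := by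
      have e : D₂.1 * D₃.2 - D₂.2 * D₃.1 = X * ρ * τ * ((ξ₂ i₂ - o).1 * (ξ₃ i₃ - o).2 -
          (ξ₂ i₂ - o).2 * (ξ₃ i₃ - o).1) := by
        rw [← along_mul_across_sub hw (ξ₂ i₂ - o) (ξ₃ i₃ - o)]
        simp only [hD₂, hD₃, rescaled]
        ring
      rw [e, abs_mul, abs_of_pos (by positivity)]
      linarith [hdet i₁ hs₁ i₂ hs₂ i₃ hs₃]
    have alt₂ : c / 2 ≤ |D₂.1| ∨ τ ≤ C' ∧ c / 2 ≤ |D₂.2| :=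
      (rescaled_alternative hw hc hτ (hd₂ i₁ hs₁ i₂ hs₂) hβ₂).imp_right fun h =>
        ⟨h.1.trans hCC'', h.2⟩
    have alt₃ : c / 2 ≤ |D₃.1| ∨ τ ≤ C' ∧ c / 2 ≤ |D₃.2| :=
      (rescaled_alternative hw hc hτ (hd₃ i₁ hs₁ i₃ hs₃) hβ₃).imp_right fun h =>
        ⟨h.1.trans hCC'', h.2⟩
    obtain ⟨y₀, hy₀⟩ := setLIntegral_slab_le_rescaled r₁ r₂ r₃ P₁ ξ₁ P₂ ξ₂ P₃ ξ₃ hw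
      (hξ₁ i₁ hs₁).1 (hξ₁ i₁ hs₁).2 hX hτ hR0 x₀
    have hmain := hest r₁ r₂ r₃ (fun i => rescaled w X (X * τ) (P₁ i))
      (fun i => rescaled w X (X * τ) (ξ₁ i - o)) (fun i => rescaled w X (X * τ) (P₂ i))
      (fun i => rescaled w X (X * τ) (ξ₂ i - o)) (fun i => rescaled w X (X * τ) (P₃ i))
      (fun i => rescaled w ρ (ρ * τ) (ξ₃ i - o)) (hα₂.trans hCC') (hβ₂.trans hCC')
      (hα₃.trans hCC') (hβ₃.trans hCC') hdet' alt₂ alt₃ hτ hρ hρX hR ?_ ?_ ?_ y₀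
    rotate_left
    · intro i hi
      have := abs_sub_le_of_cell_eq hη ((Finset.mem_filter.1 hi).2.trans hc₁.symm)
      rwa [← Prod.fst_sub, ← Prod.snd_sub, ← rescaled_sub, sub_sub_sub_cancel_right] at this
    · intro i hi
      have := abs_sub_le_of_cell_eq hη ((Finset.mem_filter.1 hi).2.trans hc₂.symm)
      rw [← Prod.fst_sub, ← Prod.snd_sub, ← rescaled_sub, sub_sub_sub_cancel_right] at this ⊢
      exact this
    · intro i hi
      have := abs_sub_le_of_cell_eq hη ((Finset.mem_filter.1 hi).2.trans hc₃.symm)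
      rw [← Prod.fst_sub, ← Prod.snd_sub, ← rescaled_sub, sub_sub_sub_cancel_right] at this ⊢
      exact this
    have hsmul : (fun i => (X / ρ) • rescaled w ρ (ρ * τ) (ξ₃ i - o)) =
        fun i => rescaled w X (X * τ) (ξ₃ i - o) := by
      funext i
      simp only [rescaled, Prod.smul_mk, smul_eq_mul, Prod.mk.injEq]
      constructor <;> field_simp
    rw [hsmul] at hmain
    -- The Jacobian cancels the factor `X * (X * τ)` of the slab estimate.
    refine hy₀.trans ((mul_le_mul_right hmain _).trans ?_)
    rw [← mul_assoc, ← ENNReal.ofReal_mul (by positivity)]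
    refine mul_le_mul' (le_of_eq (congrArg _ ?_)) (sqrtProd_mono ?_ ?_ ?_)
    · field_simp
    · exact_mod_cast Finset.card_filter_le _ _
    · exact_mod_cast Finset.card_filter_le _ _
    · exact_mod_cast Finset.card_filter_le _ _
  · rw [← mul_assoc, mul_assoc _ B, mul_assoc _ (B * R ^ ε),
      ENNReal.ofReal_mul (p := (J.card + 1 : ℝ) ^ 3) (by positivity)]
    gcongr
    rw [ENNReal.ofReal_pow (by positivity)]
    gcongr
    rw [← ENNReal.ofReal_natCast]
    exact ENNReal.ofReal_le_ofReal (by linarith)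

/-! ### Geometry of the tubes, the squares and the strips -/

/-- The coordinates of a point of three-dimensional Euclidean space, the last one reflected. -/
def reflectedCoordinates (x : E3) : ℝ × ℝ × ℝ := (x 0, x 1, -x 2)

lemma measurePreserving_reflectedCoordinates :
    MeasurePreserving reflectedCoordinates volume (volume : Measure (ℝ × ℝ × ℝ)) :=
  ((MeasurePreserving.id volume).prod ((MeasurePreserving.id volume).prod
    (Measure.measurePreserving_neg volume))).comp measurePreserving_coordinates

lemma reflectedCoordinates_mem_closedBall {x a : E3} {R : ℝ} (hx : x ∈ Metric.closedBall a R) :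
    reflectedCoordinates x ∈ Metric.closedBall (reflectedCoordinates a) R := by
  rw [Metric.mem_closedBall, dist_eq_norm] at hx
  have h : ∀ i, |x i - a i| ≤ R := fun i => (PiLp.norm_apply_le (x - a) i).trans hx
  refine mem_closedBall_prod.2 ⟨h 0, h 1, ?_⟩
  have h2 := h 2
  rw [abs_sub_comm] at h2
  simpa [reflectedCoordinates, neg_add_eq_sub] using h2

lemma setLIntegral_le_of_reflectedCoordinates {f : E3 → ℝ≥0∞} {g : ℝ × ℝ × ℝ → ℝ≥0∞}
    (hg : Measurable g) (h : ∀ x, f x ≤ g (reflectedCoordinates x)) (a : E3) (R : ℝ) :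
    ∫⁻ x in Metric.closedBall a R, f x ≤
      ∫⁻ x in Metric.closedBall (reflectedCoordinates a) R, g x := by
  rw [← lintegral_indicator measurableSet_closedBall,
    ← lintegral_indicator measurableSet_closedBall,
    ← measurePreserving_reflectedCoordinates.lintegral_comp
      (hg.indicator measurableSet_closedBall)]
  refine lintegral_mono fun x => ?_
  by_cases hx : x ∈ Metric.closedBall a R
  · rw [Set.indicator_of_mem hx, Set.indicator_of_mem (reflectedCoordinates_mem_closedBall hx)]
    exact h x
  · rw [Set.indicator_of_notMem hx]
    exact zero_le

/-- The direction is proportional to `(ξ, -1)`, so the reflection turns `ξ` into the slope over the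
height. Eliminating the parameter adds the error of the third coordinate times `ξ i ≤ 2`, hence the
width `1 + 2 = 3`. -/
lemma reflectedCoordinates_mem_slab {T : Tube} {ξ : E2} (hdir : T.dir = unitNormal (lift ξ))
    (hξ : ∀ i, 0 ≤ ξ i ∧ ξ i ≤ 2) {x : E3} (hx : x ∈ T.carrier) :
    reflectedCoordinates x ∈
      slab 3 3 (T.base 0 + T.base 2 * ξ 0, T.base 1 + T.base 2 * ξ 1) (ξ 0, ξ 1) := by
  obtain ⟨s, hs⟩ := hx
  rw [dist_eq_norm] at hs
  have h : ∀ i, |x i - (T.base i + s * T.dir i)| ≤ 1 := fun i => by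
    simpa using (PiLp.norm_apply_le (x - (T.base + s • T.dir)) i).trans hs
  set N := (√(1 + (lift ξ) 0 ^ 2 + (lift ξ) 1 ^ 2))⁻¹
  have h0 : T.dir 0 = N * ξ 0 := by simp [hdir, unitNormal, lift, N]
  have h1 : T.dir 1 = N * ξ 1 := by simp [hdir, unitNormal, lift, N]
  have h2 : T.dir 2 = -N := by simp [hdir, unitNormal, N]
  have e0 := h 0
  have e1 := h 1
  have e2 := h 2
  rw [h0] at e0
  rw [h1] at e1
  rw [h2] at e2
  have key : ∀ {y b c : ℝ}, 0 ≤ c ∧ c ≤ 2 → |y - (b + s * (N * c))| ≤ 1 →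
      |y - (b + T.base 2 * c) - -x 2 * c| ≤ 3 := by
    intro y b c hc hy
    have : |(x 2 - (T.base 2 + s * -N)) * c| ≤ 1 * 2 := by
      rw [abs_mul, abs_of_nonneg hc.1]
      exact mul_le_mul e2 hc.2 hc.1 zero_le_one
    calc |y - (b + T.base 2 * c) - -x 2 * c|
        = |(y - (b + s * (N * c))) + (x 2 - (T.base 2 + s * -N)) * c| := by ring_nf
      _ ≤ 1 + 1 * 2 := (abs_add_le _ _).trans (add_le_add hy this)
      _ = 3 := by norm_num
  exact ⟨key (hξ 0) e0, key (hξ 1) e1⟩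

/-- The coordinates of a vector of the plane. -/
def planeCoordinates (ξ : E2) : ℝ × ℝ := (ξ 0, ξ 1)

lemma planeCoordinates_sub (ξ ζ : E2) :
    planeCoordinates (ξ - ζ) = planeCoordinates ξ - planeCoordinates ζ := by
  simp [planeCoordinates]

lemma norm_sq_eq_planeCoordinates (ξ : E2) :
    ‖ξ‖ ^ 2 = (planeCoordinates ξ).1 ^ 2 + (planeCoordinates ξ).2 ^ 2 := by
  simp [EuclideanSpace.norm_sq_eq, Fin.sum_univ_two, planeCoordinates]

lemma abs_across_planeCoordinates_le (w ξ : E2) :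
    |across (planeCoordinates w) (planeCoordinates ξ)| ≤ ‖w‖ * ‖ξ‖ := by
  refine abs_le_of_sq_le_sq ?_ (by positivity)
  rw [mul_pow, norm_sq_eq_planeCoordinates, norm_sq_eq_planeCoordinates, across]
  nlinarith [sq_nonneg ((planeCoordinates w).1 * (planeCoordinates ξ).1 +
    (planeCoordinates w).2 * (planeCoordinates ξ).2)]

lemma abs_along_planeCoordinates_le (w ξ : E2) :
    |along (planeCoordinates w) (planeCoordinates ξ)| ≤ ‖w‖ * ‖ξ‖ := by
  refine abs_le_of_sq_le_sq ?_ (by positivity)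
  rw [mul_pow, norm_sq_eq_planeCoordinates, norm_sq_eq_planeCoordinates, along]
  nlinarith [sq_nonneg ((planeCoordinates w).1 * (planeCoordinates ξ).2 -
    (planeCoordinates w).2 * (planeCoordinates ξ).1)]

lemma norm_sub_inner_smul {w : E2} (hw : ‖w‖ = 1) (ξ : E2) :
    ‖ξ - inner ℝ ξ w • w‖ = |across (planeCoordinates w) (planeCoordinates ξ)| := by
  have hw' : w 0 ^ 2 + w 1 ^ 2 = 1 := by
    have := norm_sq_eq_planeCoordinates w
    rw [hw] at this
    simpa [planeCoordinates] using this.symm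
  rw [← sq_eq_sq₀ (norm_nonneg _) (abs_nonneg _), norm_sq_eq_planeCoordinates, sq_abs]
  simp only [planeCoordinates, across, PiLp.sub_apply, PiLp.smul_apply, smul_eq_mul,
    PiLp.inner_apply, Fin.sum_univ_two, RCLike.inner_apply, conj_trivial]
  have h1 : w 1 ^ 2 = 1 - w 0 ^ 2 := by linarith
  calc _ = (ξ 0 ^ 2 + ξ 1 ^ 2) - (w 0 * ξ 0 + w 1 * ξ 1) ^ 2 * (2 - (w 0 ^ 2 + w 1 ^ 2)) := by
        ring
    _ = (w 0 ^ 2 + w 1 ^ 2) * (ξ 0 ^ 2 + ξ 1 ^ 2) - (w 0 * ξ 0 + w 1 * ξ 1) ^ 2 := by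
        rw [hw']
        ring
    _ = _ := by ring

lemma dist_le_of_mem_square {j : ℕ} {k p q : E2} {s : ℝ} (hs : (2 : ℝ) ^ (-(j : ℝ)) ≤ s)
    (hp : p ∈ square j k) (hq : q ∈ square j k) : dist p q ≤ 2 * s := by
  have hpos : 0 < s := (Real.rpow_pos_of_pos two_pos _).trans_le hs
  have h : ∀ i, |p i - q i| ≤ s := fun i => by
    rw [abs_le]
    constructor <;> linarith [(hp i).1, (hp i).2, (hq i).1, (hq i).2]
  have h' : ∀ i, (p i - q i) ^ 2 ≤ s ^ 2 := fun i => sq_le_sq' (abs_le.1 (h i)).1 (abs_le.1 (h i)).2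
  rw [dist_eq_norm]
  refine le_of_sq_le_sq ?_ (by positivity)
  rw [norm_sq_eq_planeCoordinates]
  simp only [planeCoordinates, PiLp.sub_apply]
  nlinarith [h' 0, h' 1]

lemma corner_mem_square (j : ℕ) (k : E2) : k ∈ square j k := fun _ =>
  ⟨le_rfl, le_add_of_nonneg_right (Real.rpow_pos_of_pos two_pos _).le⟩

lemma setDist_le_dist {S S' : Set E2} {p q : E2} (hp : p ∈ S) (hq : q ∈ S') :
    setDist S S' ≤ dist p q := by
  refine csInf_le ⟨0, ?_⟩ (Set.mem_image2_of_mem hp hq)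
  rintro _ ⟨x, -, y, -, rfl⟩
  exact dist_nonneg

/-- The constant is `A` for the distance of the squares, `1` as slack for the infimum, and `2` for
the diameter of each square. -/
lemma dist_le_of_setDist_square_le {i j : ℕ} {k k' p q : E2} {A s : ℝ}
    (hi : (2 : ℝ) ^ (-(i : ℝ)) ≤ s) (hj : (2 : ℝ) ^ (-(j : ℝ)) ≤ s)
    (h : setDist (square i k) (square j k') ≤ A * s) (hp : p ∈ square i k)
    (hq : q ∈ square j k') : dist p q ≤ (A + 5) * s := by
  have hpos : 0 < s := (Real.rpow_pos_of_pos two_pos _).trans_le hi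
  have hlt : sInf (Set.image2 dist (square i k) (square j k')) < A * s + s :=
    lt_of_le_of_lt h (by linarith)
  obtain ⟨_, ⟨p', hp', q', hq', rfl⟩, hd⟩ := exists_lt_of_csInf_lt
    ⟨_, Set.mem_image2_of_mem (corner_mem_square i k) (corner_mem_square j k')⟩ hlt
  have h₁ := dist_le_of_mem_square hi hp hp'
  have h₂ := dist_le_of_mem_square hj hq' hq
  have := dist_triangle4 p p' q' q
  linarith

/-- Subtracting rows of the determinant leaves the cross product of the frequency differences,
multiplied by the normalising factors, all at most `1`. This direction suffices because
transversality enters only as a lower bound. -/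
lemma wedge_unitNormal_lift_le (ξ₁ ξ₂ ξ₃ : E2) :
    wedge (unitNormal (lift ξ₁)) (unitNormal (lift ξ₂)) (unitNormal (lift ξ₃)) ≤
      |(planeCoordinates ξ₂ - planeCoordinates ξ₁).1 *
          (planeCoordinates ξ₃ - planeCoordinates ξ₁).2 -
        (planeCoordinates ξ₂ - planeCoordinates ξ₁).2 *
          (planeCoordinates ξ₃ - planeCoordinates ξ₁).1| := by
  have hN : ∀ a b : ℝ, 0 ≤ (√(1 + a ^ 2 + b ^ 2))⁻¹ ∧ (√(1 + a ^ 2 + b ^ 2))⁻¹ ≤ 1 := fun a b =>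
    ⟨by positivity, inv_le_one_of_one_le₀ (Real.one_le_sqrt.2 (by nlinarith))⟩
  set N : E2 → ℝ := fun ξ => (√(1 + ξ 0 ^ 2 + ξ 1 ^ 2))⁻¹ with hNdef
  have hle : N ξ₁ * N ξ₂ * N ξ₃ ≤ 1 :=
    mul_le_one₀ (mul_le_one₀ (hN _ _).2 (hN _ _).1 (hN _ _).2) (hN _ _).1 (hN _ _).2
  have hnn : 0 ≤ N ξ₁ * N ξ₂ * N ξ₃ := mul_nonneg (mul_nonneg (hN _ _).1 (hN _ _).1) (hN _ _).1
  have e : (Matrix.of ![(unitNormal (lift ξ₁)).ofLp, (unitNormal (lift ξ₂)).ofLp,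
      (unitNormal (lift ξ₃)).ofLp]).det = -(N ξ₁ * N ξ₂ * N ξ₃) *
        ((planeCoordinates ξ₂ - planeCoordinates ξ₁).1 *
          (planeCoordinates ξ₃ - planeCoordinates ξ₁).2 -
        (planeCoordinates ξ₂ - planeCoordinates ξ₁).2 *
          (planeCoordinates ξ₃ - planeCoordinates ξ₁).1) := by
    simp [Matrix.det_fin_three, unitNormal, lift, planeCoordinates, hNdef]
    ring
  rw [wedge, e, abs_mul, abs_neg, abs_of_nonneg hnn]
  exact mul_le_of_le_one_left (abs_nonneg _) hle

/-- Transversality is assumed in the original order of the families, the localisation after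
reordering; a permutation of the rows changes only the sign of the determinant. -/
lemma wedge_comp_perm (σ : Equiv.Perm (Fin 3)) (u : Fin 3 → E3) :
    wedge (u (σ 0)) (u (σ 1)) (u (σ 2)) = wedge (u 0) (u 1) (u 2) := by
  have h : ∀ v : Fin 3 → E3, Matrix.of ![(v 0).ofLp, (v 1).ofLp, (v 2).ofLp] =
      Matrix.of fun i => (v i).ofLp := fun v => by
    ext i k
    fin_cases i <;> rfl
  have e := Matrix.det_permute σ (Matrix.of fun i => (u i).ofLp)
  have e' : (Matrix.of fun i => (u i).ofLp).submatrix σ id = Matrix.of fun i => (u (σ i)).ofLp :=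
    rfl
  rw [wedge, wedge, h, h fun i => u (σ i), ← e', e, abs_mul]
  rcases Int.units_eq_one_or (Equiv.Perm.sign σ) with hs | hs <;> simp [hs]

/-! ### Real integrals and the trivial estimate -/

/-- Passing from the lower Lebesgue integral to the Bochner integral. -/
lemma integral_prod_le_of_setLIntegral_le (𝒯 : Fin 3 → Finset Tube) (σ : Equiv.Perm (Fin 3))
    (D : Set E3) {K : ℝ} (hK : 0 ≤ K)
    (h : ∫⁻ x in D, sqrtProd (multiplicity (𝒯 (σ 0)) Tube.carrier x)
        (multiplicity (𝒯 (σ 1)) Tube.carrier x) (multiplicity (𝒯 (σ 2)) Tube.carrier x) ≤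
      ENNReal.ofReal K * sqrtProd (𝒯 (σ 0)).card (𝒯 (σ 1)).card (𝒯 (σ 2)).card) :
    ∫ x in D, ∏ n, (∑ T ∈ 𝒯 n, T.carrier.indicator (fun _ => (1 : ℝ)) x) ^ (1 / 2 : ℝ) ≤
      K * ∏ n, ((𝒯 n).card : ℝ) ^ (1 / 2 : ℝ) := by
  classical
  have hhalf : (0 : ℝ) ≤ 1 / 2 := by norm_num
  have hprod : ∀ f : Fin 3 → ℝ≥0∞, sqrtProd (f (σ 0)) (f (σ 1)) (f (σ 2)) =
      ∏ n, f n ^ (1 / 2 : ℝ) := fun f => by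
    rw [← Equiv.prod_comp σ, Fin.prod_univ_three, sqrtProd]
  have hcard : sqrtProd (𝒯 (σ 0)).card (𝒯 (σ 1)).card (𝒯 (σ 2)).card =
      ENNReal.ofReal (∏ n, ((𝒯 n).card : ℝ) ^ (1 / 2 : ℝ)) := by
    rw [hprod fun n => ((𝒯 n).card : ℝ≥0∞), ENNReal.ofReal_prod_of_nonneg fun _ _ => by positivity]
    refine Finset.prod_congr rfl fun n _ => ?_
    rw [← ENNReal.ofReal_rpow_of_nonneg (by positivity) hhalf, ENNReal.ofReal_natCast]
  have hnn : ∀ n x, 0 ≤ ∑ T ∈ 𝒯 n, T.carrier.indicator (fun _ => (1 : ℝ)) x := fun n x =>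
    Finset.sum_nonneg fun T _ => Set.indicator_nonneg (fun _ _ => zero_le_one) x
  have hintegrand : ∀ x, ENNReal.ofReal
      ‖∏ n, (∑ T ∈ 𝒯 n, T.carrier.indicator (fun _ => (1 : ℝ)) x) ^ (1 / 2 : ℝ)‖ =
      sqrtProd (multiplicity (𝒯 (σ 0)) Tube.carrier x)
        (multiplicity (𝒯 (σ 1)) Tube.carrier x) (multiplicity (𝒯 (σ 2)) Tube.carrier x) := by
    intro x
    rw [hprod fun n => multiplicity (𝒯 n) Tube.carrier x, Real.norm_of_nonneg
      (Finset.prod_nonneg fun n _ => Real.rpow_nonneg (hnn n x) _),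
      ENNReal.ofReal_prod_of_nonneg fun n _ => Real.rpow_nonneg (hnn n x) _]
    refine Finset.prod_congr rfl fun n _ => ?_
    rw [← ENNReal.ofReal_rpow_of_nonneg (hnn n x) hhalf, ENNReal.ofReal_sum_of_nonneg
      fun T _ => Set.indicator_nonneg (fun _ _ => zero_le_one) x]
    congr 1
    refine Finset.sum_congr rfl fun T _ => ?_
    by_cases hx : x ∈ T.carrier <;> simp [hx]
  -- The norm of the Bochner integral is controlled by the lower Lebesgue integral of the norm in
  -- every case, so integrability need not be discussed.
  refine (Real.le_norm_self _).trans ((norm_integral_le_lintegral_norm _).trans ?_)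
  refine ENNReal.toReal_le_of_le_ofReal
    (mul_nonneg hK (Finset.prod_nonneg fun _ _ => by positivity)) ?_
  simp_rw [hintegrand]
  rwa [ENNReal.ofReal_mul hK, ← hcard]

/-- The trivial estimate, by the volume of the ball. -/
lemma setLIntegral_closedBall_sqrtProd_le (𝒯₁ 𝒯₂ 𝒯₃ : Finset Tube) (a : E3) {R : ℝ}
    (hR : 0 < R) :
    ∫⁻ x in Metric.closedBall a R, sqrtProd (multiplicity 𝒯₁ Tube.carrier x)
        (multiplicity 𝒯₂ Tube.carrier x) (multiplicity 𝒯₃ Tube.carrier x) ≤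
      ENNReal.ofReal (8 * R ^ 3) * sqrtProd 𝒯₁.card 𝒯₂.card 𝒯₃.card := by
  refine (setLIntegral_le_of_reflectedCoordinates
    (g := fun _ => sqrtProd 𝒯₁.card 𝒯₂.card 𝒯₃.card) measurable_const (fun x => sqrtProd_mono
      (multiplicity_le_card _ _ _) (multiplicity_le_card _ _ _) (multiplicity_le_card _ _ _))
    a R).trans ?_
  rw [setLIntegral_const, volume_closedBall_prod _ hR.le, mul_comm]
  refine le_of_eq (congrArg (ENNReal.ofReal · * _) ?_)
  ring

/-! ### From the type condition to the theorem -/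

/-- The part of the type condition that is used, after reordering. -/
lemma IsOfType.exists_directions {A : ℝ} {r j t : ℕ} {w m : E2} {𝒯 : Fin 3 → Finset Tube}
    (h : IsOfType A r j t w m 𝒯) (hA : 1 ≤ A) :
    ∃ (σ : Equiv.Perm (Fin 3)) (k k' k'' w' : E2) (ξ₁ ξ₂ ξ₃ : Tube → E2),
      (∀ T ∈ 𝒯 (σ 0), T.dir = unitNormal (lift (ξ₁ T)) ∧
        ξ₁ T ∈ square j k ∩ strip (j + t) w m) ∧
      (∀ T ∈ 𝒯 (σ 1), T.dir = unitNormal (lift (ξ₂ T)) ∧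
        ξ₂ T ∈ square j k' ∩ strip (j + t) w m) ∧
      (∀ T ∈ 𝒯 (σ 2), T.dir = unitNormal (lift (ξ₃ T)) ∧
        ξ₃ T ∈ square r k'' ∩ strip (r + t) w' m) ∧
      (∀ T₁ ∈ 𝒯 (σ 0), ∀ T₂ ∈ 𝒯 (σ 1), ∀ T₃ ∈ 𝒯 (σ 2),
        A⁻¹ * (A⁻¹ * ((2 : ℝ) ^ (-(j : ℝ)) * (2 : ℝ) ^ (-(r : ℝ)) * (2 : ℝ) ^ (-(t : ℝ)))) ≤
          wedge (unitNormal (lift (ξ₁ T₁))) (unitNormal (lift (ξ₂ T₂)))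
            (unitNormal (lift (ξ₃ T₃)))) ∧
      m ∈ square j k ∧
      Comparable A (setDist (square j k) (square j k')) ((2 : ℝ) ^ (-(j : ℝ))) ∧
      Comparable A (setDist (square j k) (square r k'')) ((2 : ℝ) ^ (-(r : ℝ))) ∧
      ‖w'‖ = 1 ∧ ‖w - w'‖ ≤ A * (2 : ℝ) ^ (-(t : ℝ)) := by
  obtain ⟨-, -, S, θ, -, hθ, hdir, σ, k, k', k'', w', hS₀, hS₁, hS₂, hm, hkk', -, hkk'', hw', hww',
    hθ'⟩ := h
  have h₀ : ∀ T, ∃ ξ : E2, T ∈ 𝒯 (σ 0) → lift ξ ∈ S (σ 0) ∧ T.dir = unitNormal (lift ξ) ∧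
      ξ ∈ square j k ∩ strip (j + t) w m := fun T => by
    by_cases hT : T ∈ 𝒯 (σ 0)
    · obtain ⟨p, hp, hd⟩ := hdir _ T hT
      obtain ⟨ξ, hξ, rfl⟩ := hS₀ hp
      exact ⟨ξ, fun _ => ⟨hp, hd, hξ⟩⟩
    · exact ⟨0, fun h => absurd h hT⟩
  have h₁ : ∀ T, ∃ ξ : E2, T ∈ 𝒯 (σ 1) → lift ξ ∈ S (σ 1) ∧ T.dir = unitNormal (lift ξ) ∧
      ξ ∈ square j k' ∩ strip (j + t) w m := fun T => by
    by_cases hT : T ∈ 𝒯 (σ 1)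
    · obtain ⟨p, hp, hd⟩ := hdir _ T hT
      obtain ⟨ξ, hξ, rfl⟩ := hS₁ hp
      exact ⟨ξ, fun _ => ⟨hp, hd, hξ⟩⟩
    · exact ⟨0, fun h => absurd h hT⟩
  have h₂ : ∀ T, ∃ ξ : E2, T ∈ 𝒯 (σ 2) → lift ξ ∈ S (σ 2) ∧ T.dir = unitNormal (lift ξ) ∧
      ξ ∈ square r k'' ∩ strip (r + t) w' m := fun T => by
    by_cases hT : T ∈ 𝒯 (σ 2)
    · obtain ⟨p, hp, hd⟩ := hdir _ T hT
      obtain ⟨ξ, hξ, rfl⟩ := hS₂ hp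
      exact ⟨ξ, fun _ => ⟨hp, hd, hξ⟩⟩
    · exact ⟨0, fun h => absurd h hT⟩
  choose ξ₁ hξ₁ using h₀
  choose ξ₂ hξ₂ using h₁
  choose ξ₃ hξ₃ using h₂
  refine ⟨σ, k, k', k'', w', ξ₁, ξ₂, ξ₃, fun T hT => (hξ₁ T hT).2, fun T hT => (hξ₂ T hT).2,
    fun T hT => (hξ₃ T hT).2, ?_, hm, hkk', hkk'', hw', hww'.2⟩
  intro T₁ hT₁ T₂ hT₂ T₃ hT₃
  set q : Fin 3 → E3 := ![lift (ξ₁ T₁), lift (ξ₂ T₂), lift (ξ₃ T₃)] with hq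
  have hqS : ∀ i, q i ∈ S (σ i) := fun i => by
    fin_cases i
    · exact (hξ₁ T₁ hT₁).1
    · exact (hξ₂ T₂ hT₂).1
    · exact (hξ₃ T₃ hT₃).1
  have hpS : ∀ n, q (σ.symm n) ∈ S n := fun n => by
    simpa using hqS (σ.symm n)
  have hwedge := (hθ _ (hpS 0) _ (hpS 1) _ (hpS 2)).1
  have hperm := wedge_comp_perm σ.symm fun i => unitNormal (q i)
  rw [hperm] at hwedge
  have hA0 : 0 < A := by linarith
  exact (mul_le_mul_of_nonneg_left hθ'.1 (inv_pos.2 hA0).le).trans hwedge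

/-- The estimate for balls of radius at least one. -/
theorem exists_setLIntegral_le_of_isOfType {A ε : ℝ} (hA : 1 ≤ A) (hε : 0 < ε) :
    ∃ B : ℝ, 0 < B ∧ ∀ (r j t : ℕ) (w m : E2) (𝒯 : Fin 3 → Finset Tube),
      IsOfType A r j t w m 𝒯 → ∃ σ : Equiv.Perm (Fin 3), ∀ (a : E3) (R : ℝ), 1 ≤ R →
        ∫⁻ x in Metric.closedBall a R, sqrtProd (multiplicity (𝒯 (σ 0)) Tube.carrier x)
          (multiplicity (𝒯 (σ 1)) Tube.carrier x) (multiplicity (𝒯 (σ 2)) Tube.carrier x) ≤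
        ENNReal.ofReal (B * R ^ ε * (2 : ℝ) ^ (((j : ℝ) + t + r) / 2)) *
          sqrtProd (𝒯 (σ 0)).card (𝒯 (σ 1)).card (𝒯 (σ 2)).card := by
  have hA0 : 0 < A := by linarith
  -- `A ^ 2` appears because the wedge is compared with `θ` and `θ` with the product of scales. In
  -- `C`, the `1` is the strip width and `A * (A + 5)` the price of replacing `w'` by `w` in the
  -- third strip.
  obtain ⟨B, hB, hest⟩ := exists_estimate_of_slopes hε (c := (A ^ 2)⁻¹) (C := 1 + A * (A + 5))
    (by positivity) (by nlinarith)
  refine ⟨B, hB, fun r j t w m 𝒯 htype => ?_⟩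
  obtain ⟨σ, k, k', k'', w', ξ₁, ξ₂, ξ₃, hξ₁, hξ₂, hξ₃, hwedge, hm, hkk', hkk'', hw', hww'⟩ :=
    htype.exists_directions hA
  obtain ⟨hw, hrj, -⟩ := htype
  refine ⟨σ, fun a R hR => ?_⟩
  set X : ℝ := (2 : ℝ) ^ (j : ℝ) with hX
  set ρ : ℝ := (2 : ℝ) ^ (r : ℝ) with hρ
  set τ : ℝ := (2 : ℝ) ^ (t : ℝ) with hτ
  have hX0 : 0 < X := Real.rpow_pos_of_pos two_pos _
  have hρ0 : 0 < ρ := Real.rpow_pos_of_pos two_pos _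
  have hτ0 : 0 < τ := Real.rpow_pos_of_pos two_pos _
  have hρ1 : 1 ≤ ρ := Real.one_le_rpow one_le_two (Nat.cast_nonneg _)
  have hτ1 : 1 ≤ τ := Real.one_le_rpow one_le_two (Nat.cast_nonneg _)
  have hρX : ρ ≤ X := Real.rpow_le_rpow_of_exponent_le one_le_two (by exact_mod_cast hrj)
  have hXinv : (2 : ℝ) ^ (-(j : ℝ)) = X⁻¹ := Real.rpow_neg two_pos.le _
  have hρinv : (2 : ℝ) ^ (-(r : ℝ)) = ρ⁻¹ := Real.rpow_neg two_pos.le _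
  have hτinv : (2 : ℝ) ^ (-(t : ℝ)) = τ⁻¹ := Real.rpow_neg two_pos.le _
  have hXτinv : (2 : ℝ) ^ (-((j + t : ℕ) : ℝ)) = (X * τ)⁻¹ := by
    rw [Real.rpow_neg two_pos.le, Nat.cast_add, Real.rpow_add two_pos]
  have hρτinv : (2 : ℝ) ^ (-((r + t : ℕ) : ℝ)) = (ρ * τ)⁻¹ := by
    rw [Real.rpow_neg two_pos.le, Nat.cast_add, Real.rpow_add two_pos]
  rw [hXinv] at hkk'
  rw [hρinv] at hkk''
  rw [hτinv] at hww'
  simp only [hXinv, hρinv, hτinv] at hwedge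
  have hXρ : (2 : ℝ) ^ (-(j : ℝ)) ≤ ρ⁻¹ := by
    rw [hXinv]
    gcongr
  have hpc : ∀ {T : Tube} {ξ : E2}, T.dir = unitNormal (lift ξ) → (∀ i, 0 ≤ ξ i ∧ ξ i ≤ 2) → ∀ {x : E3},
      x ∈ T.carrier → reflectedCoordinates x ∈ slab 3 3
        (T.base 0 + T.base 2 * ξ 0, T.base 1 + T.base 2 * ξ 1) (planeCoordinates ξ) :=
    fun hd hξ _ hx => reflectedCoordinates_mem_slab hd hξ hx
  have hwc : (planeCoordinates w).1 ^ 2 + (planeCoordinates w).2 ^ 2 = 1 := by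
    rw [← norm_sq_eq_planeCoordinates, hw, one_pow]
  have halong : ∀ {Z D : ℝ} {ξ : E2}, 0 < Z → dist ξ m ≤ D * Z⁻¹ →
      |Z * along (planeCoordinates w) (planeCoordinates ξ - planeCoordinates m)| ≤ D := by
    intro Z D ξ hZ hξ
    rw [abs_mul, abs_of_pos hZ, ← planeCoordinates_sub]
    calc Z * |along (planeCoordinates w) (planeCoordinates (ξ - m))| ≤ Z * (D * Z⁻¹) := by
          gcongr
          refine (abs_along_planeCoordinates_le _ _).trans ?_
          rwa [hw, one_mul, ← dist_eq_norm]
      _ = D := by field_simp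
  have hacross : ∀ {ξ : E2}, ξ ∈ strip (j + t) w m →
      |X * τ * across (planeCoordinates w) (planeCoordinates ξ - planeCoordinates m)| ≤ 1 := by
    intro ξ hξ
    have := hξ.2
    rw [norm_sub_inner_smul hw, hXτinv, planeCoordinates_sub] at this
    rw [abs_mul, abs_of_pos (by positivity)]
    calc _ ≤ X * τ * (X * τ)⁻¹ := by gcongr
      _ = 1 := by field_simp
  have hd₁ : ∀ T ∈ 𝒯 (σ 0), dist (ξ₁ T) m ≤ 2 * X⁻¹ := fun T hT =>
    dist_le_of_mem_square hXinv.le (hξ₁ T hT).2.1 hm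
  have hd₂ : ∀ T ∈ 𝒯 (σ 1), dist (ξ₂ T) m ≤ (A + 5) * X⁻¹ := fun T hT => by
    rw [dist_comm]
    exact dist_le_of_setDist_square_le hXinv.le hXinv.le hkk'.2 hm (hξ₂ T hT).2.1
  have hd₃ : ∀ T ∈ 𝒯 (σ 2), dist (ξ₃ T) m ≤ (A + 5) * ρ⁻¹ := fun T hT => by
    rw [dist_comm]
    exact dist_le_of_setDist_square_le hXρ hρinv.le hkk''.2 hm (hξ₃ T hT).2.1
  have hlower : ∀ {Z : ℝ} {ξ ζ : E2}, 0 < Z → A⁻¹ * Z⁻¹ ≤ dist ξ ζ →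
      ((A ^ 2)⁻¹) ^ 2 ≤ Z ^ 2 * ((planeCoordinates ζ - planeCoordinates ξ).1 ^ 2 +
        (planeCoordinates ζ - planeCoordinates ξ).2 ^ 2) := by
    intro Z ξ ζ hZ h
    rw [← planeCoordinates_sub, ← norm_sq_eq_planeCoordinates, ← mul_pow, ← dist_eq_norm,
      dist_comm]
    gcongr
    calc (A ^ 2)⁻¹ ≤ A⁻¹ := by
          gcongr
          nlinarith
      _ = Z * (A⁻¹ * Z⁻¹) := by field_simp
      _ ≤ _ := by gcongr
  have hmain := hest (𝒯 (σ 0)) (𝒯 (σ 1)) (𝒯 (σ 2))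
    (fun T => (T.base 0 + T.base 2 * ξ₁ T 0, T.base 1 + T.base 2 * ξ₁ T 1))
    (fun T => planeCoordinates (ξ₁ T))
    (fun T => (T.base 0 + T.base 2 * ξ₂ T 0, T.base 1 + T.base 2 * ξ₂ T 1))
    (fun T => planeCoordinates (ξ₂ T))
    (fun T => (T.base 0 + T.base 2 * ξ₃ T 0, T.base 1 + T.base 2 * ξ₃ T 1))
    (fun T => planeCoordinates (ξ₃ T)) (w := planeCoordinates w) (m := planeCoordinates m)
    (X := X) (τ := τ) (ρ := ρ) (R := R) hwc hτ1 hρ1 hρX hR ?_ ?_ ?_ ?_ ?_ ?_ ?_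
    (reflectedCoordinates a)
  · refine (setLIntegral_le_of_reflectedCoordinates (measurable_sqrtProd
      (measurable_multiplicity (𝒯 (σ 0)) fun T => measurableSet_slab 3 3
        (T.base 0 + T.base 2 * ξ₁ T 0, T.base 1 + T.base 2 * ξ₁ T 1) (planeCoordinates (ξ₁ T)))
      (measurable_multiplicity (𝒯 (σ 1)) fun T => measurableSet_slab 3 3
        (T.base 0 + T.base 2 * ξ₂ T 0, T.base 1 + T.base 2 * ξ₂ T 1) (planeCoordinates (ξ₂ T)))
      (measurable_multiplicity (𝒯 (σ 2)) fun T => measurableSet_slab 3 3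
        (T.base 0 + T.base 2 * ξ₃ T 0, T.base 1 + T.base 2 * ξ₃ T 1) (planeCoordinates (ξ₃ T))))
      (fun x => sqrtProd_mono ?_ ?_ ?_) a R).trans (hmain.trans ?_)
    · exact multiplicity_le_of_imp fun T hT hx => hpc (hξ₁ T hT).1 (hξ₁ T hT).2.2.1 hx
    · exact multiplicity_le_of_imp fun T hT hx => hpc (hξ₂ T hT).1 (hξ₂ T hT).2.2.1 hx
    · exact multiplicity_le_of_imp fun T hT hx => hpc (hξ₃ T hT).1 (hξ₃ T hT).2.2.1 hx
    · have hsqrt : √(X * τ * ρ) = (2 : ℝ) ^ (((j : ℝ) + t + r) / 2) := by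
        rw [hX, hτ, hρ, ← Real.rpow_add two_pos, ← Real.rpow_add two_pos, Real.sqrt_eq_rpow,
          ← Real.rpow_mul two_pos.le]
        ring_nf
      rw [hsqrt]
  · intro T hT
    have h := (hξ₁ T hT).2.2.1
    simp only [planeCoordinates]
    exact ⟨by rw [abs_of_nonneg (h 0).1]; exact (h 0).2,
      by rw [abs_of_nonneg (h 1).1]; exact (h 1).2⟩
  · intro T hT
    exact ⟨(halong hX0 (hd₁ T hT)).trans (by nlinarith),
      (hacross (hξ₁ T hT).2.2).trans (by nlinarith)⟩
  · intro T hT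
    exact ⟨(halong hX0 (hd₂ T hT)).trans (by nlinarith),
      (hacross (hξ₂ T hT).2.2).trans (by nlinarith)⟩
  · intro T hT
    refine ⟨(halong hρ0 (hd₃ T hT)).trans (by nlinarith), ?_⟩
    set u := ξ₃ T - m with hu
    have h₁ : |across (planeCoordinates w') (planeCoordinates u)| ≤ (ρ * τ)⁻¹ := by
      have := (hξ₃ T hT).2.2.2
      rwa [norm_sub_inner_smul hw', hρτinv] at this
    -- Tilting the axis from `w'` to `w` moves the perpendicular component by at most `‖w - w'‖ *
    -- ‖u‖`, which is of the same order `(ρ * τ)⁻¹` as the width of the strip.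
    have h₂ : |across (planeCoordinates (w - w')) (planeCoordinates u)| ≤
        A * τ⁻¹ * ((A + 5) * ρ⁻¹) := by
      refine (abs_across_planeCoordinates_le _ _).trans ?_
      have := hd₃ T hT
      rw [dist_eq_norm] at this
      gcongr
    have h₃ : across (planeCoordinates w) (planeCoordinates u) =
        across (planeCoordinates w') (planeCoordinates u) +
          across (planeCoordinates (w - w')) (planeCoordinates u) := by
      simp only [across, planeCoordinates_sub, Prod.fst_sub, Prod.snd_sub]
      ring
    simp only [rescaled]
    rw [← planeCoordinates_sub, abs_mul, abs_of_pos (by positivity), h₃]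
    calc _ ≤ ρ * τ * ((ρ * τ)⁻¹ + A * τ⁻¹ * ((A + 5) * ρ⁻¹)) := by
          gcongr
          exact (abs_add_le _ _).trans (add_le_add h₁ h₂)
      _ = 1 + A * (A + 5) := by field_simp
  · intro T hT T' hT'
    exact hlower hX0 (hkk'.1.trans (setDist_le_dist (hξ₁ T hT).2.1 (hξ₂ T' hT').2.1))
  · intro T hT T' hT'
    exact hlower hρ0 (hkk''.1.trans (setDist_le_dist (hξ₁ T hT).2.1 (hξ₃ T' hT').2.1))
  · intro T₁ hT₁ T₂ hT₂ T₃ hT₃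
    have h := (hwedge T₁ hT₁ T₂ hT₂ T₃ hT₃).trans (wedge_unitNormal_lift_le _ _ _)
    calc (A ^ 2)⁻¹ = X * ρ * τ * (A⁻¹ * (A⁻¹ * (X⁻¹ * ρ⁻¹ * τ⁻¹))) := by field_simp
      _ ≤ _ := by gcongr

end TrilinearKakeya

open MeasureTheory TrilinearKakeya in
theorem mainTheorem2 (A : ℝ) (hA : 1 ≤ A) (ε : ℝ) (hε : 0 < ε) :
    ∃ C : ℝ, ∀ (r j t : ℕ) (w m : E2) (𝒯 : Fin 3 → Finset Tube),
      IsOfType A r j t w m 𝒯 →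
      ∀ (a : E3) (R : ℝ), 0 < R → (1 ≤ R ∨ ε ≤ 3) →
        ∫ x in Metric.closedBall a R,
            ∏ n, (∑ T ∈ 𝒯 n, T.carrier.indicator (fun _ => (1 : ℝ)) x) ^ (1 / 2 : ℝ)
          ≤ C * R ^ ε * (2 : ℝ) ^ (((j : ℝ) + t + r) / 2) *
              ∏ n, ((𝒯 n).card : ℝ) ^ (1 / 2 : ℝ) := by
  obtain ⟨B, hB, hest⟩ := exists_setLIntegral_le_of_isOfType hA hε
  refine ⟨B + 8, fun r j t w m 𝒯 htype a R hR hRε => ?_⟩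
  have h2 : 1 ≤ (2 : ℝ) ^ (((j : ℝ) + t + r) / 2) := Real.one_le_rpow one_le_two (by positivity)
  rcases le_or_gt 1 R with h1 | h1
  · obtain ⟨σ, hσ⟩ := hest r j t w m 𝒯 htype
    refine integral_prod_le_of_setLIntegral_le 𝒯 σ _ (by positivity) ((hσ a R h1).trans ?_)
    gcongr
    linarith
  · have hε3 : ε ≤ 3 := hRε.resolve_left h1.not_ge
    refine integral_prod_le_of_setLIntegral_le 𝒯 1 _ (by positivity)
      ((setLIntegral_closedBall_sqrtProd_le _ _ _ a hR).trans ?_)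
    gcongr ENNReal.ofReal ?_ * _
    have hpow : R ^ 3 ≤ R ^ ε := by
      rw [← Real.rpow_natCast]
      exact Real.rpow_le_rpow_of_exponent_ge hR h1.le (by exact_mod_cast hε3)
    have hRε0 : 0 < R ^ ε := Real.rpow_pos_of_pos hR _
    calc 8 * R ^ 3 ≤ (B + 8) * R ^ ε * 1 := by nlinarith
      _ ≤ _ := by gcongr
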